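/- Let $k\ge 1$, $n\ge 2$, $t\ge 1$ be integers. Place the integers $1,\dots,k(n-1),-1,\dots,-k(n-1)$ clockwise on the outer circle of an annulus and $k(n-1)+1,\dots,kn,-(k(n-1)+1),\dots,-kn$ counterclockwise on its inner circle. A partition of $\{\pm1,\dots,\pm kn\}$ is non-crossing on the annulus if its blocks can be drawn inside the annulus without crossings, a block being drawn by listing its elements $e_1,\dots,e_r$ with first its outer elements in clockwise order and then its inner elements in counterclockwise order, and joining $e_i$ to $e_{i+1}$ for $1\le i\le r$, where $e_{r+1}=e_1$. For a block $V$ let $-V=\{-x: x\in V\}$; a zero-block is a block with $V=-V$. Let $NC^k_D(n)$ be the set of partitions $\pi$ of $\{\pm1,\dots,\pm kn\}$ such that: (1) if $V$ is a block of $\pi$, then so is $-V$; (2) $\pi$ has a non-crossing drawing on the annulus in which the elements $e_1,\dots,e_r$ of every block, in the order of the drawing, satisfy $|e_{i+1}|\equiv|e_i|+1 \pmod k$ for $1\le i\le r$; (3) every zero-block contains all integers of the inner circle and at least two integers of the outer circle; (4) if no block of $\pi$ meets both circles, then for every block $U$ on the inner circle and every visible block $V$ on the outer circle (in a centrally symmetric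 drawing, no other block lies between $V$ and the inner circle), the partition obtained from $\pi$ by replacing $U,V$ by $U\cup V$ and $-U,-V$ by $-(U\cup V)$ again satisfies (2). The size of an unordered pair $\{V,-V\}$ is $\tfrac12|V\cup(-V)|$ (a zero-block $V$ forms a pair of size $\tfrac12|V|$). Then the sum over all $\pi\in NC^k_D(n)$ of the number of pairs $\{V,-V\}$ of blocks of $\pi$ of size $tk$ is $$(k(n-1)+1)\binom{(k+1)(n-1)-t}{k(n-1)-1}+k(n-1)\binom{(k+1)(n-1)-t-1}{k(n-1)-2}.$$ Here $\binom ab=0$ unless $0\le b\le a$, except that $\binom{-1}{-1}=1$ (this occurs only for $k=1$, $n=2$, $t=2$). -/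

import Mathlib

namespace TypeD

/-- The ground set `{1, 2, ..., kn, -1, -2, ..., -kn}`. -/
noncomputable def points (k n : ℕ) : Finset ℤ :=
  (Finset.Icc (-((k : ℤ) * n)) ((k : ℤ) * n)).erase 0

/-- The number `N = k(n-1)`; the outer circle carries the `2N` integers `x` with `|x| ≤ N`,
the inner circle the remaining `2k` integers of the ground set. -/
def outerHalf (k n : ℕ) : ℤ := (k : ℤ) * ((n : ℤ) - 1)

/-- `x` lies on the outer circle. -/
def OnOuter (k n : ℕ) (x : ℤ) : Prop := |x| ≤ outerHalf k n

instance (k n : ℕ) (x : ℤ) : Decidable (OnOuter k n x) :=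
  inferInstanceAs (Decidable (_ ≤ _))

/-- Position of `x` on the outer circle, read clockwise: `1, 2, ..., N, -1, ..., -N`
have positions `0, 1, ..., N-1, N, ..., 2N-1`. -/
def outerPos (k n : ℕ) (x : ℤ) : ℤ :=
  if 0 < x then x - 1 else outerHalf k n - x - 1

/-- Position of `x` on the inner circle, read counterclockwise:
`N+1, ..., N+k, -(N+1), ..., -(N+k)` have positions `0, ..., k-1, k, ..., 2k-1`. -/
def innerPos (k n : ℕ) (x : ℤ) : ℤ :=
  if 0 < x then x - outerHalf k n - 1 else (k : ℤ) - x - outerHalf k n - 1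

/-- Cut the annulus open along an arc that joins the two circles, meeting the outer circle just
before position `a` and the inner circle just before position `b`.  The result is a disc, and its
boundary reads the outer circle clockwise from position `a` on, and then the inner circle
counterclockwise from position `b` on. `cutPos k n a b x` is the place of `x` in this reading. -/
def cutPos (k n : ℕ) (a b x : ℤ) : ℤ :=
  if OnOuter k n x then (outerPos k n x - a) % (2 * outerHalf k n)
  else 2 * outerHalf k n + (innerPos k n x - b) % (2 * (k : ℤ))

/-- The collection of blocks `P` is non-crossing with respect to the linear order given by `p`:
there are no `x < y < z < w` with `x, z` in one block and `y, w` in another. -/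
def NonCrossing (P : Finset (Finset ℤ)) (p : ℤ → ℤ) : Prop :=
  ∀ V ∈ P, ∀ W ∈ P, V ≠ W → ∀ x ∈ V, ∀ z ∈ V, ∀ y ∈ W, ∀ w ∈ W,
    ¬ (p x < p y ∧ p y < p z ∧ p z < p w)

/-- If `e_1, ..., e_t` are the elements of `V` in the order given by `p` and `e_{t+1} = e_1`,
then `e` and `e'` are `e_i` and `e_{i+1}` for some `i` in `1, ..., t`. -/
def IsNext (p : ℤ → ℤ) (V : Finset ℤ) (e e' : ℤ) : Prop :=
  e ∈ V ∧ e' ∈ V ∧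
    ((p e < p e' ∧ ∀ x ∈ V, ¬ (p e < p x ∧ p x < p e')) ∨
      ((∀ x ∈ V, p x ≤ p e) ∧ ∀ x ∈ V, p e' ≤ p x))

/-- The congruence condition on every block, its elements being listed in the order `p`:
`|e_{i+1}| ≡ |e_i| + 1 mod k` for `i = 1, ..., t`, where `e_{t+1} = e_1`. -/
def CongruenceCondition (k : ℕ) (P : Finset (Finset ℤ)) (p : ℤ → ℤ) : Prop :=
  ∀ V ∈ P, ∀ e e' : ℤ, IsNext p V e e' → |e'| ≡ |e| + 1 [ZMOD (k : ℤ)]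

/-- The blocks of `P` can be drawn in the annulus without crossings in such a way that every
block, its elements being listed in the order of the drawing (`e_1, ..., e_s` clockwise on the
outer circle, then `e_{s+1}, ..., e_t` counterclockwise on the inner circle), satisfies the
congruence condition.

Drawings without crossings are described by cuts. If some block meets both circles, no curve
crosses a cut that runs alongside the curve from the last inner point `e_t` of the block back to
its first outer point `e_1`, and the disc order given by this cut lists the block as
`e_1, ..., e_t`; if no block does, any cut can be used. Conversely a non-crossing
drawing in the cut disc is one in the annulus. -/
def IsAnnularDivisible (k n : ℕ) (P : Finset (Finset ℤ)) : Prop :=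
  ∃ a b : ℤ, NonCrossing P (cutPos k n a b) ∧ CongruenceCondition k P (cutPos k n a b)

/-- The block `-V`. -/
def negBlock (V : Finset ℤ) : Finset ℤ := V.image (fun x => -x)

/-- All elements of the block lie on the outer circle. -/
def IsOuterBlock (k n : ℕ) (V : Finset ℤ) : Prop := ∀ x ∈ V, OnOuter k n x

/-- All elements of the block lie on the inner circle. -/
def IsInnerBlock (k n : ℕ) (V : Finset ℤ) : Prop := ∀ x ∈ V, ¬ OnOuter k n x

/-- The outer points `x, y, z, w` are distinct and are met in this order when one goes
clockwise once around the outer circle, starting from `x`. -/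
def OuterCyclic (k n : ℕ) (x y z w : ℤ) : Prop :=
  0 < (outerPos k n y - outerPos k n x) % (2 * outerHalf k n) ∧
  (outerPos k n y - outerPos k n x) % (2 * outerHalf k n) <
    (outerPos k n z - outerPos k n x) % (2 * outerHalf k n) ∧
  (outerPos k n z - outerPos k n x) % (2 * outerHalf k n) <
    (outerPos k n w - outerPos k n x) % (2 * outerHalf k n)

/-- `V` is a visible block: it lies on the outer circle and no other block lies between it and the
inner circle. The partition is drawn centrally symmetrically, so that a block `W` of the
outer circle, or its opposite `-W`, lies between `V` and the inner circle exactly if `W ≠ V, -V`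
and `W` separates some point `v` of `V` from its opposite `-v`. -/
def IsVisible (k n : ℕ) (P : Finset (Finset ℤ)) (V : Finset ℤ) : Prop :=
  V ∈ P ∧ IsOuterBlock k n V ∧
    ¬ ∃ W ∈ P, IsOuterBlock k n W ∧ W ≠ V ∧ W ≠ negBlock V ∧
      ∃ w ∈ W, ∃ w' ∈ W, ∃ v ∈ V, OuterCyclic k n w v w' (-v)

/-- The partition obtained from `P` by joining `U` and `V` to one block, and, symmetrically,
`-U` and `-V`. -/
def join (P : Finset (Finset ℤ)) (U V : Finset ℤ) : Finset (Finset ℤ) :=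
  (P \ {U, V, negBlock U, negBlock V}) ∪ {U ∪ V, negBlock (U ∪ V)}

/-- The `k`-divisible non-crossing partitions of type `D_n`. -/
structure IsNCD (k n : ℕ) (π : Finpartition (points k n)) : Prop where
  /-- If `V` is a block then so is `-V`. -/
  neg_mem : ∀ V ∈ π.parts, negBlock V ∈ π.parts
  /-- The partition is non-crossing on the annulus and satisfies the congruence condition. -/
  annular : IsAnnularDivisible k n π.parts
  /-- A zero-block contains the whole inner circle and at least two outer points. -/
  zero_block : ∀ V ∈ π.parts, negBlock V = V →
    (∀ x ∈ points k n, ¬ OnOuter k n x → x ∈ V) ∧ 2 ≤ (V.filter (OnOuter k n)).card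
  /-- If no block meets both circles, then joining any inner block with any visible block
  preserves the congruence condition. -/
  inner_visible : (∀ V ∈ π.parts, IsOuterBlock k n V ∨ IsInnerBlock k n V) →
    ∀ U ∈ π.parts, IsInnerBlock k n U → ∀ V, IsVisible k n π.parts V →
      IsAnnularDivisible k n (join π.parts U V)

open Classical in
/-- The set `NC^k_D(n)`. -/
noncomputable def NCD (k n : ℕ) : Finset (Finpartition (points k n)) :=
  Finset.univ.filter (IsNCD k n)

/-- The set of unordered pairs `{V, -V}`, `V` a block of `P`, whose size `|V ∪ (-V)| / 2`
equals `s`. A zero-block `V = -V` gives the pair `{V}`. -/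
def pairsOfSize (P : Finset (Finset ℤ)) (s : ℕ) : Finset (Finset (Finset ℤ)) :=
  (P.filter (fun V => (V ∪ negBlock V).card = 2 * s)).image (fun V => {V, negBlock V})

/-- The binomial coefficient for integer arguments: the usual one for `0 ≤ b ≤ a`, equal to `1` for
`a = b` (also when `a = b < 0`), and `0` in all other cases. -/
def binom (a b : ℤ) : ℕ :=
  if a = b then 1 else if 0 ≤ b ∧ b ≤ a then Nat.choose a.toNat b.toNat else 0

end TypeD

/-! Write N = k(n-1), so that the outer circle has 2N points and antipodal points are N positions
apart. A partition is encoded by a sequence `g` of period N: `g i` is the size, divided by k, of the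
block that starts at the outer position i, and 0 if no block starts there. A block starts at i if it
contains i but no point of the half circle before i. The walk H with steps k * `g p` - 1 recovers
the partition: p belongs to the block started by its opener, the last j ≤ p with H j ≤ H (p + 1).
The arcs from openers to opened points are nested, so there are no crossings, and i opens exactly k
* `g i` points, one for each level from H i to H (i + 1).

The drift d = H N = k(∑ g - (n-1)), where g is summed over one period, governs the inner circle. If
d < 0, the outer points without an opener and the whole inner circle form a zero-block of size 2k -
2d. If d = 0, every outer point has an opener and the inner circle consists of two opposite blocks
of k points. If d = k, a full turn leaves 2k levels unused, and the inner points take them one by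
one (`innerLabel`); the inner circle can be attached in two ways that differ by half a turn. No
other drift is needed. The congruence condition amounts to the divisibility of the block sizes by k
in a disc whose two cut positions are congruent modulo k (`isAnnularDivisible_of_label`,
`dvd_card_of_congruence`, `modEq_of_traversing`); cutting at a minimum of H gives such a disc
because H p ≡ -p modulo k. This makes each code a partition of type D (`IsCode.isNCD`).

Conversely, in any non-crossing disc the first element of a block is the opener of all its elements
for the walk of the block sizes (`isOpener_of_isFirst`). If some block meets both circles, the first
elements in the disc of the blocks that are not their own opposite are the starting points defined
above (`isGoodCut`), so this walk agrees with H. If no block meets both circles, condition (4) is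
applied to an inner block and a visible block, and the joined block supplies the good cut. Hence
every partition comes from its code (`eq_kerPart_of_isNCD`), and the code is determined by the
partition (`eq_of_kerPart_eq`).

With an additional entry f(-1) = n - ∑ g, the codes are the compositions of n into N + 1 parts ≥ 0;
those with f(-1) = 0, which are the compositions into N parts, give two partitions each. The pairs
of size tk are the entries equal to t, because the zero-block, or the pair of inner blocks, has size
k - d = k f(-1). Finally, the entries t in all compositions of n into m parts number m times the
compositions of n - t into m - 1 parts; m = N + 1 and m = N give the two terms. -/

namespace TypeD

/-! ### Walks on the integers: openers and nesting -/

section Walk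

/-- `j` is the last time up to `p` at which the walk `H` is not above its value just after `p`. -/
def IsOpener (H : ℤ → ℤ) (j p : ℤ) : Prop :=
  j ≤ p ∧ H j ≤ H (p + 1) ∧ ∀ i, j < i → i ≤ p → H (p + 1) < H i

/-- `j` is the last time at which the walk `H` is not above the level `l`. -/
def IsLastBelow (H : ℤ → ℤ) (j l : ℤ) : Prop :=
  H j ≤ l ∧ ∀ i, j < i → l < H i

variable {H : ℤ → ℤ}

theorem IsOpener.unique {i j p : ℤ} (hi : IsOpener H i p) (hj : IsOpener H j p) : i = j := by
  rcases lt_trichotomy i j with h | h | h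
  · exact absurd (hi.2.2 j h hj.1) (not_lt.2 hj.2.1)
  · exact h
  · exact absurd (hj.2.2 i h hi.1) (not_lt.2 hi.2.1)

theorem IsLastBelow.unique {i j l : ℤ} (hi : IsLastBelow H i l) (hj : IsLastBelow H j l) :
    i = j := by
  rcases lt_trichotomy i j with h | h | h
  · exact absurd (hi.2 j h) (not_lt.2 hj.1)
  · exact h
  · exact absurd (hj.2 i h) (not_lt.2 hi.1)

theorem IsOpener.le_succ {i p : ℤ} (h : IsOpener H i p) : H i ≤ H (i + 1) := by
  rcases h.1.eq_or_lt with h' | h'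
  · rw [h']; exact h' ▸ h.2.1
  · exact h.2.1.trans (h.2.2 (i + 1) (by omega) (by omega)).le

theorem isOpener_self {i : ℤ} (h : H i ≤ H (i + 1)) : IsOpener H i i :=
  ⟨le_rfl, h, fun _ _ _ => by omega⟩

theorem exists_isOpener {j p : ℤ} (hj : j ≤ p) (h : H j ≤ H (p + 1)) :
    ∃ i, j ≤ i ∧ IsOpener H i p := by
  obtain ⟨i, ⟨hi1, hi2⟩, hi3⟩ := Int.exists_greatest_of_bdd
    (P := fun i => i ≤ p ∧ H i ≤ H (p + 1)) ⟨p, fun z hz => hz.1⟩ ⟨j, hj, h⟩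
  refine ⟨i, hi3 j ⟨hj, h⟩, hi1, hi2, fun l hl hlp => ?_⟩
  by_contra hcon
  have := hi3 l ⟨hlp, not_lt.1 hcon⟩
  omega

/-- The arcs from openers to the points they open are nested. -/
theorem IsOpener.nested {j y z : ℤ} (h : IsOpener H j z) (hj : j ≤ y) (hy : y ≤ z) :
    ∃ i, j ≤ i ∧ IsOpener H i y := by
  rcases hy.eq_or_lt with rfl | hy
  · exact ⟨j, le_rfl, h⟩
  · exact exists_isOpener hj (h.2.1.trans (h.2.2 (y + 1) (by omega) (by omega)).le)

/-- Since y lies under the arc from i to z, nesting gives i ≤ j; since z lies under the arc from j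
to w, it gives j ≤ i. -/
theorem IsOpener.eq_of_crossing {i j x y z w : ℤ} (hx : IsOpener H i x) (hz : IsOpener H i z)
    (hy : IsOpener H j y) (hw : IsOpener H j w) (hxy : x < y) (hyz : y < z) (hzw : z < w) :
    i = j := by
  obtain ⟨a, ha, ha'⟩ := hz.nested (hx.1.trans hxy.le) hyz.le
  obtain ⟨b, hb, hb'⟩ := hw.nested (hy.1.trans hyz.le) hzw.le
  have := ha'.unique hy
  have := hb'.unique hz
  omega

/-- A walk with down-steps of size one meets every level on its way down. -/
theorem exists_first_passage (hstep : ∀ p, H p - 1 ≤ H (p + 1)) {i m l : ℤ} (him : i < m)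
    (hl : l ≤ H (i + 1)) (hm : H m ≤ l) :
    ∃ s, i ≤ s ∧ s < m ∧ H (s + 1) = l ∧ ∀ j, i < j → j ≤ s → l < H j := by
  obtain ⟨s, ⟨hs1, hs2⟩, hs3⟩ := Int.exists_least_of_bdd
    (P := fun s => i ≤ s ∧ H (s + 1) ≤ l) ⟨i, fun z hz => hz.1⟩
    ⟨m - 1, by omega, by simpa using hm⟩
  have hsm : s ≤ m - 1 := hs3 (m - 1) ⟨by omega, by simpa using hm⟩
  have key : ∀ j, i < j → j ≤ s → l < H j := by
    intro j hj hjs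
    by_contra hcon
    have := hs3 (j - 1) ⟨by omega, by simpa using hcon⟩
    omega
  refine ⟨s, hs1, by omega, ?_, key⟩
  rcases hs1.eq_or_lt with rfl | h
  · omega
  · have := key s h le_rfl
    have := hstep s
    omega

open Classical in
/-- The number of points opened by `i`. -/
theorem card_isOpener (hstep : ∀ p, H p - 1 ≤ H (p + 1)) {i m : ℤ} (h0 : 0 ≤ i) (him : i < m)
    (hi : H i ≤ H (i + 1)) (hm : H m ≤ H i) :
    (((Finset.Ico 0 m).filter (IsOpener H i)).card : ℤ) = H (i + 1) - H i + 1 := by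
  -- The points opened by i are the steps with which the walk first arrives, after i, at the levels
  -- from H (i + 1), where the step is i itself, down to H i. The bound H m ≤ H i ensures that all
  -- these levels are met before m.
  have : ((Finset.Ico 0 m).filter (IsOpener H i)).card
      = (Finset.Icc (H i) (H (i + 1))).card := by
    refine Finset.card_bij (fun s _ => H (s + 1)) ?_ ?_ ?_
    · intro s hs
      obtain ⟨-, h1, h2, h3⟩ := by simpa using hs
      rw [Finset.mem_Icc]
      refine ⟨h2, ?_⟩
      rcases h1.eq_or_lt with rfl | h
      · exact le_rfl
      · exact (h3 (i + 1) (by omega) (by omega)).le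
    · intro s hs t ht hst
      obtain ⟨-, h1, h2, h3⟩ := by simpa using hs
      obtain ⟨-, h1', h2', h3'⟩ := by simpa using ht
      rcases lt_trichotomy s t with h | h | h
      · have := h3' (s + 1) (by omega) (by omega)
        omega
      · exact h
      · have := h3 (t + 1) (by omega) (by omega)
        omega
    · intro l hl
      rw [Finset.mem_Icc] at hl
      obtain ⟨s, h1, h2, h3, h4⟩ := exists_first_passage hstep him hl.2 (hm.trans hl.1)
      refine ⟨s, ?_, h3⟩
      simp only [Finset.mem_filter, Finset.mem_Ico]
      exact ⟨⟨by omega, h2⟩, h1, by omega, fun j hj hjs => h3 ▸ h4 j hj hjs⟩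
  rw [this, Int.card_Icc]
  omega

/-! ### Walks with constant drift over a period; records -/

section Periodic

variable {N d : ℤ}

theorem walk_add_mul (hper : ∀ p, H (p + N) = H p + d) (p m : ℤ) :
    H (p + N * m) = H p + d * m := by
  induction m using Int.induction_on with
  | zero => simp
  | succ i ih =>
    rw [show p + N * (i + 1) = p + N * i + N by ring, hper, ih]; ring
  | pred i ih =>
    have := hper (p + N * (-i - 1))
    rw [show p + N * (-i - 1) + N = p + N * (-i) by ring, ih] at this
    linarith

theorem IsOpener.shift (hper : ∀ p, H (p + N) = H p + d) {j p : ℤ} (h : IsOpener H j p) (m : ℤ) :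
    IsOpener H (j + N * m) (p + N * m) := by
  have hw := walk_add_mul hper
  refine ⟨by linarith [h.1], ?_, fun i h1 h2 => ?_⟩
  · rw [show p + N * m + 1 = p + 1 + N * m by ring, hw, hw]; linarith [h.2.1]
  · have := h.2.2 (i - N * m) (by linarith) (by linarith)
    rw [show p + N * m + 1 = p + 1 + N * m by ring, hw]
    have h3 := hw (i - N * m) m
    rw [sub_add_cancel] at h3
    linarith

theorem IsLastBelow.shift (hper : ∀ p, H (p + N) = H p + d) {j l : ℤ} (h : IsLastBelow H j l)
    (m : ℤ) : IsLastBelow H (j + N * m) (l + d * m) := by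
  have hw := walk_add_mul hper
  refine ⟨by rw [hw]; linarith [h.1], fun i h1 => ?_⟩
  have := h.2 (i - N * m) (by linarith)
  have h3 := hw (i - N * m) m
  rw [sub_add_cancel] at h3
  linarith

/-- A longer arc would pass over p + 1 - N, which is not higher than p + 1 when d ≥ 0, and over j +
N, which is lower than j when d < 0. So arcs stay within half a circle, and a block with an opener
is different from its opposite. -/
theorem IsOpener.lt_add (hN : 0 < N) (hper : ∀ p, H (p + N) = H p + d) {j p : ℤ}
    (h : IsOpener H j p) : p < j + N := by
  by_contra hcon
  rcases le_or_gt 0 d with hd | hd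
  · have h1 := h.2.2 (p + 1 - N) (by omega) (by omega)
    have h2 := hper (p + 1 - N)
    rw [sub_add_cancel] at h2
    omega
  · have h1 := h.2.2 (j + N) (by omega) (by omega)
    have h2 := hper j
    have := h.2.1
    omega

/-- The walk does not go below its value at `a` on the side to which it does not decrease. -/
def IsRecord (H : ℤ → ℤ) (d a : ℤ) : Prop :=
  (0 ≤ d → ∀ j, a ≤ j → H a ≤ H j) ∧ (d ≤ 0 → ∀ j, j ≤ a → H a ≤ H j)

/-- A minimum over one period works: the height at any j is the height at its residue plus d times
the number of periods, and this number has the right sign on the side in question. -/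
theorem exists_isRecord (hN : 0 < N) (hper : ∀ p, H (p + N) = H p + d) :
    ∃ a, IsRecord H d a := by
  obtain ⟨a, ha, hmin⟩ := Finset.exists_min_image (Finset.Ico 0 N) H ⟨0, by simpa using hN⟩
  rw [Finset.mem_Ico] at ha
  have hw := walk_add_mul hper
  have key : ∀ j, H a ≤ H j - d * (j / N) := by
    intro j
    have h1 := hmin (j % N) (by
      rw [Finset.mem_Ico]; exact ⟨Int.emod_nonneg _ hN.ne', Int.emod_lt_of_pos _ hN⟩)
    have h2 := hw (j % N) (j / N)
    rw [Int.emod_add_mul_ediv] at h2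
    linarith
  refine ⟨a, fun hd j hj => ?_, fun hd j hj => ?_⟩
  · have : 0 ≤ j / N := Int.ediv_nonneg (by omega) hN.le
    nlinarith [key j]
  · have : j / N ≤ 0 := by
      have : j / N < 1 := Int.ediv_lt_of_lt_mul hN (by omega)
      omega
    nlinarith [key j]

/-- No arc passes over a record, so a circle can be cut open there without cutting an arc. -/
theorem IsRecord.le_of_isOpener (hN : 0 < N) (hper : ∀ p, H (p + N) = H p + d) {a : ℤ}
    (ha : IsRecord H d a) {j p : ℤ} (hp : a ≤ p) (h : IsOpener H j p) : a ≤ j := by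
  by_contra hcon
  have h1 := h.2.2 a (by omega) hp
  rcases le_or_gt 0 d with hd | hd
  · have := h.lt_add hN hper
    have h2 := ha.1 hd (j + N) (by omega)
    have h3 := ha.1 hd (p + 1) (by omega)
    omega
  · have := ha.2 hd.le j (by omega)
    have := h.2.1
    omega

/-- Without positive drift the walk is back at or below the level one period later. Hence the inner
points have openers only for positive drift. -/
theorem not_isLastBelow (hN : 0 < N) (hper : ∀ p, H (p + N) = H p + d) (hd : d ≤ 0) (j l : ℤ) :
    ¬ IsLastBelow H j l := by
  intro h
  have := h.2 (j + N) (by omega)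
  have := hper j
  have := h.1
  omega

/-- The time p + 1 - N is at height H (p + 1) - d, so the search for the opener of p succeeds there
at the latest. -/
theorem exists_isOpener_of_nonneg (hN : 0 < N) (hper : ∀ p, H (p + N) = H p + d) (hd : 0 ≤ d)
    (p : ℤ) : ∃ j, IsOpener H j p := by
  obtain ⟨j, -, h⟩ := exists_isOpener (H := H) (j := p + 1 - N) (p := p) (by omega) (by
    have := hper (p + 1 - N)
    rw [sub_add_cancel] at this
    omega)
  exact ⟨j, h⟩

theorem isRecord_add (hper : ∀ p, H (p + N) = H p + d) {a : ℤ} (ha : IsRecord H d a) (m : ℤ) :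
    IsRecord H d (a + N * m) := by
  have hw := walk_add_mul hper
  refine ⟨fun hd j hj => ?_, fun hd j hj => ?_⟩
  · have := ha.1 hd (j - N * m) (by linarith)
    have h3 := hw (j - N * m) m
    rw [sub_add_cancel] at h3
    rw [hw]; linarith
  · have := ha.2 hd (j - N * m) (by linarith)
    have h3 := hw (j - N * m) m
    rw [sub_add_cancel] at h3
    rw [hw]; linarith

end Periodic

end Walk

/-! ### The walk with prescribed steps -/

section WalkOfSteps

/-- The walk on the integers that starts at height `0` at time `0` and has the steps `f`. -/
noncomputable def walk (f : ℤ → ℤ) (p : ℤ) : ℤ :=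
  ∑ i ∈ Finset.Ico 0 p, f i - ∑ i ∈ Finset.Ico p 0, f i

theorem walk_zero (f : ℤ → ℤ) : walk f 0 = 0 := by simp [walk]

theorem walk_succ (f : ℤ → ℤ) (p : ℤ) : walk f (p + 1) = walk f p + f p := by
  rcases le_or_gt 0 p with h | h
  · have : Finset.Ico 0 (p + 1) = insert p (Finset.Ico 0 p) := by
      ext x; simp only [Finset.mem_Ico, Finset.mem_insert]; omega
    rw [walk, walk, this, Finset.sum_insert (by simp), Finset.Ico_eq_empty (by omega : ¬ p + 1 < 0),
      Finset.Ico_eq_empty (by omega : ¬ p < 0)]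
    simp [add_comm]
  · have : Finset.Ico p 0 = insert p (Finset.Ico (p + 1) 0) := by
      ext x; simp only [Finset.mem_Ico, Finset.mem_insert]; omega
    rw [walk, walk, this, Finset.sum_insert (by simp), Finset.Ico_eq_empty (by omega : ¬ 0 < p + 1),
      Finset.Ico_eq_empty (by omega : ¬ 0 < p)]
    simp

theorem walk_sub_walk (f : ℤ → ℤ) {u v : ℤ} (h : u ≤ v) :
    walk f v - walk f u = ∑ i ∈ Finset.Ico u v, f i := by
  induction v, h using Int.leInduction with
  | base => simp
  | succ v h ih =>
    have : Finset.Ico u (v + 1) = insert v (Finset.Ico u v) := by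
      ext x; simp only [Finset.mem_Ico, Finset.mem_insert]; omega
    rw [this, Finset.sum_insert (by simp), ← ih, walk_succ]
    ring

theorem walk_add_period {f : ℤ → ℤ} {N : ℤ} (hf : ∀ p, f (p + N) = f p) (p : ℤ) :
    walk f (p + N) = walk f p + walk f N := by
  induction p using Int.induction_on with
  | zero => simp [walk_zero]
  | succ i ih =>
    rw [show (i : ℤ) + 1 + N = i + N + 1 by ring, walk_succ, walk_succ, ih, hf]; ring
  | pred i ih =>
    have h1 := walk_succ f (-i - 1 + N)
    have h2 := walk_succ f (-i - 1)
    rw [show -(i : ℤ) - 1 + N + 1 = -i + N by ring, ih, hf] at h1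
    rw [show -(i : ℤ) - 1 + 1 = -i by ring] at h2
    linarith

end WalkOfSteps

/-! ### Non-crossing labellings of a line and the walk of their block sizes -/

section FirstElements

/-- `x` is the first of the places `0, 1, ...` with the label of `x`. -/
def IsFirst {γ : Type*} (β : ℤ → γ) (x : ℤ) : Prop := ∀ i, 0 ≤ i → i < x → β i ≠ β x

theorem exists_isFirst {γ : Type*} (β : ℤ → γ) {x : ℤ} (hx : 0 ≤ x) :
    ∃ j, 0 ≤ j ∧ j ≤ x ∧ β j = β x ∧ IsFirst β j := by
  obtain ⟨j, ⟨h1, h2⟩, h3⟩ := Int.exists_least_of_bdd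
    (P := fun i => 0 ≤ i ∧ β i = β x) ⟨0, fun z hz => hz.1⟩ ⟨x, hx, rfl⟩
  refine ⟨j, h1, h3 x ⟨hx, rfl⟩, h2, fun i hi hij hne => ?_⟩
  have := h3 i ⟨hi, hne.trans h2⟩
  omega

open Classical in
/-- The number of places `0, ..., m - 1` with the label of `x` if `x` is the first of them, and `0`
otherwise. -/
noncomputable def firstSize {γ : Type*} (β : ℤ → γ) (m x : ℤ) : ℕ :=
  if IsFirst β x then ((Finset.Ico 0 m).filter (fun y => β y = β x)).card else 0

variable {γ : Type*} {β : ℤ → γ} {m : ℤ}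

-- Blocks that start at different places are disjoint, so their sizes add up. Increments of the walk
-- of block sizes thereby become counts of points, which can be compared by inclusion.
open Classical in
theorem sum_firstSize {u v : ℤ} (hu : 0 ≤ u) :
    ∑ x ∈ Finset.Ico u v, firstSize β m x = ((Finset.Ico 0 m).filter
      (fun y => ∃ x, u ≤ x ∧ x < v ∧ IsFirst β x ∧ β y = β x)).card := by
  have : (Finset.Ico 0 m).filter (fun y => ∃ x, u ≤ x ∧ x < v ∧ IsFirst β x ∧ β y = β x)
      = ((Finset.Ico u v).filter (IsFirst β)).biUnion
        (fun x => (Finset.Ico 0 m).filter (fun y => β y = β x)) := by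
    ext y
    simp only [Finset.mem_filter, Finset.mem_Ico, Finset.mem_biUnion]
    constructor
    · rintro ⟨h, x, h1, h2, h3, h4⟩; exact ⟨x, ⟨⟨h1, h2⟩, h3⟩, h, h4⟩
    · rintro ⟨x, ⟨⟨h1, h2⟩, h3⟩, h, h4⟩; exact ⟨h, x, h1, h2, h3, h4⟩
  rw [this, Finset.card_biUnion, Finset.sum_filter]
  · rfl
  · intro x hx y hy hxy
    simp only [Finset.coe_filter, Set.mem_ofPred_eq, Finset.mem_Ico] at hx hy
    rw [Function.onFun, Finset.disjoint_left]
    intro z hz hz'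
    simp only [Finset.mem_filter] at hz hz'
    have hβ := hz.2.symm.trans hz'.2
    rcases lt_or_gt_of_ne hxy with h | h
    · exact hy.2 x (by omega) h hβ
    · exact hx.2 y (by omega) h hβ.symm

/-- In a non-crossing partition of `0, ..., m - 1`, the first element of the block of `s` is the
opener of `s` for the walk whose steps are the block sizes at the first elements, less one. -/
theorem isOpener_of_isFirst {K : ℤ → ℤ}
    (hnc : ∀ x y z w, 0 ≤ x → x < y → y < z → z < w → w < m → β x = β z → β y = β w → β x = β y)
    (hK : ∀ u v, 0 ≤ u → u ≤ v → v ≤ m →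
      K v - K u = ∑ x ∈ Finset.Ico u v, (firstSize β m x : ℤ) - (v - u))
    {j s : ℤ} (hj : 0 ≤ j) (hjs : j ≤ s) (hs : s < m) (hβ : β j = β s) (hfirst : IsFirst β j) :
    IsOpener K j s := by
  classical
  refine ⟨hjs, ?_, fun i hi his => ?_⟩
  · have h1 := hK j (s + 1) hj (by omega) (by omega)
    have h2 := sum_firstSize (β := β) (m := m) (v := s + 1) hj
    -- The block of a point between j and s cannot have started before j, since it would cross the
    -- block of j and s. So the blocks started in [j, s] contain all of [j, s], and the walk has not
    -- fallen below its value at j.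
    have h3 : (Finset.Icc j s).card ≤ ((Finset.Ico 0 m).filter
        (fun y => ∃ x, j ≤ x ∧ x < s + 1 ∧ IsFirst β x ∧ β y = β x)).card := by
      refine Finset.card_le_card fun y hy => ?_
      rw [Finset.mem_Icc] at hy
      obtain ⟨f, hf0, hfy, hfβ, hff⟩ := exists_isFirst β (x := y) (by omega)
      simp only [Finset.mem_filter, Finset.mem_Ico]
      refine ⟨by omega, f, ?_, by omega, hff, hfβ.symm⟩
      by_contra hcon
      have hys : y ≠ s := by
        rintro rfl
        exact hfirst f hf0 (by omega) (hfβ.trans hβ.symm)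
      have hyj : y ≠ j := by
        rintro rfl
        exact hfirst f hf0 (by omega) hfβ
      have := hnc f j y s hf0 (by omega) (by omega) (by omega) hs hfβ hβ
      exact hfirst f hf0 (by omega) this
    rw [← h2, Int.card_Icc] at h3
    push_cast [← Nat.cast_sum] at h1
    omega
  · have h1 := hK i (s + 1) (by omega) (by omega) (by omega)
    have h2 := sum_firstSize (β := β) (m := m) (v := s + 1) (u := i) (by omega)
    -- A block started in [i, s] is not the block of s, which started at j < i, and it cannot reach
    -- beyond s without crossing. It lies in [i, s), so the walk strictly falls from i to s + 1.
    have h3 : ((Finset.Ico 0 m).filter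
        (fun y => ∃ x, i ≤ x ∧ x < s + 1 ∧ IsFirst β x ∧ β y = β x)).card
        ≤ (Finset.Ico i s).card := by
      refine Finset.card_le_card fun y hy => ?_
      simp only [Finset.mem_filter, Finset.mem_Ico] at hy
      obtain ⟨⟨hy0, hym⟩, x, hx1, hx2, hxf, hxβ⟩ := hy
      have hxy : x ≤ y := by
        by_contra hcon
        exact hxf y hy0 (by omega) hxβ
      rw [Finset.mem_Ico]
      refine ⟨by omega, ?_⟩
      have hne : β x ≠ β j := fun h => hxf j hj (by omega) h.symm
      have hys : y ≠ s := by
        rintro rfl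
        exact hne (hxβ.symm.trans hβ.symm)
      by_contra hcon
      have hxs : x ≠ s := by
        rintro rfl
        exact hne hβ.symm
      exact hne (hnc j x s y hj (by omega) (by omega) (by omega) hym hβ hxβ.symm).symm
    rw [← h2, Int.card_Ico] at h3
    push_cast [← Nat.cast_sum] at h1
    omega

/-- Every point before v belongs to a block that started before v; hence the walk of block sizes is
never negative in the disc. -/
theorem le_sum_firstSize {v : ℤ} (hv : 0 ≤ v) (hvm : v ≤ m) :
    v ≤ ∑ x ∈ Finset.Ico 0 v, (firstSize β m x : ℤ) := by
  classical
  have h2 := sum_firstSize (β := β) (m := m) (v := v) (u := 0) le_rfl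
  have h3 : (Finset.Ico 0 v).card ≤ ((Finset.Ico 0 m).filter
      (fun y => ∃ x, 0 ≤ x ∧ x < v ∧ IsFirst β x ∧ β y = β x)).card := by
    refine Finset.card_le_card fun y hy => ?_
    rw [Finset.mem_Ico] at hy
    obtain ⟨f, hf0, hfy, hfβ, hff⟩ := exists_isFirst β hy.1
    simp only [Finset.mem_filter, Finset.mem_Ico]
    exact ⟨by omega, f, hf0, by omega, hff, hfβ.symm⟩
  rw [← h2, Int.card_Ico] at h3
  push_cast [← Nat.cast_sum]
  omega

end FirstElements

end TypeD

/-! ### Coordinates on the two circles and on the cut disc -/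

namespace TypeD

theorem emod_eq_of_eq_add_mul {a b r q : ℤ} (h : a = r + b * q) (h0 : 0 ≤ r) (hr : r < b) :
    a % b = r := by
  rw [h, Int.add_mul_emod_self_left, Int.emod_eq_of_lt h0 hr]

theorem exists_eq_emod_add_mul (a : ℤ) {b : ℤ} (hb : 0 < b) :
    ∃ q, a = a % b + b * q ∧ 0 ≤ a % b ∧ a % b < b :=
  ⟨a / b, (Int.emod_add_mul_ediv a b).symm, Int.emod_nonneg _ hb.ne', Int.emod_lt_of_pos _ hb⟩

/-- The antipodal place on a circle with `2m` places. -/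
theorem add_emod_two_mul {m : ℤ} (hm : 0 < m) (p : ℤ) :
    (p + m) % (2 * m) = if p % (2 * m) < m then p % (2 * m) + m else p % (2 * m) - m := by
  obtain ⟨q, hq, h0, h1⟩ := exists_eq_emod_add_mul p (b := 2 * m) (by omega)
  split_ifs with h
  · exact emod_eq_of_eq_add_mul (q := q) (by linarith) (by omega) (by omega)
  · exact emod_eq_of_eq_add_mul (q := q + 1) (by linarith) (by omega) (by omega)

/-- The outer point at the position `p`, read modulo `2N`. -/
def outerPt (N p : ℤ) : ℤ :=
  if p % (2 * N) < N then p % (2 * N) + 1 else N - p % (2 * N) - 1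

/-- The inner point at the position `q`, read modulo `2k`. -/
def innerPt (N k q : ℤ) : ℤ :=
  if q % (2 * k) < k then N + 1 + q % (2 * k) else k - (N + 1) - q % (2 * k)

theorem outerPt_add_period {N : ℤ} (hN : 0 < N) (p : ℤ) : outerPt N (p + N) = -outerPt N p := by
  obtain ⟨q, hq, h0, h1⟩ := exists_eq_emod_add_mul p (b := 2 * N) (by omega)
  rw [outerPt, outerPt, add_emod_two_mul hN]
  split_ifs <;> omega

theorem outerPt_sub_period {N : ℤ} (hN : 0 < N) (p : ℤ) : outerPt N (p - N) = -outerPt N p := by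
  have := outerPt_add_period hN (p - N)
  rw [sub_add_cancel] at this
  omega

theorem outerPt_add_mul (N p m : ℤ) : outerPt N (p + 2 * N * m) = outerPt N p := by
  rw [outerPt, outerPt, Int.add_mul_emod_self_left]

theorem innerPt_add_period {N k : ℤ} (hk : 0 < k) (q : ℤ) :
    innerPt N k (q + k) = -innerPt N k q := by
  obtain ⟨m, hm, h0, h1⟩ := exists_eq_emod_add_mul q (b := 2 * k) (by omega)
  rw [innerPt, innerPt, add_emod_two_mul hk]
  split_ifs <;> omega

theorem innerPt_add_mul (N k q m : ℤ) : innerPt N k (q + 2 * k * m) = innerPt N k q := by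
  rw [innerPt, innerPt, Int.add_mul_emod_self_left]

section Points

variable {k n : ℕ}

theorem mem_points {x : ℤ} : x ∈ points k n ↔ x ≠ 0 ∧ |x| ≤ outerHalf k n + k := by
  rw [points, Finset.mem_erase, Finset.mem_Icc, ← abs_le, outerHalf,
    show (k : ℤ) * (n - 1) + k = k * n by ring]

theorem outerHalf_pos (hk : 1 ≤ k) (hn : 2 ≤ n) : 0 < outerHalf k n := by
  have : (0 : ℤ) < k := by exact_mod_cast hk
  have : (0 : ℤ) < (n : ℤ) - 1 := by omega
  unfold outerHalf; positivity

theorem outerPt_ne_zero {N : ℤ} (hN : 0 < N) (p : ℤ) : outerPt N p ≠ 0 ∧ |outerPt N p| ≤ N := by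
  obtain ⟨q, hq, h0, h1⟩ := exists_eq_emod_add_mul p (b := 2 * N) (by omega)
  rw [outerPt, abs_le]
  split_ifs with h <;> omega

theorem innerPt_ne_zero {N k : ℤ} (hN : 0 < N) (hk : 0 < k) (q : ℤ) :
    innerPt N k q ≠ 0 ∧ N < |innerPt N k q| ∧ |innerPt N k q| ≤ N + k := by
  obtain ⟨m, hm, h0, h1⟩ := exists_eq_emod_add_mul q (b := 2 * k) (by omega)
  rw [innerPt, lt_abs, abs_le]
  split_ifs with h <;> omega

theorem onOuter_outerPt (hN : 0 < outerHalf k n) (p : ℤ) :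
    OnOuter k n (outerPt (outerHalf k n) p) := (outerPt_ne_zero hN p).2

theorem not_onOuter_innerPt (hk : 1 ≤ k) (hN : 0 < outerHalf k n) (q : ℤ) :
    ¬ OnOuter k n (innerPt (outerHalf k n) k q) :=
  not_le.2 (innerPt_ne_zero hN (by omega) q).2.1

theorem outerPt_mem (hN : 0 < outerHalf k n) (p : ℤ) :
    outerPt (outerHalf k n) p ∈ points k n := by
  have := outerPt_ne_zero hN p
  rw [mem_points]
  exact ⟨this.1, by omega⟩

theorem innerPt_mem (hk : 1 ≤ k) (hN : 0 < outerHalf k n) (q : ℤ) :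
    innerPt (outerHalf k n) k q ∈ points k n := by
  have := innerPt_ne_zero hN (by omega : (0 : ℤ) < k) q
  rw [mem_points]
  exact ⟨this.1, this.2.2⟩

theorem outerPos_outerPt (hN : 0 < outerHalf k n) (p : ℤ) :
    outerPos k n (outerPt (outerHalf k n) p) = p % (2 * outerHalf k n) := by
  obtain ⟨q, hq, h0, h1⟩ := exists_eq_emod_add_mul p (b := 2 * outerHalf k n) (by omega)
  rw [outerPos, outerPt]
  split_ifs <;> omega

theorem innerPos_innerPt (hk : 1 ≤ k) (hN : 0 < outerHalf k n) (q : ℤ) :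
    innerPos k n (innerPt (outerHalf k n) k q) = q % (2 * k) := by
  obtain ⟨m, hm, h0, h1⟩ := exists_eq_emod_add_mul q (b := 2 * (k : ℤ)) (by omega)
  rw [innerPos, innerPt]
  split_ifs <;> omega

theorem outerPt_outerPos {x : ℤ} (hx : x ∈ points k n) (h : OnOuter k n x) :
    outerPt (outerHalf k n) (outerPos k n x) = x := by
  have h0 := (mem_points.1 hx).1
  rw [OnOuter, abs_le] at h
  rw [outerPos]
  split_ifs with hx0
  · rw [outerPt, Int.emod_eq_of_lt (by omega) (by omega), if_pos (by omega)]; omega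
  · rw [outerPt, Int.emod_eq_of_lt (by omega) (by omega), if_neg (by omega)]; omega

theorem innerPt_innerPos (hN : 0 < outerHalf k n) {x : ℤ} (hx : x ∈ points k n)
    (h : ¬ OnOuter k n x) :
    innerPt (outerHalf k n) k (innerPos k n x) = x := by
  have h0 := (mem_points.1 hx).2
  rw [OnOuter, not_le, lt_abs] at h
  rw [abs_le] at h0
  rw [innerPos]
  split_ifs with hx0
  · rw [innerPt, Int.emod_eq_of_lt (by omega) (by omega), if_pos (by omega)]; omega
  · rw [innerPt, Int.emod_eq_of_lt (by omega) (by omega), if_neg (by omega)]; omega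

theorem neg_mem_points {x : ℤ} (hx : x ∈ points k n) : -x ∈ points k n := by
  rw [mem_points] at *
  rwa [abs_neg, neg_ne_zero]

theorem onOuter_neg {x : ℤ} : OnOuter k n (-x) ↔ OnOuter k n x := by
  rw [OnOuter, OnOuter, abs_neg]

/-- The point at the place `s` of the boundary of the disc cut open at `a` and `b`. -/
def discPt (k n : ℕ) (a b s : ℤ) : ℤ :=
  if s < 2 * outerHalf k n then outerPt (outerHalf k n) (a + s)
  else innerPt (outerHalf k n) k (b + (s - 2 * outerHalf k n))

/-- The number of points. -/
def discLen (k n : ℕ) : ℤ := 2 * outerHalf k n + 2 * k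

theorem cutPos_outerPt (hN : 0 < outerHalf k n) (a b p : ℤ) :
    cutPos k n a b (outerPt (outerHalf k n) p) = (p - a) % (2 * outerHalf k n) := by
  rw [cutPos, if_pos (onOuter_outerPt hN p), outerPos_outerPt hN, Int.emod_sub_emod]

theorem cutPos_innerPt (hk : 1 ≤ k) (hN : 0 < outerHalf k n) (a b q : ℤ) :
    cutPos k n a b (innerPt (outerHalf k n) k q) = 2 * outerHalf k n + (q - b) % (2 * k) := by
  rw [cutPos, if_neg (not_onOuter_innerPt hk hN q), innerPos_innerPt hk hN, Int.emod_sub_emod]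

theorem cutPos_discPt (hk : 1 ≤ k) (hN : 0 < outerHalf k n) (a b : ℤ) {s : ℤ} (h0 : 0 ≤ s)
    (hs : s < discLen k n) : cutPos k n a b (discPt k n a b s) = s := by
  rw [discLen] at hs
  rw [discPt]
  split_ifs with h
  · rw [cutPos_outerPt hN, add_sub_cancel_left, Int.emod_eq_of_lt h0 h]
  · rw [cutPos_innerPt hk hN, add_sub_cancel_left, Int.emod_eq_of_lt (by omega) (by omega)]
    omega

theorem cutPos_nonneg_lt (hk : 1 ≤ k) (hN : 0 < outerHalf k n) (a b x : ℤ) :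
    0 ≤ cutPos k n a b x ∧ cutPos k n a b x < discLen k n ∧
      (OnOuter k n x ↔ cutPos k n a b x < 2 * outerHalf k n) := by
  obtain ⟨_, -, h1, h2⟩ := exists_eq_emod_add_mul (outerPos k n x - a)
    (b := 2 * outerHalf k n) (by omega)
  obtain ⟨_, -, h3, h4⟩ := exists_eq_emod_add_mul (innerPos k n x - b)
    (b := 2 * (k : ℤ)) (by omega)
  rw [cutPos, discLen]
  split_ifs with h
  · simp only [h, true_iff]; omega
  · simp only [h, false_iff]; omega

theorem discPt_cutPos (hk : 1 ≤ k) (hN : 0 < outerHalf k n) (a b : ℤ) {x : ℤ}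
    (hx : x ∈ points k n) : discPt k n a b (cutPos k n a b x) = x := by
  obtain ⟨h0, h1, h2⟩ := cutPos_nonneg_lt hk hN a b x
  rw [discPt]
  split_ifs with h
  · rw [cutPos, if_pos (h2.2 h)]
    obtain ⟨m, hm, -, -⟩ := exists_eq_emod_add_mul (outerPos k n x - a)
      (b := 2 * outerHalf k n) (by omega)
    rw [← outerPt_add_mul _ _ m, add_assoc, ← hm, add_sub_cancel,
      outerPt_outerPos hx (h2.2 h)]
  · rw [cutPos, if_neg (fun hc => h (h2.1 hc)), add_sub_cancel_left]
    obtain ⟨m, hm, -, -⟩ := exists_eq_emod_add_mul (innerPos k n x - b)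
      (b := 2 * (k : ℤ)) (by omega)
    rw [← innerPt_add_mul _ _ _ m, add_assoc, ← hm, add_sub_cancel,
      innerPt_innerPos hN hx (fun hc => h (h2.1 hc))]

theorem discPt_mem (hk : 1 ≤ k) (hN : 0 < outerHalf k n) (a b s : ℤ) :
    discPt k n a b s ∈ points k n := by
  rw [discPt]
  split_ifs
  · exact outerPt_mem hN _
  · exact innerPt_mem hk hN _

theorem exists_discPt (hk : 1 ≤ k) (hN : 0 < outerHalf k n) (a b : ℤ) {x : ℤ}
    (hx : x ∈ points k n) : ∃ s, 0 ≤ s ∧ s < discLen k n ∧ discPt k n a b s = x :=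
  ⟨cutPos k n a b x, (cutPos_nonneg_lt hk hN a b x).1, (cutPos_nonneg_lt hk hN a b x).2.1,
    discPt_cutPos hk hN a b hx⟩

theorem cutPos_injOn (hk : 1 ≤ k) (hN : 0 < outerHalf k n) (a b : ℤ) {x y : ℤ}
    (hx : x ∈ points k n) (hy : y ∈ points k n) (h : cutPos k n a b x = cutPos k n a b y) :
    x = y := by
  rw [← discPt_cutPos hk hN a b hx, h, discPt_cutPos hk hN a b hy]

theorem card_filter_points (hk : 1 ≤ k) (hN : 0 < outerHalf k n) (a b : ℤ) (P : ℤ → Prop)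
    [DecidablePred P] [DecidablePred fun s => P (discPt k n a b s)] :
    ((points k n).filter P).card
      = ((Finset.Ico 0 (discLen k n)).filter (fun s => P (discPt k n a b s))).card := by
  refine Finset.card_bij (fun x _ => cutPos k n a b x) ?_ ?_ ?_
  · intro x hx
    rw [Finset.mem_filter] at hx
    have := cutPos_nonneg_lt hk hN a b x
    rw [Finset.mem_filter, Finset.mem_Ico, discPt_cutPos hk hN a b hx.1]
    exact ⟨⟨this.1, this.2.1⟩, hx.2⟩
  · intro x hx y hy h
    exact cutPos_injOn hk hN a b (Finset.mem_filter.1 hx).1 (Finset.mem_filter.1 hy).1 h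
  · intro s hs
    rw [Finset.mem_filter, Finset.mem_Ico] at hs
    exact ⟨discPt k n a b s, Finset.mem_filter.2 ⟨discPt_mem hk hN a b s, hs.2⟩,
      cutPos_discPt hk hN a b hs.1.1 hs.1.2⟩

theorem card_points (hk : 1 ≤ k) (hN : 0 < outerHalf k n) :
    ((points k n).card : ℤ) = discLen k n := by
  have := card_filter_points hk hN 0 0 (fun _ => True)
  simp only [Finset.filter_true, Int.card_Ico] at this
  have h : 0 ≤ discLen k n := by rw [discLen]; omega
  omega

theorem dvd_outerHalf : (k : ℤ) ∣ outerHalf k n := ⟨(n : ℤ) - 1, rfl⟩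

theorem modEq_emod_two_mul {m : ℤ} (h : (k : ℤ) ∣ m) (p : ℤ) : p % (2 * m) ≡ p [ZMOD k] :=
  (Int.mod_modEq p (2 * m)).of_dvd (h.mul_left 2)

/-- The position of a negative point exceeds that of its opposite by N, a multiple of k, so
positions modulo k see only absolute values. -/
theorem abs_outerPt (hN : 0 < outerHalf k n) (p : ℤ) :
    |outerPt (outerHalf k n) p| ≡ p + 1 [ZMOD k] := by
  obtain ⟨q, hq, h0, h1⟩ := exists_eq_emod_add_mul p (b := 2 * outerHalf k n) (by omega)
  have h2 := (modEq_emod_two_mul (dvd_outerHalf (k := k) (n := n)) p).add_right 1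
  refine Int.ModEq.trans ?_ h2
  rw [outerPt]
  split_ifs with h
  · rw [abs_of_nonneg (by omega)]
  · rw [abs_of_nonpos (by omega), Int.modEq_iff_dvd]
    obtain ⟨c, hc⟩ := dvd_outerHalf (k := k) (n := n)
    exact ⟨c, by rw [← hc]; ring⟩

theorem abs_innerPt (hk : 1 ≤ k) (hN : 0 < outerHalf k n) (q : ℤ) :
    |innerPt (outerHalf k n) k q| ≡ q + 1 [ZMOD k] := by
  obtain ⟨m, hm, h0, h1⟩ := exists_eq_emod_add_mul q (b := 2 * (k : ℤ)) (by omega)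
  have h2 := (modEq_emod_two_mul (dvd_refl (k : ℤ)) q).add_right 1
  refine Int.ModEq.trans ?_ h2
  obtain ⟨c, hc⟩ := dvd_outerHalf (k := k) (n := n)
  rw [innerPt]
  split_ifs with h
  · rw [abs_of_nonneg (by omega), Int.modEq_iff_dvd]
    exact ⟨-c, by rw [mul_neg, ← hc]; ring⟩
  · rw [abs_of_nonpos (by omega), Int.modEq_iff_dvd]
    exact ⟨1 - c, by rw [mul_sub, ← hc]; ring⟩

/-- The residue of a point modulo `k` advances with its place if the cut is compatible with `k`. -/
theorem abs_modEq_cutPos (hk : 1 ≤ k) (hN : 0 < outerHalf k n) {a b : ℤ} (hab : a ≡ b [ZMOD k])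
    {x : ℤ} (hx : x ∈ points k n) : |x| ≡ cutPos k n a b x + (a + 1) [ZMOD k] := by
  obtain ⟨s, hs0, hs1, rfl⟩ := exists_discPt hk hN a b hx
  rw [cutPos_discPt hk hN a b hs0 hs1, discPt]
  split_ifs with h
  · refine (abs_outerPt hN _).trans ?_
    rw [show a + s + 1 = s + (a + 1) by ring]
  · refine (abs_innerPt hk hN _).trans ?_
    have h3 : (k : ℤ) ∣ 2 * outerHalf k n := (dvd_outerHalf).mul_left 2
    have h4 : s - 2 * outerHalf k n ≡ s [ZMOD k] := by
      rw [Int.modEq_iff_dvd]; simpa using h3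
    rw [show s + (a + 1) = a + s + 1 by ring]
    exact (hab.symm.add h4).add_right 1

end Points
end TypeD

/-! ### Partitions as fibres of labellings; the congruence condition and block sizes divisible by k
-/

namespace TypeD

section Labels

variable {γ : Type*} {k n : ℕ}

open Classical in
/-- The points with the same label as `x`. -/
noncomputable def fiber (k n : ℕ) (β : ℤ → γ) (x : ℤ) : Finset ℤ :=
  (points k n).filter (fun y => β x = β y)

theorem mem_fiber {β : ℤ → γ} {x y : ℤ} : y ∈ fiber k n β x ↔ y ∈ points k n ∧ β x = β y := by
  classical
  simp [fiber]

theorem fiber_eq_filter (β : ℤ → γ) (x : ℤ) [DecidablePred fun y => β x = β y] :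
    fiber k n β x = (points k n).filter (fun y => β x = β y) := by
  ext y
  rw [mem_fiber, Finset.mem_filter]

theorem fiber_congr {β : ℤ → γ} {x y : ℤ} (h : β x = β y) : fiber k n β x = fiber k n β y := by
  ext z; rw [mem_fiber, mem_fiber, h]

open Classical in
/-- The partition of the points into the sets of points with equal labels. -/
noncomputable def kerPart (k n : ℕ) (β : ℤ → γ) : Finpartition (points k n) :=
  Finpartition.ofSetSetoid (Setoid.ker β) (points k n)

theorem mem_kerPart {β : ℤ → γ} {V : Finset ℤ} :
    V ∈ (kerPart k n β).parts ↔ ∃ x ∈ points k n, fiber k n β x = V := by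
  classical
  rw [kerPart, Finpartition.ofSetSetoid_parts, Finset.mem_image]
  rfl

theorem fiber_mem_kerPart {β : ℤ → γ} {x : ℤ} (hx : x ∈ points k n) :
    fiber k n β x ∈ (kerPart k n β).parts := mem_kerPart.2 ⟨x, hx, rfl⟩

theorem fiber_eq_iff {β : ℤ → γ} {x y : ℤ} (hy : y ∈ points k n) :
    fiber k n β x = fiber k n β y ↔ β x = β y :=
  ⟨fun h => (mem_fiber.1 (h ▸ mem_fiber.2 ⟨hy, rfl⟩ : y ∈ fiber k n β x)).2, fiber_congr⟩

theorem kerPart_part {β : ℤ → γ} {x : ℤ} (hx : x ∈ points k n) :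
    (kerPart k n β).part x = fiber k n β x :=
  Finpartition.part_eq_of_mem _ (fiber_mem_kerPart hx) (mem_fiber.2 ⟨hx, rfl⟩)

theorem eq_kerPart {π : Finpartition (points k n)} {β : ℤ → γ}
    (h : ∀ x ∈ points k n, ∀ y ∈ points k n, π.part x = π.part y ↔ β x = β y) :
    π = kerPart k n β := by
  have key : ∀ x ∈ points k n, π.part x = fiber k n β x := by
    intro x hx
    ext y
    rw [mem_fiber]
    constructor
    · intro hy
      have hy' := π.part_subset x hy
      exact ⟨hy', (h x hx y hy').1 ((π.mem_part_iff_part_eq_part hy' hx).1 hy).symm⟩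
    · rintro ⟨hy, hxy⟩
      exact (π.mem_part_iff_part_eq_part hy hx).2 ((h x hx y hy).2 hxy).symm
  ext V
  rw [mem_kerPart]
  constructor
  · intro hV
    obtain ⟨x, hx⟩ := π.nonempty_of_mem_parts hV
    have hxp := π.le hV hx
    exact ⟨x, hxp, by rw [← key x hxp, π.part_eq_of_mem hV hx]⟩
  · rintro ⟨x, hx, rfl⟩
    rw [← key x hx]
    exact π.part_mem.2 hx

/-- The labelling `β` of the places `0, ..., m - 1` has no crossing. -/
def PlaceNC (β : ℤ → γ) (m : ℤ) : Prop :=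
  ∀ x y z w, 0 ≤ x → x < y → y < z → z < w → w < m → β x = β z → β y = β w → β x = β y

/-- A set closed under having equal labels is a disjoint union of blocks, each of size divisible by
k. -/
theorem dvd_card_of_closed {β : ℤ → γ} {m : ℤ} {S : Finset ℤ} (hS : S ⊆ Finset.Ico 0 m)
    (hclosed : ∀ x ∈ S, ∀ y, 0 ≤ y → y < m → β x = β y → y ∈ S)
    (hdvd : ∀ x, 0 ≤ x → x < m →
      ∃ F : Finset ℤ, k ∣ F.card ∧ ∀ y, y ∈ F ↔ (0 ≤ y ∧ y < m) ∧ β x = β y) :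
    k ∣ S.card := by
  classical
  rw [Finset.card_eq_sum_card_image β S]
  refine Finset.dvd_sum fun v hv => ?_
  obtain ⟨x, hx, rfl⟩ := Finset.mem_image.1 hv
  have hx' := Finset.mem_Ico.1 (hS hx)
  obtain ⟨F, hF, hmem⟩ := hdvd x hx'.1 hx'.2
  have : S.filter (fun y => β y = β x) = F := by
    ext y
    rw [Finset.mem_filter, hmem]
    constructor
    · rintro ⟨h1, h2⟩
      exact ⟨Finset.mem_Ico.1 (hS h1), h2.symm⟩
    · rintro ⟨h1, h2⟩
      exact ⟨hclosed x hx y h1.1 h1.2 h2, h2.symm⟩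
  rwa [this]

/-- Between consecutive elements of a block there is a union of blocks. -/
theorem dvd_gap {β : ℤ → γ} {m : ℤ} (hnc : PlaceNC β m)
    (hdvd : ∀ x, 0 ≤ x → x < m →
      ∃ F : Finset ℤ, k ∣ F.card ∧ ∀ y, y ∈ F ↔ (0 ≤ y ∧ y < m) ∧ β x = β y)
    {s t : ℤ} (hs : 0 ≤ s) (hst : s < t) (ht : t < m) (hβ : β s = β t)
    (hgap : ∀ x, s < x → x < t → β s ≠ β x) : (k : ℤ) ∣ t - s - 1 := by
  have : k ∣ (Finset.Ioo s t).card := by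
    refine dvd_card_of_closed (β := β) (m := m) ?_ ?_ hdvd
    · intro x hx
      rw [Finset.mem_Ioo] at hx
      rw [Finset.mem_Ico]
      omega
    · intro x hx y hy hym hxy
      rw [Finset.mem_Ioo] at *
      have hne := hgap x hx.1 hx.2
      have hys : y ≠ s := by rintro rfl; exact hne hxy.symm
      have hyt : y ≠ t := by rintro rfl; exact hne (hβ.trans hxy.symm)
      by_contra hcon
      rcases lt_or_ge y s with h | h
      · exact hne ((hnc y s x t hy h hx.1 hx.2 ht hxy.symm hβ).symm.trans hxy.symm)
      · exact hne (hnc s x t y hs hx.1 hx.2 (by omega) hym hβ hxy)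
  rw [Int.card_Ioo] at this
  have h2 := Int.natCast_dvd_natCast.2 this
  rwa [Int.toNat_of_nonneg (by omega)] at h2

/-- Outside the span of a block there is a union of blocks. -/
theorem dvd_outside {β : ℤ → γ} {m : ℤ} (hnc : PlaceNC β m)
    (hdvd : ∀ x, 0 ≤ x → x < m →
      ∃ F : Finset ℤ, k ∣ F.card ∧ ∀ y, y ∈ F ↔ (0 ≤ y ∧ y < m) ∧ β x = β y)
    {s t : ℤ} (hs : 0 ≤ s) (hst : s ≤ t) (ht : t < m) (hβ : β s = β t)
    (hout : ∀ x, 0 ≤ x → x < m → β s = β x → s ≤ x ∧ x ≤ t) : (k : ℤ) ∣ m - (t - s + 1) := by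
  have : k ∣ (Finset.Ico 0 m \ Finset.Icc s t).card := by
    refine dvd_card_of_closed (β := β) (m := m) Finset.sdiff_subset ?_ hdvd
    intro x hx y hy hym hxy
    rw [Finset.mem_sdiff, Finset.mem_Ico, Finset.mem_Icc] at *
    refine ⟨⟨hy, hym⟩, fun hcon => ?_⟩
    have hne : β s ≠ β x := fun h => hx.2 (hout x hx.1.1 hx.1.2 h)
    have hys : y ≠ s := by rintro rfl; exact hne hxy.symm
    have hyt : y ≠ t := by rintro rfl; exact hne (hβ.trans hxy.symm)
    rcases lt_or_ge x s with h | h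
    · exact hne (hnc x s y t hx.1.1 h (by omega) (by omega) ht hxy hβ).symm
    · exact hne ((hnc s y t x hs (by omega) (by omega) (by omega) hx.1.2 hβ hxy.symm).trans
        hxy.symm)
  rw [Finset.card_sdiff_of_subset (by
    intro x hx; rw [Finset.mem_Icc] at hx; rw [Finset.mem_Ico]; omega), Int.card_Ico,
    Int.card_Icc] at this
  have h2 := Int.natCast_dvd_natCast.2 this
  rw [Nat.cast_sub (by omega), Int.toNat_of_nonneg (by omega), Int.toNat_of_nonneg (by omega)] at h2
  convert h2 using 1
  ring

theorem exists_place_fiber (hk : 1 ≤ k) (hN : 0 < outerHalf k n) {β : ℤ → γ} (a b : ℤ)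
    (hdiv : ∀ x ∈ points k n, k ∣ (fiber k n β x).card) (x : ℤ) (_ : 0 ≤ x)
    (_ : x < discLen k n) :
    ∃ F : Finset ℤ, k ∣ F.card ∧
      ∀ y, y ∈ F ↔ (0 ≤ y ∧ y < discLen k n) ∧ β (discPt k n a b x) = β (discPt k n a b y) := by
  classical
  refine ⟨(Finset.Ico 0 (discLen k n)).filter
    (fun y => β (discPt k n a b x) = β (discPt k n a b y)), ?_, by simp⟩
  rw [← card_filter_points hk hN a b (fun y => β (discPt k n a b x) = β y)]
  rw [← fiber_eq_filter]
  exact hdiv _ (discPt_mem hk hN a b x)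

/-- A non-crossing labelling whose fibers have sizes divisible by `k` gives a divisible
non-crossing partition. -/
theorem isAnnularDivisible_of_label (hk : 1 ≤ k) (hN : 0 < outerHalf k n) {β : ℤ → γ}
    {P : Finset (Finset ℤ)} {a b : ℤ} (hab : a ≡ b [ZMOD k])
    (hP : ∀ V ∈ P, ∃ x ∈ points k n, fiber k n β x = V)
    (hdiv : ∀ x ∈ points k n, k ∣ (fiber k n β x).card)
    (hnc : PlaceNC (fun s => β (discPt k n a b s)) (discLen k n)) :
    IsAnnularDivisible k n P := by
  refine ⟨a, b, ?_, ?_⟩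
  · intro V hV W hW hVW x hx z hz y hy w hw ⟨h1, h2, h3⟩
    obtain ⟨v, hv, rfl⟩ := hP V hV
    obtain ⟨u, hu, rfl⟩ := hP W hW
    rw [mem_fiber] at hx hz hy hw
    have := hnc _ _ _ _ (cutPos_nonneg_lt hk hN a b x).1 h1 h2 h3
      (cutPos_nonneg_lt hk hN a b w).2.1
    simp only [discPt_cutPos hk hN a b hx.1, discPt_cutPos hk hN a b hy.1,
      discPt_cutPos hk hN a b hz.1, discPt_cutPos hk hN a b hw.1] at this
    have := this (hx.2.symm.trans hz.2) (hy.2.symm.trans hw.2)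
    exact hVW (fiber_congr (hx.2.trans (this.trans hy.2.symm)))
  · intro V hV e e' ⟨he, he', h⟩
    obtain ⟨v, hv, rfl⟩ := hP V hV
    have hF := exists_place_fiber hk hN a b hdiv
    have hmem : ∀ s, β (discPt k n a b (cutPos k n a b e)) = β (discPt k n a b s) →
        discPt k n a b s ∈ fiber k n β v := by
      intro s hs
      rw [mem_fiber] at he ⊢
      rw [discPt_cutPos hk hN a b he.1] at hs
      exact ⟨discPt_mem hk hN a b s, he.2.trans hs⟩
    have hep := (mem_fiber.1 he).1
    have hep' := (mem_fiber.1 he').1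
    have c1 := cutPos_nonneg_lt hk hN a b e
    have c2 := cutPos_nonneg_lt hk hN a b e'
    have hβ : β (discPt k n a b (cutPos k n a b e)) = β (discPt k n a b (cutPos k n a b e')) := by
      rw [discPt_cutPos hk hN a b hep, discPt_cutPos hk hN a b hep']
      exact (mem_fiber.1 he).2.symm.trans (mem_fiber.1 he').2
    refine (abs_modEq_cutPos hk hN hab hep').trans
      (Int.ModEq.trans ?_ ((abs_modEq_cutPos hk hN hab hep).add_right 1).symm)
    -- With a ≡ b the residue of |x| is the place of x up to a constant. Consecutive elements are a
    -- multiple of k plus one apart because the gap is a union of blocks; for the return from the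
    -- last element to the first, the complement of the span is one, and k divides the number of all
    -- places.
    rcases h with ⟨hlt, hgap⟩ | ⟨hmax, hmin⟩
    · have := dvd_gap hnc hF c1.1 hlt c2.2.1 hβ (by
        intro s hs1 hs2 hs
        have := hgap _ (hmem s hs)
        rw [cutPos_discPt hk hN a b (by omega) (by omega)] at this
        exact this ⟨hs1, hs2⟩)
      rw [Int.modEq_iff_dvd, ← dvd_neg]
      rwa [show ∀ u v c : ℤ, -(u + c + 1 - (v + c)) = v - u - 1 by intros; ring]
    · have := dvd_outside hnc hF c2.1 (hmax e' he') c1.2.1 hβ.symm (by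
        intro s hs1 hs2 hs
        have hs := hmem s (hβ.trans hs)
        have h1 := hmax _ hs
        have h2 := hmin _ hs
        rw [cutPos_discPt hk hN a b hs1 hs2] at h1 h2
        exact ⟨h2, h1⟩)
      have h3 : (k : ℤ) ∣ discLen k n := by
        rw [discLen]
        exact (dvd_outerHalf.mul_left 2).add (dvd_mul_left _ _)
      rw [Int.modEq_iff_dvd]
      have := (dvd_sub_right h3).1 this
      rwa [show ∀ u v c : ℤ, u + c + 1 - (v + c) = u - v + 1 by intros; ring]

/-- Conversely, the fibers are non-crossing as labels. -/
theorem placeNC_of_nonCrossing (hk : 1 ≤ k) (hN : 0 < outerHalf k n) {β : ℤ → γ}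
    {P : Finset (Finset ℤ)} {a b : ℤ} (hP : ∀ x ∈ points k n, fiber k n β x ∈ P)
    (h : NonCrossing P (cutPos k n a b)) :
    PlaceNC (fun s => β (discPt k n a b s)) (discLen k n) := by
  intro x y z w h0 hxy hyz hzw hw h1 h2
  by_contra hne
  have hx := discPt_mem hk hN a b x
  have hy := discPt_mem hk hN a b y
  refine h _ (hP _ hx) _ (hP _ hy) (fun h => hne ((fiber_eq_iff hy).1 h))
    _ (mem_fiber.2 ⟨hx, rfl⟩) _ (mem_fiber.2 ⟨discPt_mem hk hN a b z, h1⟩)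
    _ (mem_fiber.2 ⟨hy, rfl⟩) _ (mem_fiber.2 ⟨discPt_mem hk hN a b w, h2⟩) ?_
  rw [cutPos_discPt hk hN a b h0 (by omega), cutPos_discPt hk hN a b (by omega) (by omega),
    cutPos_discPt hk hN a b (by omega) (by omega), cutPos_discPt hk hN a b (by omega) hw]
  exact ⟨hxy, hyz, hzw⟩

/-- A block satisfying the congruence condition has a size divisible by `k`. -/
theorem dvd_card_of_congruence {V : Finset ℤ} {p : ℤ → ℤ} (hp : Set.InjOn p V)
    (h : ∀ e e' : ℤ, IsNext p V e e' → |e'| ≡ |e| + 1 [ZMOD (k : ℤ)]) : k ∣ V.card := by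
  rcases V.eq_empty_or_nonempty with rfl | hV
  · simp
  obtain ⟨e0, he0, hmin⟩ := Finset.exists_min_image V p hV
  obtain ⟨e1, he1, hmax⟩ := Finset.exists_max_image V p hV
  -- The residue of |e| advances by one per element, so it counts the elements before e; the step
  -- from the last element back to the first then makes the size 0 modulo k.
  have key : ∀ m : ℕ, ∀ e ∈ V, (V.filter (fun x => p x < p e)).card = m →
      |e| ≡ |e0| + m [ZMOD k] := by
    intro m
    induction m with
    | zero =>
      intro e he hcard
      rw [Finset.card_eq_zero, Finset.filter_eq_empty_iff] at hcard
      have : e = e0 := hp he he0 (le_antisymm (not_lt.1 (hcard he0)) (hmin e he))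
      simp [this]
    | succ m ih =>
      intro e he hcard
      have hne : (V.filter (fun x => p x < p e)).Nonempty := by
        rw [← Finset.card_pos]; omega
      obtain ⟨f, hf, hfmax⟩ := Finset.exists_max_image _ p hne
      rw [Finset.mem_filter] at hf
      have hins : V.filter (fun x => p x < p e) = insert f (V.filter (fun x => p x < p f)) := by
        ext x
        simp only [Finset.mem_filter, Finset.mem_insert]
        constructor
        · rintro ⟨h1, h2⟩
          rcases (hfmax x (Finset.mem_filter.2 ⟨h1, h2⟩)).eq_or_lt with h3 | h3
          · exact Or.inl (hp h1 hf.1 h3)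
          · exact Or.inr ⟨h1, h3⟩
        · rintro (rfl | ⟨h1, h2⟩)
          · exact hf
          · exact ⟨h1, h2.trans hf.2⟩
      rw [hins, Finset.card_insert_of_notMem (by simp)] at hcard
      have h1 := ih f hf.1 (by omega)
      have h2 := h f e ⟨hf.1, he, Or.inl ⟨hf.2, fun x hx hlt =>
        absurd (hfmax x (Finset.mem_filter.2 ⟨hx, hlt.2⟩)) (not_le.2 hlt.1)⟩⟩
      refine h2.trans ?_
      push_cast
      rw [← add_assoc]
      exact h1.add_right 1
  have h1 := key _ e1 he1 rfl
  have h2 := h e1 e0 ⟨he1, he0, Or.inr ⟨hmax, hmin⟩⟩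
  have h3 : V.filter (fun x => p x < p e1) = V.erase e1 := by
    ext x
    simp only [Finset.mem_filter, Finset.mem_erase]
    constructor
    · rintro ⟨hx, hlt⟩
      exact ⟨fun h => by subst h; exact lt_irrefl _ hlt, hx⟩
    · rintro ⟨hne, hx⟩
      exact ⟨hx, lt_of_le_of_ne (hmax x hx) fun h => hne (hp hx he1 h)⟩
  rw [h3, Finset.card_erase_of_mem he1] at h1
  have h4 := h2.trans (h1.add_right 1)
  have hpos : 1 ≤ V.card := Finset.card_pos.2 hV
  rw [Nat.cast_sub hpos, Int.modEq_iff_dvd] at h4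
  rw [← Int.natCast_dvd_natCast]
  convert h4 using 1
  push_cast
  ring

/-- A block that meets both circles forces the cut to be compatible with `k`. -/
theorem modEq_of_traversing (hk : 1 ≤ k) (hN : 0 < outerHalf k n) {β : ℤ → γ} {a b : ℤ}
    (hnc : PlaceNC (fun s => β (discPt k n a b s)) (discLen k n))
    (hdiv : ∀ x ∈ points k n, k ∣ (fiber k n β x).card) {x y : ℤ} (hx : x ∈ points k n)
    (hy : y ∈ points k n) (hxo : OnOuter k n x) (hyi : ¬ OnOuter k n y) (hβ : β x = β y)
    (hcong : ∀ e e' : ℤ, IsNext (cutPos k n a b) (fiber k n β x) e e' →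
      |e'| ≡ |e| + 1 [ZMOD (k : ℤ)]) : a ≡ b [ZMOD k] := by
  classical
  have cx := cutPos_nonneg_lt hk hN a b x
  have cy := cutPos_nonneg_lt hk hN a b y
  -- Here s is the last outer place of the block and t below its first inner place, so they are
  -- consecutive elements. The gap between them has a length divisible by k, and the congruence for
  -- this pair compares a with b.
  obtain ⟨s, ⟨hs1, hs2, hs3⟩, hs4⟩ := Int.exists_greatest_of_bdd
    (P := fun s => 0 ≤ s ∧ s < 2 * outerHalf k n ∧ β x = β (discPt k n a b s))
    ⟨2 * outerHalf k n, fun z hz => hz.2.1.le⟩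
    ⟨cutPos k n a b x, cx.1, cx.2.2.1 hxo, by rw [discPt_cutPos hk hN a b hx]⟩
  obtain ⟨t, ⟨ht1, ht2, ht3⟩, ht4⟩ := Int.exists_least_of_bdd
    (P := fun s => 2 * outerHalf k n ≤ s ∧ s < discLen k n ∧ β x = β (discPt k n a b s))
    ⟨2 * outerHalf k n, fun z hz => hz.1⟩
    ⟨cutPos k n a b y, not_lt.1 fun h => hyi (cy.2.2.2 h), cy.2.1,
      by rw [discPt_cutPos hk hN a b hy, hβ]⟩
  have hgap : ∀ u, s < u → u < t → β x ≠ β (discPt k n a b u) := by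
    intro u hu1 hu2 hu
    rcases lt_or_ge u (2 * outerHalf k n) with h | h
    · have := hs4 u ⟨by omega, h, hu⟩; omega
    · have := ht4 u ⟨h, by omega, hu⟩; omega
  have h1 := dvd_gap hnc (exists_place_fiber hk hN a b hdiv) hs1 (by omega) ht2
    (hs3.symm.trans ht3) (fun u hu1 hu2 h => hgap u hu1 hu2 (hs3.trans h))
  have h2 := hcong (discPt k n a b s) (discPt k n a b t)
    ⟨mem_fiber.2 ⟨discPt_mem hk hN a b s, hs3⟩, mem_fiber.2 ⟨discPt_mem hk hN a b t, ht3⟩, Or.inl (by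
      rw [cutPos_discPt hk hN a b hs1 (by omega), cutPos_discPt hk hN a b (by omega) ht2]
      refine ⟨by omega, fun u hu hlt => ?_⟩
      rw [mem_fiber] at hu
      exact hgap _ hlt.1 hlt.2 (by rw [discPt_cutPos hk hN a b hu.1]; exact hu.2))⟩
  rw [discPt, discPt, if_neg (by omega), if_pos hs2] at h2
  have h3 := ((abs_innerPt hk hN _).symm.trans h2).trans ((abs_outerPt hN _).add_right 1)
  rw [Int.modEq_iff_dvd] at h3
  have h4 : (k : ℤ) ∣ 2 * outerHalf k n := dvd_outerHalf.mul_left 2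
  rw [Int.modEq_iff_dvd, ← dvd_neg]
  have := (h3.sub h4).add h1
  convert this using 1
  ring

end Labels

end TypeD

/-! ### The height walk of a sequence and the labels it gives to the points -/

namespace TypeD

theorem dvd_of_dvd_of_eq {a b c : ℤ} (h : a ∣ b) (hbc : b = c) : a ∣ c := hbc ▸ h

section Height

variable {k : ℕ} {g : ℤ → ℕ}

/-- The walk with the steps `k * g p - 1`. -/
noncomputable def height (k : ℕ) (g : ℤ → ℕ) : ℤ → ℤ := walk (fun p => (k : ℤ) * g p - 1)

theorem height_succ (p : ℤ) : height k g (p + 1) = height k g p + (k * g p - 1) := walk_succ _ p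

theorem height_step (p : ℤ) : height k g p - 1 ≤ height k g (p + 1) := by
  rw [height_succ]
  have : (0 : ℤ) ≤ k * g p := by positivity
  omega

/-- Every step is -1 modulo k. Thus heights and positions carry the same residue information, which
makes the cuts below compatible with k. -/
theorem height_modEq (p : ℤ) : height k g p ≡ -p [ZMOD k] := by
  induction p using Int.induction_on with
  | zero => simp [height, walk_zero]
  | succ i ih =>
    rw [height_succ, Int.modEq_iff_dvd] at *
    exact dvd_of_dvd_of_eq (ih.sub (dvd_mul_right (k : ℤ) (g i))) (by ring)
  | pred i ih =>
    have h := height_succ (k := k) (g := g) (-i - 1)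
    rw [sub_add_cancel] at h
    rw [h, Int.modEq_iff_dvd] at ih
    rw [Int.modEq_iff_dvd]
    exact dvd_of_dvd_of_eq (ih.add (dvd_mul_right (k : ℤ) (g (-i - 1)))) (by ring)

theorem height_add_period {N : ℤ} (hg : ∀ p, g (p + N) = g p) (p : ℤ) :
    height k g (p + N) = height k g p + height k g N :=
  walk_add_period (fun p => by simp [hg]) p

theorem le_height_succ_iff (hk : 1 ≤ k) (p : ℤ) :
    height k g p ≤ height k g (p + 1) ↔ 1 ≤ g p := by
  rw [height_succ]
  constructor
  · intro h
    by_contra hcon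
    have : g p = 0 := by omega
    rw [this] at h
    simp at h
  · intro h
    have : (1 : ℤ) * 1 ≤ k * g p := by gcongr <;> exact_mod_cast ‹_›
    omega

theorem periodic_mul {N : ℤ} (hg : ∀ p, g (p + N) = g p) (p m : ℤ) : g (p + N * m) = g p := by
  induction m using Int.induction_on with
  | zero => simp
  | succ i ih => rw [show p + N * (i + 1) = p + N * i + N by ring, hg, ih]
  | pred i ih =>
    rw [← ih, ← hg]; congr 1; ring

end Height

section Label

variable {k n : ℕ} {g : ℤ → ℕ} {r e : ℤ}

open Classical in
/-- The label of the outer point at the position `p`: the position of its opener, if any. -/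
noncomputable def outerLabel (N : ℤ) (H : ℤ → ℤ) (p : ℤ) : ℤ :=
  if h : ∃ j, IsOpener H j p then h.choose % (2 * N) else -1

open Classical in
/-- The label of the inner point at the position `q`: the position of its opener, if any. If the
walk is periodic, there is no opener, and the inner points get two labels, according to the half
of the inner circle they are on. -/
noncomputable def innerLabel (N k : ℤ) (H : ℤ → ℤ) (r e q : ℤ) : ℤ :=
  -- The inner circle prolongs the walk by down-steps, and the point at q is the step that ends at
  -- level e - 1 - q. Its opener is the last time at or below this level; e fixes how the inner
  -- circle is turned.
  if h : ∃ j, IsLastBelow H j (e - 1 - q) then h.choose % (2 * N)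
  -- At drift 0, H r is the minimum of the walk. The k positions from e - H r on get the label -1,
  -- the next k get -2, and so on alternately.
  else if H N = 0 then -1 - ((q + H r - e) / k) % 2 else -1

/-- The label of a point. -/
noncomputable def label (k n : ℕ) (g : ℤ → ℕ) (r e x : ℤ) : ℤ :=
  if OnOuter k n x then outerLabel (outerHalf k n) (height k g) (outerPos k n x)
  else innerLabel (outerHalf k n) k (height k g) r e (innerPos k n x)

theorem outerLabel_of_isOpener {N : ℤ} {H : ℤ → ℤ} {j p : ℤ} (h : IsOpener H j p) :
    outerLabel N H p = j % (2 * N) := by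
  have hex : ∃ j, IsOpener H j p := ⟨j, h⟩
  rw [outerLabel, dif_pos hex, hex.choose_spec.unique h]

theorem outerLabel_of_not {N : ℤ} {H : ℤ → ℤ} {p : ℤ} (h : ∀ j, ¬ IsOpener H j p) :
    outerLabel N H p = -1 := by
  rw [outerLabel, dif_neg (by simpa using h)]

theorem innerLabel_of_isLastBelow {N k : ℤ} {H : ℤ → ℤ} {r e j q : ℤ}
    (h : IsLastBelow H j (e - 1 - q)) : innerLabel N k H r e q = j % (2 * N) := by
  have hex : ∃ j, IsLastBelow H j (e - 1 - q) := ⟨j, h⟩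
  rw [innerLabel, dif_pos hex, hex.choose_spec.unique h]

theorem innerLabel_of_not {N k : ℤ} {H : ℤ → ℤ} {r e q : ℤ}
    (h : ∀ j, ¬ IsLastBelow H j (e - 1 - q)) : innerLabel N k H r e q =
      if H N = 0 then -1 - ((q + H r - e) / k) % 2 else -1 := by
  rw [innerLabel, dif_neg (by simpa using h)]

/-- The label of the opposite point. -/
def oppLabel (N d v : ℤ) : ℤ :=
  if 0 ≤ v then (v + N) % (2 * N) else if d = 0 then -3 - v else v

theorem oppLabel_emod {N d : ℤ} (hN : 0 < N) (j : ℤ) :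
    oppLabel N d (j % (2 * N)) = (j + N) % (2 * N) := by
  rw [oppLabel, if_pos (Int.emod_nonneg _ (by omega)), Int.emod_add_emod]

theorem outerLabel_add {N d : ℤ} {H : ℤ → ℤ} (hN : 0 < N) (hper : ∀ p, H (p + N) = H p + d)
    (p : ℤ) : outerLabel N H (p + N) = oppLabel N d (outerLabel N H p) := by
  by_cases h : ∃ j, IsOpener H j p
  · obtain ⟨j, hj⟩ := h
    have := hj.shift hper 1
    rw [mul_one] at this
    rw [outerLabel_of_isOpener hj, outerLabel_of_isOpener this, oppLabel_emod hN]
  · have hd : d ≠ 0 := fun hd => h (exists_isOpener_of_nonneg hN hper hd.ge p)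
    push Not at h
    rw [outerLabel_of_not h, outerLabel_of_not, oppLabel, if_neg (by omega), if_neg hd]
    intro j hj
    have := hj.shift hper (-1)
    rw [show p + N + N * -1 = p by ring] at this
    exact h _ this

theorem outerLabel_add_mul {N d : ℤ} {H : ℤ → ℤ} (hper : ∀ p, H (p + N) = H p + d)
    (p m : ℤ) : outerLabel N H (p + 2 * N * m) = outerLabel N H p := by
  by_cases h : ∃ j, IsOpener H j p
  · obtain ⟨j, hj⟩ := h
    have := hj.shift hper (2 * m)
    rw [show N * (2 * m) = 2 * N * m by ring] at this
    rw [outerLabel_of_isOpener hj, outerLabel_of_isOpener this, Int.add_mul_emod_self_left]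
  · push Not at h
    rw [outerLabel_of_not h, outerLabel_of_not]
    intro j hj
    have := hj.shift hper (-(2 * m))
    rw [show p + 2 * N * m + N * (-(2 * m)) = p by ring] at this
    exact h _ this

theorem half_emod_two {k : ℤ} (hk : 0 < k) (q : ℤ) :
    ((q + k) / k) % 2 = 1 - (q / k) % 2 := by
  have := Int.add_mul_ediv_right q 1 hk.ne'
  rw [one_mul] at this
  omega

/-- Half a turn of the inner circle lowers the level by k. If d = k, this is the change of height
over one period backwards, so the opener moves by half the outer circle; if d = 0, the halves -1 and
-2 are exchanged. -/
theorem innerLabel_add {N k d : ℤ} {H : ℤ → ℤ} (hN : 0 < N) (hk : 0 < k)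
    (hper : ∀ p, H (p + N) = H p + d) (hd : d ≤ 0 ∨ d = k) (hHN : H N = d) (r e q : ℤ) :
    innerLabel N k H r e (q + k) = oppLabel N d (innerLabel N k H r e q) := by
  have hnot : ∀ q, (¬ ∃ j, IsLastBelow H j (e - 1 - q)) →
      ¬ ∃ j, IsLastBelow H j (e - 1 - (q + k)) := by
    rintro q h ⟨j, hj⟩
    rcases hd with hd | rfl
    · exact not_isLastBelow hN hper hd _ _ hj
    · have := hj.shift hper 1
      rw [show e - 1 - (q + d) + d * 1 = e - 1 - q by ring] at this
      exact h ⟨_, this⟩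
  by_cases h : ∃ j, IsLastBelow H j (e - 1 - q)
  · obtain ⟨j, hj⟩ := h
    rcases hd with hd | rfl
    · exact absurd hj (not_isLastBelow hN hper hd _ _)
    · have := hj.shift hper (-1)
      rw [show e - 1 - q + d * -1 = e - 1 - (q + d) by ring] at this
      rw [innerLabel_of_isLastBelow hj, innerLabel_of_isLastBelow this, oppLabel_emod hN,
        show j + N = j + N * -1 + 2 * N * 1 by ring, Int.add_mul_emod_self_left]
  · have h2 := hnot q h
    push Not at h h2
    rw [innerLabel_of_not h, innerLabel_of_not h2, hHN]
    split_ifs with hd0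
    · rw [show q + k + H r - e = q + H r - e + k by ring, half_emod_two hk, oppLabel,
        if_neg (by omega), if_pos hd0]
      omega
    · rw [oppLabel, if_neg (by omega), if_neg hd0]

theorem oppLabel_oppLabel_of {N d v : ℤ} (hN : 0 < N) (hv : v < 2 * N) :
    oppLabel N d (oppLabel N d v) = v ∨ (d = 0 ∧ v < -2) := by
  by_cases h0 : 0 ≤ v
  · left
    have : oppLabel N d v = (v + N) % (2 * N) := by rw [oppLabel, if_pos h0]
    rw [this, oppLabel_emod hN, show v + N + N = v + 2 * N * 1 by ring,
      Int.add_mul_emod_self_left, Int.emod_eq_of_lt h0 hv]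
  · by_cases hd : d = 0
    · by_cases hv2 : v < -2
      · exact Or.inr ⟨hd, hv2⟩
      · left
        have h1 : oppLabel N d v = -3 - v := by rw [oppLabel, if_neg h0, if_pos hd]
        rw [h1, oppLabel, if_neg (by omega), if_pos hd]
        omega
    · left
      have h1 : oppLabel N d v = v := by rw [oppLabel, if_neg h0, if_neg hd]
      rw [h1, h1]

theorem innerLabel_bounds {N k : ℤ} {H : ℤ → ℤ} (hN : 0 < N) (r e q : ℤ) :
    -2 ≤ innerLabel N k H r e q ∧ innerLabel N k H r e q < 2 * N := by
  by_cases h : ∃ j, IsLastBelow H j (e - 1 - q)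
  · obtain ⟨j, hj⟩ := h
    rw [innerLabel_of_isLastBelow hj]
    have := Int.emod_nonneg j (by omega : 2 * N ≠ 0)
    have := Int.emod_lt_of_pos j (by omega : 0 < 2 * N)
    omega
  · push Not at h
    rw [innerLabel_of_not h]
    split_ifs <;> omega

theorem innerLabel_add_mul {N k d : ℤ} {H : ℤ → ℤ} (hN : 0 < N) (hk : 0 < k)
    (hper : ∀ p, H (p + N) = H p + d) (hd : d ≤ 0 ∨ d = k) (hHN : H N = d) (r e q m : ℤ) :
    innerLabel N k H r e (q + 2 * k * m) = innerLabel N k H r e q := by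
  have h2 : ∀ q, innerLabel N k H r e (q + 2 * k) = innerLabel N k H r e q := by
    intro q
    rw [show q + 2 * k = q + k + k by ring, innerLabel_add hN hk hper hd hHN,
      innerLabel_add hN hk hper hd hHN]
    have hb := innerLabel_bounds (k := k) (H := H) hN r e q
    rcases oppLabel_oppLabel_of (d := d) hN hb.2 with h | h
    · exact h
    · omega
  induction m using Int.induction_on with
  | zero => simp
  | succ i ih => rw [show q + 2 * k * (i + 1) = q + 2 * k * i + 2 * k by ring, h2, ih]
  | pred i ih => rw [← ih, ← h2]; congr 1; ring

end Label

/-! ### Codes and their labels read in a disc cut at a record -/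

section Code

variable {k n : ℕ} {g : ℤ → ℕ} {r e : ℤ}

/-- The data that encode the partitions: `g` is periodic, its sum over a period is at most `n`, and
the height is minimal at `r` if it is periodic. -/
structure IsCode (k n : ℕ) (g : ℤ → ℕ) (r e : ℤ) : Prop where
  one_le : 1 ≤ k
  pos : 0 < outerHalf k n
  periodic : ∀ p, g (p + outerHalf k n) = g p
  drift : height k g (outerHalf k n) ≤ 0 ∨ height k g (outerHalf k n) = k
  record : IsRecord (height k g) (height k g (outerHalf k n)) r
  dvd : (k : ℤ) ∣ e

namespace IsCode

theorem kpos (c : IsCode k n g r e) : (0 : ℤ) < k := by exact_mod_cast c.one_le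

theorem per (c : IsCode k n g r e) (p : ℤ) :
    height k g (p + outerHalf k n) = height k g p + height k g (outerHalf k n) :=
  height_add_period c.periodic p

theorem label_outerPt (c : IsCode k n g r e) (p : ℤ) :
    label k n g r e (outerPt (outerHalf k n) p) = outerLabel (outerHalf k n) (height k g) p := by
  rw [label, if_pos (onOuter_outerPt c.pos p), outerPos_outerPt c.pos]
  obtain ⟨q, hq, -, -⟩ := exists_eq_emod_add_mul p (b := 2 * outerHalf k n) (by have := c.pos; omega)
  conv_rhs => rw [hq]
  rw [outerLabel_add_mul c.per]

theorem label_innerPt (c : IsCode k n g r e) (q : ℤ) :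
    label k n g r e (innerPt (outerHalf k n) k q)
      = innerLabel (outerHalf k n) k (height k g) r e q := by
  rw [label, if_neg (not_onOuter_innerPt c.one_le c.pos q), innerPos_innerPt c.one_le c.pos]
  obtain ⟨m, hm, -, -⟩ := exists_eq_emod_add_mul q (b := 2 * (k : ℤ)) (by have := c.kpos; omega)
  conv_rhs => rw [hm]
  rw [innerLabel_add_mul c.pos c.kpos c.per c.drift rfl]

theorem label_neg (c : IsCode k n g r e) {x : ℤ} (hx : x ∈ points k n) :
    label k n g r e (-x) =
      oppLabel (outerHalf k n) (height k g (outerHalf k n)) (label k n g r e x) := by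
  by_cases h : OnOuter k n x
  · rw [← outerPt_outerPos hx h, ← outerPt_add_period c.pos, c.label_outerPt, c.label_outerPt,
      outerLabel_add c.pos c.per]
  · rw [← innerPt_innerPos c.pos hx h, ← innerPt_add_period c.kpos, c.label_innerPt,
      c.label_innerPt, innerLabel_add c.pos c.kpos c.per c.drift rfl]

/-- The heights at the places of the disc: after the outer points there is one step down for each
inner point. -/
noncomputable def discHeight (N : ℤ) (H : ℤ → ℤ) (a s : ℤ) : ℤ :=
  if s ≤ 2 * N then H (a + s) else H (a + 2 * N) - (s - 2 * N)

theorem discHeight_of_le {N : ℤ} {H : ℤ → ℤ} {a s : ℤ} (h : s ≤ 2 * N) :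
    discHeight N H a s = H (a + s) := if_pos h

theorem discHeight_of_ge {N : ℤ} {H : ℤ → ℤ} {a s : ℤ} (h : 2 * N ≤ s) :
    discHeight N H a s = H (a + 2 * N) - (s - 2 * N) := by
  rw [discHeight]
  split_ifs with h'
  · rw [le_antisymm h' h]; omega
  · rfl

theorem isOpener_discHeight_iff {N : ℤ} {H : ℤ → ℤ} {a j s : ℤ} (hs : s < 2 * N) :
    IsOpener (discHeight N H a) j s ↔ IsOpener H (a + j) (a + s) := by
  unfold IsOpener
  rw [add_assoc a s 1]
  constructor
  · rintro ⟨h1, h2, h3⟩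
    rw [discHeight_of_le (by omega), discHeight_of_le (by omega)] at h2
    refine ⟨by omega, h2, fun i hi1 hi2 => ?_⟩
    have := h3 (i - a) (by omega) (by omega)
    rwa [discHeight_of_le (by omega), discHeight_of_le (by omega), add_sub_cancel] at this
  · rintro ⟨h1, h2, h3⟩
    rw [discHeight_of_le (by omega), discHeight_of_le (by omega)]
    refine ⟨by omega, h2, fun i hi1 hi2 => ?_⟩
    rw [discHeight_of_le (by omega)]
    exact h3 _ (by omega) (by omega)

theorem height_add_two (c : IsCode k n g r e) (p : ℤ) :
    height k g (p + 2 * outerHalf k n) = height k g p + 2 * height k g (outerHalf k n) := by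
  rw [two_mul, ← add_assoc, c.per, c.per]; ring

theorem record_add_two (c : IsCode k n g r e) {a : ℤ}
    (ha : IsRecord (height k g) (height k g (outerHalf k n)) a) :
    IsRecord (height k g) (height k g (outerHalf k n)) (a + 2 * outerHalf k n) := by
  have := isRecord_add c.per ha 2
  rwa [mul_comm] at this

/-- Labels for places without an opener. -/
def specialLabel (k n : ℕ) (d s : ℤ) : ℤ :=
  if d = 0 ∧ 2 * outerHalf k n + k ≤ s then -2 else -1

/-- The description of the labels in a disc cut at a record of the height. -/
theorem label_discPt (c : IsCode k n g r e) {a : ℤ}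
    (ha : IsRecord (height k g) (height k g (outerHalf k n)) a) {s : ℤ} (hs0 : 0 ≤ s)
    (hs : s < discLen k n) :
    (∃ j, 0 ≤ j ∧ j < 2 * outerHalf k n ∧
      IsOpener (discHeight (outerHalf k n) (height k g) a) j s ∧
      label k n g r e (discPt k n a (e - height k g (a + 2 * outerHalf k n)) s)
        = (a + j) % (2 * outerHalf k n)) ∨
    ((∀ j, 0 ≤ j → ¬ IsOpener (discHeight (outerHalf k n) (height k g) a) j s) ∧
      label k n g r e (discPt k n a (e - height k g (a + 2 * outerHalf k n)) s)
        = specialLabel k n (height k g (outerHalf k n)) s) := by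
  have hN := c.pos
  have hkpos := c.kpos
  rw [discLen] at hs
  rw [discPt]
  split_ifs with hso
  · rw [c.label_outerPt]
    by_cases h : ∃ j, IsOpener (height k g) j (a + s)
    · obtain ⟨j, hj⟩ := h
      have haj := ha.le_of_isOpener hN c.per (by omega) hj
      have hjs := hj.1
      refine Or.inl ⟨j - a, by omega, by omega, ?_, ?_⟩
      · rw [isOpener_discHeight_iff hso, add_sub_cancel]; exact hj
      · rw [add_sub_cancel]; exact outerLabel_of_isOpener hj
    · push Not at h
      refine Or.inr ⟨fun j _ hj => h _ ((isOpener_discHeight_iff hso).1 hj), ?_⟩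
      rw [outerLabel_of_not h, specialLabel, if_neg (by omega)]
  · rw [not_lt] at hso
    rw [c.label_innerPt]
    -- The inner cut e - H (a + 2N) is chosen such that the level of the inner place s is the disc
    -- height after s; a last visit at or below the level then becomes an opener in the disc.
    set l := height k g (a + 2 * outerHalf k n) - 1 - (s - 2 * outerHalf k n) with hl
    have hle : e - 1 - (e - height k g (a + 2 * outerHalf k n) + (s - 2 * outerHalf k n)) = l := by
      omega
    have hKs : discHeight (outerHalf k n) (height k g) a (s + 1) = l := by
      rw [discHeight_of_ge (by omega)]; omega
    have hrec := c.record_add_two ha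
    by_cases h : ∃ j, IsLastBelow (height k g) j l
    · obtain ⟨j, hj⟩ := h
      have hd : height k g (outerHalf k n) = k := by
        rcases c.drift with hd | hd
        · exact absurd hj (not_isLastBelow hN c.per hd _ _)
        · exact hd
      have h2 := c.height_add_two a
      -- H (a + 2N) = H a + 2k and there are only 2k inner places, so the level l does not fall
      -- below H a.
      have haj : a ≤ j := by
        by_contra hcon
        have := hj.2 a (by omega)
        omega
      have hja : j < a + 2 * outerHalf k n := by
        by_contra hcon
        have := hrec.1 (by omega) j (by omega)
        have := hj.1
        omega
      refine Or.inl ⟨j - a, by omega, by omega, ⟨by omega, ?_, fun i h1 h2 => ?_⟩, ?_⟩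
      · rw [hKs, discHeight_of_le (by omega), add_sub_cancel]; exact hj.1
      · rw [hKs]
        rcases le_or_gt i (2 * outerHalf k n) with h3 | h3
        · rw [discHeight_of_le h3]; exact hj.2 _ (by omega)
        · rw [discHeight_of_ge h3.le]; omega
      · rw [add_sub_cancel]
        exact innerLabel_of_isLastBelow (by rw [hle]; exact hj)
    · push Not at h
      refine Or.inr ⟨fun j hj0 hj => ?_, ?_⟩
      · have hj2 : j < 2 * outerHalf k n := by
          by_contra hcon
          have := hj.le_succ
          rw [discHeight_of_ge (by omega), discHeight_of_ge (by omega)] at this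
          omega
        have h1 := hj.2.1
        rw [hKs, discHeight_of_le hj2.le] at h1
        rcases le_or_gt (height k g (outerHalf k n)) 0 with hd | hd
        · have := hrec.2 hd (a + j) (by omega)
          omega
        · refine h (a + j) ⟨h1, fun i hi => ?_⟩
          rcases le_or_gt i (a + 2 * outerHalf k n) with h3 | h3
          · have := hj.2.2 (i - a) (by omega) (by omega)
            rwa [hKs, discHeight_of_le (by omega), add_sub_cancel] at this
          · have := hrec.1 hd.le i h3.le
            omega
      · rw [innerLabel_of_not (by rw [hle]; exact h), specialLabel]
        by_cases hd : height k g (outerHalf k n) = 0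
        -- At drift 0 a record is a global minimum, so all records have the same height and the
        -- inner cut falls on the border between two halves.
        · have hm : height k g r = height k g (a + 2 * outerHalf k n) := by
            have h1 := c.record
            rw [hd] at h1 hrec
            rcases le_total r (a + 2 * outerHalf k n) with h | h
            · exact le_antisymm (h1.1 le_rfl _ h) (hrec.2 le_rfl _ h)
            · exact le_antisymm (h1.2 le_rfl _ h) (hrec.1 le_rfl _ h)
          rw [if_pos hd, hm, show e - height k g (a + 2 * outerHalf k n) + (s - 2 * outerHalf k n)
            + height k g (a + 2 * outerHalf k n) - e = s - 2 * outerHalf k n by ring]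
          rcases lt_or_ge (s - 2 * outerHalf k n) k with h3 | h3
          · rw [Int.ediv_eq_zero_of_lt (by omega) h3, if_neg (by omega)]; rfl
          · have : (s - 2 * outerHalf k n) / k = 1 := by
              rw [Int.ediv_eq_iff_of_pos hkpos]; constructor <;> linarith
            rw [this, if_pos ⟨hd, by omega⟩]; rfl
        · rw [if_neg hd, if_neg (by tauto)]

/-- This follows from H p ≡ -p modulo k, as k divides 2N and e. -/
theorem discCut_modEq (c : IsCode k n g r e) (a : ℤ) :
    a ≡ e - height k g (a + 2 * outerHalf k n) [ZMOD k] := by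
  have h1 := height_modEq (k := k) (g := g) (a + 2 * outerHalf k n)
  rw [Int.modEq_iff_dvd] at *
  have h2 : (k : ℤ) ∣ 2 * outerHalf k n := dvd_outerHalf.mul_left 2
  have := (h1.add h2).add c.dvd
  rwa [show -(a + 2 * outerHalf k n) - height k g (a + 2 * outerHalf k n) + 2 * outerHalf k n + e
    = e - height k g (a + 2 * outerHalf k n) - a by ring] at this

theorem emod_inj {m a i j : ℤ} (hi : 0 ≤ i) (hi' : i < m) (hj : 0 ≤ j) (hj' : j < m)
    (h : (a + i) % m = (a + j) % m) : i = j := by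
  have h2 : i % m = j % m := by
    have : (a + i) ≡ (a + j) [ZMOD m] := h
    exact Int.ModEq.add_left_cancel' a this
  rwa [Int.emod_eq_of_lt hi hi', Int.emod_eq_of_lt hj hj'] at h2

/-- Two blocks with openers do not cross because arcs are nested, and nesting also shows that a
place under an arc has an opener, so the remaining places do not cross such a block. Among the
places without opener the label changes at most once. -/
theorem placeNC_label (c : IsCode k n g r e) {a : ℤ}
    (ha : IsRecord (height k g) (height k g (outerHalf k n)) a) :
    PlaceNC (fun s => label k n g r e
      (discPt k n a (e - height k g (a + 2 * outerHalf k n)) s)) (discLen k n) := by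
  have hN := c.pos
  have key : ∀ s t, 0 ≤ s → s < discLen k n → 0 ≤ t → t < discLen k n →
      label k n g r e (discPt k n a (e - height k g (a + 2 * outerHalf k n)) s) =
        label k n g r e (discPt k n a (e - height k g (a + 2 * outerHalf k n)) t) →
      (∃ j, 0 ≤ j ∧ IsOpener (discHeight (outerHalf k n) (height k g) a) j s ∧
        IsOpener (discHeight (outerHalf k n) (height k g) a) j t ∧
        label k n g r e (discPt k n a (e - height k g (a + 2 * outerHalf k n)) s)
          = (a + j) % (2 * outerHalf k n)) ∨
      ((∀ j, 0 ≤ j → ¬ IsOpener (discHeight (outerHalf k n) (height k g) a) j s) ∧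
      (∀ j, 0 ≤ j → ¬ IsOpener (discHeight (outerHalf k n) (height k g) a) j t) ∧
        label k n g r e (discPt k n a (e - height k g (a + 2 * outerHalf k n)) s)
          = specialLabel k n (height k g (outerHalf k n)) s ∧
        label k n g r e (discPt k n a (e - height k g (a + 2 * outerHalf k n)) t)
          = specialLabel k n (height k g (outerHalf k n)) t) := by
    intro s t hs0 hs ht0 ht hst
    have hneg : ∀ s, specialLabel k n (height k g (outerHalf k n)) s < 0 := by
      intro s; rw [specialLabel]; split_ifs <;> omega
    have hnn : ∀ j, 0 ≤ j % (2 * outerHalf k n) := fun j => Int.emod_nonneg _ (by omega)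
    rcases c.label_discPt ha hs0 hs with ⟨i, hi0, hi1, hi2, hi3⟩ | ⟨hi2, hi3⟩ <;>
    rcases c.label_discPt ha ht0 ht with ⟨j, hj0, hj1, hj2, hj3⟩ | ⟨hj2, hj3⟩
    · have := emod_inj hi0 hi1 hj0 hj1 (hi3.symm.trans (hst.trans hj3))
      subst this
      exact Or.inl ⟨i, hi0, hi2, hj2, hi3⟩
    · have := hnn (a + i); have := hneg t; omega
    · have := hnn (a + j); have := hneg s; omega
    · exact Or.inr ⟨hi2, hj2, hi3, hj3⟩
  intro x y z w hx hxy hyz hzw hw h1 h2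
  rcases key x z hx (by omega) (by omega) (by omega) h1 with ⟨i, hi0, hi1, hi2, hi3⟩ |
    ⟨hi1, hi2, hi3, hi4⟩ <;>
  rcases key y w (by omega) (by omega) (by omega) (by omega) h2 with ⟨j, hj0, hj1, hj2, hj3⟩ |
    ⟨hj1, hj2, hj3, hj4⟩
  · have := hi1.eq_of_crossing hi2 hj1 hj2 hxy hyz hzw
    subst this
    exact hi3.trans hj3.symm
  · obtain ⟨j, hj, hj'⟩ := hi2.nested (hi1.1.trans hxy.le) hyz.le
    exact absurd hj' (hj1 j (by omega))
  · obtain ⟨i, hi, hi'⟩ := hj2.nested (hj1.1.trans hyz.le) hzw.le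
    exact absurd hi' (hi2 i (by omega))
  · simp only at h1 h2 ⊢
    rw [hi3, hi4] at h1
    rw [hi3, hj3]
    revert h1
    unfold specialLabel
    split_ifs <;> omega

end IsCode

end Code

end TypeD

/-! ### Opposite blocks, block sizes and zero-blocks of the partition of a code -/

namespace TypeD

section Neg

variable {γ : Type*} {k n : ℕ} {β : ℤ → γ}

theorem mem_negBlock {V : Finset ℤ} {x : ℤ} : x ∈ negBlock V ↔ -x ∈ V := by
  rw [negBlock, Finset.mem_image]
  constructor
  · rintro ⟨y, hy, rfl⟩; rwa [neg_neg]
  · intro h; exact ⟨-x, h, neg_neg x⟩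

theorem card_negBlock (V : Finset ℤ) : (negBlock V).card = V.card :=
  Finset.card_image_of_injective _ neg_injective

theorem negBlock_union (V W : Finset ℤ) : negBlock (V ∪ W) = negBlock V ∪ negBlock W := by
  ext x; simp only [mem_negBlock, Finset.mem_union]

theorem negBlock_fiber
    (hβ : ∀ x ∈ points k n, ∀ y ∈ points k n, β x = β y → β (-x) = β (-y)) {x : ℤ}
    (hx : x ∈ points k n) : negBlock (fiber k n β x) = fiber k n β (-x) := by
  ext y
  rw [mem_negBlock, mem_fiber, mem_fiber]
  constructor
  · rintro ⟨h1, h2⟩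
    have h3 := neg_mem_points h1
    rw [neg_neg] at h3
    refine ⟨h3, ?_⟩
    have := hβ x hx _ h1 h2
    rwa [neg_neg] at this
  · rintro ⟨h1, h2⟩
    refine ⟨neg_mem_points h1, ?_⟩
    have := hβ _ (neg_mem_points hx) _ h1 h2
    rwa [neg_neg] at this

theorem outerCyclic_outerPt_iff (hN : 0 < outerHalf k n) {x y z w : ℤ} :
    OuterCyclic k n (outerPt (outerHalf k n) x) (outerPt (outerHalf k n) y)
      (outerPt (outerHalf k n) z) (outerPt (outerHalf k n) w) ↔
    0 < (y - x) % (2 * outerHalf k n) ∧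
    (y - x) % (2 * outerHalf k n) < (z - x) % (2 * outerHalf k n) ∧
    (z - x) % (2 * outerHalf k n) < (w - x) % (2 * outerHalf k n) := by
  unfold OuterCyclic
  simp only [outerPos_outerPt hN, Int.emod_sub_emod, Int.sub_emod_emod]

theorem outerCyclic_of_lt (hN : 0 < outerHalf k n) {x y z w : ℤ} (hxy : x < y) (hyz : y < z)
    (hzw : z < w) (hwx : w < x + 2 * outerHalf k n) :
    OuterCyclic k n (outerPt (outerHalf k n) x) (outerPt (outerHalf k n) y)
      (outerPt (outerHalf k n) z) (outerPt (outerHalf k n) w) := by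
  rw [outerCyclic_outerPt_iff hN, Int.emod_eq_of_lt (by omega) (by omega),
    Int.emod_eq_of_lt (by omega) (by omega), Int.emod_eq_of_lt (by omega) (by omega)]
  omega

theorem card_inner (hk : 1 ≤ k) (hN : 0 < outerHalf k n) :
    ((points k n).filter (fun x => ¬ OnOuter k n x)).card = 2 * k := by
  classical
  rw [← Nat.cast_inj (R := ℤ)]
  have h1 := card_filter_points hk hN 0 0 (fun x => ¬ OnOuter k n x)
  have h2 : (Finset.Ico 0 (discLen k n)).filter (fun s => ¬ OnOuter k n (discPt k n 0 0 s))
      = Finset.Ico (2 * outerHalf k n) (discLen k n) := by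
    ext s
    rw [Finset.mem_filter, Finset.mem_Ico, Finset.mem_Ico]
    constructor
    · rintro ⟨⟨h0, h1⟩, h2⟩
      rw [(cutPos_nonneg_lt hk hN 0 0 _).2.2, cutPos_discPt hk hN 0 0 h0 h1] at h2
      omega
    · rintro ⟨h0, h1⟩
      refine ⟨⟨by omega, h1⟩, ?_⟩
      rw [(cutPos_nonneg_lt hk hN 0 0 _).2.2, cutPos_discPt hk hN 0 0 (by omega) h1]
      omega
  rw [h2, Int.card_Ico, discLen] at h1
  have h3 : ((points k n).filter (fun x => ¬ OnOuter k n x)).card =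
    (2 * outerHalf k n + 2 * (k : ℤ) - 2 * outerHalf k n).toNat := by rw [← h1]
  rw [h3]
  push_cast
  omega

end Neg

namespace IsCode

variable {k n : ℕ} {g : ℤ → ℕ} {r e : ℤ}

theorem discHeight_step (a s : ℤ) :
    discHeight (outerHalf k n) (height k g) a s - 1
      ≤ discHeight (outerHalf k n) (height k g) a (s + 1) := by
  rcases lt_or_ge s (2 * outerHalf k n) with h | h
  · rw [discHeight_of_le h.le, discHeight_of_le (by omega), ← add_assoc]
    exact height_step _
  · rw [discHeight_of_ge h, discHeight_of_ge (by omega)]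
    omega

-- In the disc cut at r, the position i stands at the place j. It opens one place for each level
-- from its height before to its height after the step, which are k * `g i` levels, or none if `g i`
-- = 0.
open Classical in
theorem card_label (c : IsCode k n g r e) {i : ℤ} (hi0 : 0 ≤ i) (hi : i < 2 * outerHalf k n) :
    ((points k n).filter (fun x => label k n g r e x = i)).card = k * g i := by
  have hN := c.pos
  obtain ⟨q, hq, hj0, hj1⟩ := exists_eq_emod_add_mul (i - r) (b := 2 * outerHalf k n) (by omega)
  set j := (i - r) % (2 * outerHalf k n) with hj
  have hij : (r + j) % (2 * outerHalf k n) = i :=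
    emod_eq_of_eq_add_mul (q := -q) (by linarith) hi0 hi
  have hgi : g (r + j) = g i := by
    rw [← periodic_mul c.periodic i (-(2 * q))]; congr 1; linarith
  rw [card_filter_points c.one_le hN r (e - height k g (r + 2 * outerHalf k n))
    (fun x => label k n g r e x = i)]
  have hS : (Finset.Ico 0 (discLen k n)).filter (fun s => label k n g r e
      (discPt k n r (e - height k g (r + 2 * outerHalf k n)) s) = i)
      = (Finset.Ico 0 (discLen k n)).filter
        (IsOpener (discHeight (outerHalf k n) (height k g) r) j) := by
    refine Finset.filter_congr fun s hs => ?_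
    rw [Finset.mem_Ico] at hs
    rcases c.label_discPt c.record hs.1 hs.2 with ⟨l, hl0, hl1, hl2, hl3⟩ | ⟨hl2, hl3⟩
    · rw [hl3]
      constructor
      · intro h
        rwa [← emod_inj hl0 hl1 hj0 hj1 (h.trans hij.symm)]
      · intro h
        rw [hl2.unique h, hij]
    · rw [hl3]
      constructor
      · intro h
        unfold specialLabel at h
        split_ifs at h <;> omega
      · intro h
        exact absurd h (hl2 j hj0)
  rw [hS]
  have hop : discHeight (outerHalf k n) (height k g) r j
      ≤ discHeight (outerHalf k n) (height k g) r (j + 1) ↔ 1 ≤ g i := by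
    rw [discHeight_of_le hj1.le, discHeight_of_le (by omega), ← add_assoc,
      le_height_succ_iff c.one_le, hgi]
  have hkp := c.kpos
  by_cases hg : 1 ≤ g i
  -- By the end of the disc the walk is back at the level of j: for d ≤ 0 already the record at the
  -- end of the outer circle is that low, and for d = k the 2k inner down-steps undo the total drift
  -- 2k.
  · have hM : discHeight (outerHalf k n) (height k g) r (discLen k n)
        ≤ discHeight (outerHalf k n) (height k g) r j := by
      rw [discHeight_of_ge (by rw [discLen]; omega), discHeight_of_le hj1.le, discLen]
      have h2 := c.height_add_two r
      rcases c.drift with hd | hd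
      · have := (c.record_add_two c.record).2 hd (r + j) (by omega)
        omega
      · have := c.record.1 (by omega) (r + j) (by omega)
        omega
    have := card_isOpener (discHeight_step r) hj0 (by rw [discLen]; omega : j < discLen k n)
      (hop.2 hg) hM
    rw [discHeight_of_le hj1.le, discHeight_of_le (by omega), ← add_assoc, height_succ, hgi] at this
    zify
    linarith
  · have hg0 : g i = 0 := by omega
    rw [hg0, mul_zero, Finset.card_eq_zero, Finset.filter_eq_empty_iff]
    intro s _ h
    exact hg (hop.1 h.le_succ)

theorem label_lt (c : IsCode k n g r e) {x : ℤ} (hx : x ∈ points k n) :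
    label k n g r e x < 2 * outerHalf k n := by
  have hN := c.pos
  obtain ⟨s, hs0, hs1, rfl⟩ := exists_discPt c.one_le hN r
    (e - height k g (r + 2 * outerHalf k n)) hx
  rcases c.label_discPt c.record hs0 hs1 with ⟨l, hl0, hl1, hl2, hl3⟩ | ⟨hl2, hl3⟩
  · rw [hl3]; exact Int.emod_lt_of_pos _ (by omega)
  · rw [hl3]; unfold specialLabel; split_ifs <;> omega

theorem height_two_period (c : IsCode k n g r e) :
    ∑ i ∈ Finset.Ico 0 (2 * outerHalf k n), ((k : ℤ) * g i)
      = 2 * height k g (outerHalf k n) + 2 * outerHalf k n := by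
  have hN := c.pos
  have h1 := walk_sub_walk (fun p => (k : ℤ) * g p - 1) (u := 0) (v := 2 * outerHalf k n) (by omega)
  rw [walk_zero, Finset.sum_sub_distrib] at h1
  have h2 := c.height_add_two 0
  rw [zero_add, height, walk_zero] at h2
  rw [h2] at h1
  simp only [Finset.sum_const, Int.card_Ico, nsmul_eq_mul, mul_one, sub_zero, zero_add] at h1
  rw [Int.toNat_of_nonneg (by omega)] at h1
  rw [height]
  linarith

-- These are the points left over: of the 2N + 2k points, the openers of a full turn account for the
-- sum of all k * `g i`, which is 2N + 2d.
open Classical in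
theorem card_label_neg (c : IsCode k n g r e) :
    (((points k n).filter (fun x => label k n g r e x < 0)).card : ℤ)
      = 2 * k - 2 * height k g (outerHalf k n) := by
  have hN := c.pos
  have h1 := Finset.card_filter_add_card_filter_not (s := points k n)
    (fun x => label k n g r e x < 0)
  have h2 : ((points k n).filter (fun x => ¬ label k n g r e x < 0)).card
      = ∑ i ∈ Finset.Ico 0 (2 * outerHalf k n), k * g i := by
    rw [Finset.card_eq_sum_card_fiberwise (f := label k n g r e)
      (t := Finset.Ico 0 (2 * outerHalf k n))]
    · refine Finset.sum_congr rfl fun i hi => ?_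
      rw [Finset.mem_Ico] at hi
      rw [← c.card_label hi.1 hi.2, Finset.filter_filter]
      congr 1
      refine Finset.filter_congr fun x _ => ⟨fun h => h.2, fun h => ⟨by omega, h⟩⟩
    · intro x hx
      rw [Finset.mem_coe, Finset.mem_filter] at hx
      rw [Finset.mem_coe, Finset.mem_Ico]
      exact ⟨by omega, c.label_lt hx.1⟩
  have h3 := card_points c.one_le hN
  have h4 := c.height_two_period
  rw [h2] at h1
  zify at h1
  rw [h4, h3, discLen] at h1
  omega

theorem drift_dvd (k n : ℕ) (g : ℤ → ℕ) : (k : ℤ) ∣ height k g (outerHalf k n) := by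
  have h := height_modEq (k := k) (g := g) (outerHalf k n)
  have h2 := dvd_outerHalf (k := k) (n := n)
  rw [Int.modEq_iff_dvd] at h
  exact dvd_of_dvd_of_eq ((h.add h2).neg_right) (by ring)

theorem label_opener (c : IsCode k n g r e) {i : ℤ} (hi : 1 ≤ g i) :
    label k n g r e (outerPt (outerHalf k n) i) = i % (2 * outerHalf k n) := by
  rw [c.label_outerPt]
  exact outerLabel_of_isOpener (isOpener_self ((le_height_succ_iff c.one_le i).2 hi))

/-- The possible labels. -/
theorem label_cases (c : IsCode k n g r e) {x : ℤ} (hx : x ∈ points k n) :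
    (0 ≤ label k n g r e x ∧ label k n g r e x < 2 * outerHalf k n ∧
      1 ≤ g (label k n g r e x)) ∨
    (height k g (outerHalf k n) < 0 ∧ label k n g r e x = -1) ∨
    (height k g (outerHalf k n) = 0 ∧ ¬ OnOuter k n x ∧
      (label k n g r e x = -1 ∨ label k n g r e x = -2)) := by
  classical
  have hN := c.pos
  by_cases h0 : 0 ≤ label k n g r e x
  · refine Or.inl ⟨h0, c.label_lt hx, ?_⟩
    have h1 := c.card_label h0 (c.label_lt hx)
    have h2 : 0 < ((points k n).filter
        (fun y => label k n g r e y = label k n g r e x)).card :=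
      Finset.card_pos.2 ⟨x, Finset.mem_filter.2 ⟨hx, rfl⟩⟩
    rw [h1] at h2
    exact Nat.pos_of_mul_pos_left h2
  · have h2 : 0 < ((points k n).filter (fun y => label k n g r e y < 0)).card :=
      Finset.card_pos.2 ⟨x, Finset.mem_filter.2 ⟨hx, by omega⟩⟩
    have h1 := c.card_label_neg
    have hkp := c.kpos
    have hd : height k g (outerHalf k n) ≤ 0 := by
      rcases c.drift with hd | hd <;> omega
    right
    obtain ⟨s, hs0, hs1, rfl⟩ := exists_discPt c.one_le hN r
      (e - height k g (r + 2 * outerHalf k n)) hx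
    rcases c.label_discPt c.record hs0 hs1 with ⟨l, hl0, hl1, hl2, hl3⟩ | ⟨hl2, hl3⟩
    · rw [hl3] at h0
      exact absurd (Int.emod_nonneg _ (by omega)) h0
    · rcases hd.lt_or_eq with hd | hd
      · left
        refine ⟨hd, ?_⟩
        rw [hl3, specialLabel, if_neg (by omega)]
      · right
        refine ⟨hd, ?_, ?_⟩
        · intro ho
          rw [(cutPos_nonneg_lt c.one_le hN r (e - height k g (r + 2 * outerHalf k n)) _).2.2,
            cutPos_discPt c.one_le hN _ _ hs0 hs1] at ho
          obtain ⟨j, hj⟩ := exists_isOpener_of_nonneg hN c.per hd.ge (r + s)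
          have := c.record.le_of_isOpener hN c.per (by omega) hj
          refine hl2 (j - r) (by omega) ((isOpener_discHeight_iff ho).2 ?_)
          rwa [add_sub_cancel]
        · rw [hl3, specialLabel]
          split_ifs <;> simp

theorem label_neg_congr (c : IsCode k n g r e) (x : ℤ) (hx : x ∈ points k n) (y : ℤ)
    (hy : y ∈ points k n) (h : label k n g r e x = label k n g r e y) :
    label k n g r e (-x) = label k n g r e (-y) := by
  rw [c.label_neg hx, c.label_neg hy, h]

theorem negBlock_fiber_label (c : IsCode k n g r e) {x : ℤ} (hx : x ∈ points k n) :
    negBlock (fiber k n (label k n g r e) x) = fiber k n (label k n g r e) (-x) :=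
  negBlock_fiber c.label_neg_congr hx

theorem card_fiber_of_nonneg (c : IsCode k n g r e) {x : ℤ} (hx : x ∈ points k n)
    (h : 0 ≤ label k n g r e x) :
    (fiber k n (label k n g r e) x).card = k * g (label k n g r e x) := by
  classical
  rw [← c.card_label h (c.label_lt hx)]
  congr 1
  ext y
  rw [mem_fiber, Finset.mem_filter, eq_comm]

theorem card_fiber_of_drift_neg (c : IsCode k n g r e) {x : ℤ}
    (hd : height k g (outerHalf k n) < 0) (h : label k n g r e x = -1) :
    ((fiber k n (label k n g r e) x).card : ℤ) = 2 * k - 2 * height k g (outerHalf k n) := by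
  classical
  rw [← c.card_label_neg, Nat.cast_inj]
  congr 1
  ext y
  rw [mem_fiber, Finset.mem_filter, and_congr_right_iff, h]
  intro hy
  rcases c.label_cases hy with h1 | h1 | h1
  · omega
  · omega
  · omega

/-- The 2k points with the labels -1 and -2 form two blocks that are opposite to each other, hence
of equal size. -/
theorem card_fiber_of_drift_zero (c : IsCode k n g r e) {x : ℤ} (hx : x ∈ points k n)
    (hd : height k g (outerHalf k n) = 0) (h : label k n g r e x < 0) :
    (fiber k n (label k n g r e) x).card = k := by
  classical
  have h1 := c.card_label_neg
  have h2 : (points k n).filter (fun y => label k n g r e y < 0)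
      = fiber k n (label k n g r e) x ∪ fiber k n (label k n g r e) (-x) := by
    ext y
    rw [Finset.mem_filter, Finset.mem_union, mem_fiber, mem_fiber, c.label_neg hx, oppLabel,
      if_neg (by omega), if_pos hd, ← and_or_left, and_congr_right_iff]
    intro hy
    rcases c.label_cases hx with h3 | h3 | h3 <;> rcases c.label_cases hy with h4 | h4 | h4 <;>
      omega
  have h3 : Disjoint (fiber k n (label k n g r e) x) (fiber k n (label k n g r e) (-x)) := by
    rw [Finset.disjoint_left]
    intro y hy hy'
    rw [mem_fiber] at hy hy'
    have := hy.2.trans hy'.2.symm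
    rw [c.label_neg hx, oppLabel, if_neg (by omega), if_pos hd] at this
    omega
  rw [h2, Finset.card_union_of_disjoint h3, ← c.negBlock_fiber_label hx, card_negBlock, hd] at h1
  push_cast at h1
  omega

theorem dvd_card_fiber (c : IsCode k n g r e) (x : ℤ) (hx : x ∈ points k n) :
    k ∣ (fiber k n (label k n g r e) x).card := by
  rcases c.label_cases hx with h | h | h
  · rw [c.card_fiber_of_nonneg hx h.1]
    exact dvd_mul_right _ _
  · rw [← Int.natCast_dvd_natCast, c.card_fiber_of_drift_neg h.1 h.2]
    exact (dvd_mul_left _ _).sub ((drift_dvd k n g).mul_left 2)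
  · rw [c.card_fiber_of_drift_zero hx h.1 (by omega)]

theorem isAnnularDivisible (c : IsCode k n g r e) :
    IsAnnularDivisible k n (kerPart k n (label k n g r e)).parts :=
  isAnnularDivisible_of_label c.one_le c.pos (c.discCut_modEq r)
    (fun _ hV => mem_kerPart.1 hV) c.dvd_card_fiber (c.placeNC_label c.record)

theorem label_neg_ne (c : IsCode k n g r e) {x : ℤ} (hx : x ∈ points k n)
    (h : 0 ≤ label k n g r e x ∨ height k g (outerHalf k n) = 0) :
    label k n g r e (-x) ≠ label k n g r e x := by
  have hN := c.pos
  have hlt := c.label_lt hx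
  rw [c.label_neg hx, oppLabel]
  split_ifs with h1 h2
  · rw [add_emod_two_mul hN, Int.emod_eq_of_lt h1 hlt]
    split_ifs <;> omega
  · omega
  · omega

/-- Only the block without opener at negative drift is its own opposite: openers move by N under
negation, and at drift 0 the labels -1 and -2 are exchanged. It contains the inner circle because
the disc cut at r ends its outer part at a lowest height so far, and its size 2k - 2d leaves at
least two outer points. -/
theorem zero_block (c : IsCode k n g r e) (V : Finset ℤ)
    (hV : V ∈ (kerPart k n (label k n g r e)).parts) (hneg : negBlock V = V) :
    (∀ x ∈ points k n, ¬ OnOuter k n x → x ∈ V) ∧ 2 ≤ (V.filter (OnOuter k n)).card := by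
  classical
  obtain ⟨x, hx, rfl⟩ := mem_kerPart.1 hV
  rw [c.negBlock_fiber_label hx, fiber_eq_iff hx] at hneg
  rcases c.label_cases hx with h | h | h
  · exact absurd hneg (c.label_neg_ne hx (Or.inl h.1))
  · have hcard := c.card_fiber_of_drift_neg h.1 h.2
    have hsub : (fiber k n (label k n g r e) x).filter (fun y => ¬ OnOuter k n y)
        ⊆ (points k n).filter (fun y => ¬ OnOuter k n y) := by
      intro y hy
      rw [Finset.mem_filter, mem_fiber] at hy
      exact Finset.mem_filter.2 ⟨hy.1.1, hy.2⟩
    have h1 := Finset.card_le_card hsub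
    rw [card_inner c.one_le c.pos] at h1
    have h2 := Finset.card_filter_add_card_filter_not (s := fiber k n (label k n g r e) x)
      (OnOuter k n)
    refine ⟨fun y hy hyi => ?_, by omega⟩
    rw [mem_fiber]
    refine ⟨hy, ?_⟩
    obtain ⟨s, hs0, hs1, rfl⟩ := exists_discPt c.one_le c.pos r
      (e - height k g (r + 2 * outerHalf k n)) hy
    have hso : 2 * outerHalf k n ≤ s := by
      rw [(cutPos_nonneg_lt c.one_le c.pos r (e - height k g (r + 2 * outerHalf k n)) _).2.2,
        cutPos_discPt c.one_le c.pos _ _ hs0 hs1] at hyi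
      omega
    rcases c.label_discPt c.record hs0 hs1 with ⟨l, hl0, hl1, hl2, hl3⟩ | ⟨hl2, hl3⟩
    · exfalso
      have h3 := (c.record_add_two c.record).2 h.1.le (r + l) (by omega)
      have h4 := hl2.2.1
      rw [discHeight_of_le hl1.le, discHeight_of_ge (by omega)] at h4
      omega
    · rw [hl3, h.2, specialLabel, if_neg (by omega)]
  · exact absurd hneg (c.label_neg_ne hx (Or.inr h.1))

end IsCode

end TypeD

/-! ### Joining an inner and a visible block; codes give partitions of type D -/

namespace TypeD

namespace IsCode

variable {k n : ℕ} {g : ℤ → ℕ} {r e : ℤ}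

theorem add_half (c : IsCode k n g r e) : IsCode k n g r (e + k) :=
  { c with dvd := c.dvd.add (dvd_refl _) }

theorem not_isOpener_inner (c : IsCode k n g r e) (hd : height k g (outerHalf k n) ≤ 0) (q : ℤ) :
    innerLabel (outerHalf k n) k (height k g) r e q = if height k g (outerHalf k n) = 0 then
      -1 - ((q + height k g r - e) / k) % 2 else -1 :=
  innerLabel_of_not fun _ => not_isLastBelow c.pos c.per hd _ _

theorem label_add_half (c : IsCode k n g r e) (hd : height k g (outerHalf k n) = 0) {x : ℤ}
    (hx : x ∈ points k n) : label k n g r (e + k) x =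
      if label k n g r e x < 0 then -3 - label k n g r e x else label k n g r e x := by
  have c' := c.add_half
  by_cases h : OnOuter k n x
  · rw [← outerPt_outerPos hx h, c.label_outerPt, c'.label_outerPt]
    obtain ⟨j, hj⟩ := exists_isOpener_of_nonneg c.pos c.per hd.ge (outerPos k n x)
    rw [outerLabel_of_isOpener hj, if_neg]
    exact not_lt.2 (Int.emod_nonneg _ (by have := c.pos; omega))
  · rw [← innerPt_innerPos c.pos hx h, c.label_innerPt, c'.label_innerPt,
      c.not_isOpener_inner hd.le, c'.not_isOpener_inner hd.le, if_pos hd, if_pos hd]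
    have h1 := half_emod_two c.kpos (innerPos k n x + height k g r - (e + k))
    rw [show innerPos k n x + height k g r - (e + k) + k = innerPos k n x + height k g r - e by
      ring] at h1
    split_ifs <;> omega

/-- At drift 0, half a turn only exchanges the names of the two inner blocks. This is why such a
code gives one partition and not two. -/
theorem kerPart_add_half (c : IsCode k n g r e) (hd : height k g (outerHalf k n) = 0) :
    kerPart k n (label k n g r e) = kerPart k n (label k n g r (e + k)) := by
  refine eq_kerPart fun x hx y hy => ?_
  rw [kerPart_part hx, kerPart_part hy, fiber_eq_iff hy, c.label_add_half hd hx,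
    c.label_add_half hd hy]
  have h1 := c.label_cases hx
  have h2 := c.label_cases hy
  split_ifs <;> omega

/-- If the walk were somewhere lower than at i, an arc would pass over i and separate it from its
opposite, hiding the block from the inner circle. -/
theorem record_of_visible (c : IsCode k n g r e) (hd : height k g (outerHalf k n) = 0) {i : ℤ}
    (hg : 1 ≤ g i) (hvis : IsVisible k n (kerPart k n (label k n g r e)).parts
      (fiber k n (label k n g r e) (outerPt (outerHalf k n) i))) :
    IsRecord (height k g) (height k g (outerHalf k n)) i := by
  have hN := c.pos
  suffices hmin : ∀ j, height k g i ≤ height k g j from ⟨fun _ j _ => hmin j, fun _ j _ => hmin j⟩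
  intro j
  by_contra hlt
  rw [not_le] at hlt
  -- At drift 0 the lower place j can be moved by whole periods to the right of i without a change
  -- of height.
  have hw := walk_add_mul c.per j (|i - j| + 1)
  rw [hd, zero_mul, add_zero] at hw
  have hj : i < j + outerHalf k n * (|i - j| + 1) := by
    have h1 := le_abs_self (i - j)
    have h2 := abs_nonneg (i - j)
    nlinarith
  have hi := (le_height_succ_iff (g := g) c.one_le i).2 hg
  obtain ⟨s, hs1, hs2, hs3, hs4⟩ := exists_first_passage (H := height k g) height_step hj
    (l := height k g i - 1) (by omega) (by omega)
  have hsi : s ≠ i := by rintro rfl; omega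
  obtain ⟨f, hf⟩ := exists_isOpener_of_nonneg hN c.per hd.ge s
  -- The step s is the first after i to go below H i, so its opener f cannot be at i or between i
  -- and s. Since the arc is shorter than N, f, i, s and the opposite i + N follow each other on the
  -- circle.
  have hfi : f < i := by
    by_contra hcon
    rcases (not_lt.1 hcon).eq_or_lt with rfl | h
    · have := hf.2.1; omega
    · have := hs4 f h hf.1
      have := hf.2.1
      omega
  have hsf := hf.lt_add hN c.per
  have hlf := c.label_outerPt f
  rw [outerLabel_of_isOpener (isOpener_self hf.le_succ)] at hlf
  have hls := c.label_outerPt s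
  rw [outerLabel_of_isOpener hf] at hls
  have hli := c.label_opener hg
  have hfp := outerPt_mem hN f
  have hip := outerPt_mem hN i
  refine hvis.2.2 ⟨_, fiber_mem_kerPart hfp, ?_, ?_, ?_, _, mem_fiber.2 ⟨hfp, rfl⟩, _,
    mem_fiber.2 ⟨outerPt_mem hN s, hlf.trans hls.symm⟩, _, mem_fiber.2 ⟨hip, rfl⟩, ?_⟩
  · intro y hy
    by_contra hyo
    rw [mem_fiber] at hy
    rw [← innerPt_innerPos hN hy.1 hyo, c.label_innerPt, c.not_isOpener_inner hd.le, if_pos hd,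
      hlf] at hy
    have := Int.emod_nonneg f (by omega : 2 * outerHalf k n ≠ 0)
    omega
  · rw [Ne, fiber_eq_iff hip, hlf, hli]
    intro h
    have := emod_inj (a := f) (i := 0) (j := i - f) (m := 2 * outerHalf k n) le_rfl (by omega)
      (by omega) (by omega) (by simpa using h)
    omega
  · rw [c.negBlock_fiber_label hip, Ne, fiber_eq_iff (neg_mem_points hip), c.label_neg hip, hlf,
      hli, oppLabel_emod hN]
    intro h
    have := emod_inj (a := f) (i := 0) (j := i + outerHalf k n - f) (m := 2 * outerHalf k n) le_rfl
      (by omega) (by omega) (by omega) (by simpa using h)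
    omega
  · rw [← outerPt_add_period hN]
    exact outerCyclic_of_lt hN hfi (by omega) (by omega) (by omega)

/-- The labels after the inner blocks have been joined to the blocks opened by `i` and its
opposite. -/
noncomputable def joinLabel (k n : ℕ) (g : ℤ → ℕ) (r e i x : ℤ) : ℤ :=
  if label k n g r e x = -2 then i % (2 * outerHalf k n)
  else if label k n g r e x = -1 then (i + outerHalf k n) % (2 * outerHalf k n)
  else label k n g r e x

theorem label_discPt_of_drift_zero (c : IsCode k n g r e)
    (hd : height k g (outerHalf k n) = 0) {a : ℤ}
    (ha : IsRecord (height k g) (height k g (outerHalf k n)) a) {s : ℤ} (hs0 : 0 ≤ s)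
    (hs : s < discLen k n) :
    (s < 2 * outerHalf k n ∧ ∃ j, 0 ≤ j ∧ j < 2 * outerHalf k n ∧
      IsOpener (height k g) (a + j) (a + s) ∧
      label k n g r e (discPt k n a (e - height k g (a + 2 * outerHalf k n)) s)
        = (a + j) % (2 * outerHalf k n)) ∨
    (2 * outerHalf k n ≤ s ∧
      label k n g r e (discPt k n a (e - height k g (a + 2 * outerHalf k n)) s)
        = if 2 * outerHalf k n + k ≤ s then -2 else -1) := by
  have hN := c.pos
  rcases c.label_discPt ha hs0 hs with ⟨j, hj0, hj1, hj2, hj3⟩ | ⟨hj2, hj3⟩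
  · left
    have hs : s < 2 * outerHalf k n := by
      by_contra hcon
      have h3 := (c.record_add_two ha).2 hd.le (a + j) (by omega)
      have h4 := hj2.2.1
      rw [discHeight_of_le hj1.le, discHeight_of_ge (by omega)] at h4
      omega
    exact ⟨hs, j, hj0, hj1, (isOpener_discHeight_iff hs).1 hj2, hj3⟩
  · right
    refine ⟨?_, ?_⟩
    · by_contra hcon
      obtain ⟨j, hj⟩ := exists_isOpener_of_nonneg hN c.per hd.ge (a + s)
      have := ha.le_of_isOpener hN c.per (by omega) hj
      refine hj2 (j - a) (by omega) ((isOpener_discHeight_iff (by omega)).2 ?_)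
      rwa [add_sub_cancel]
    · rw [hj3, specialLabel]
      simp [hd]

/-- In the disc cut at the global minimum i, the block of i lies in the first half of the outer
circle and that of i + N in the second. The first inner half joins the latter and the second inner
half the former, so the two joined blocks are nested; no other arc covers i or i + N. -/
theorem placeNC_joinLabel (c : IsCode k n g r e) (hd : height k g (outerHalf k n) = 0) {i : ℤ}
    (hi : IsRecord (height k g) (height k g (outerHalf k n)) i) :
    PlaceNC (fun s => joinLabel k n g r e i
      (discPt k n i (e - height k g (i + 2 * outerHalf k n)) s)) (discLen k n) := by
  have hN := c.pos
  have key : ∀ s, 0 ≤ s → s < discLen k n → ∃ j, 0 ≤ j ∧ j < 2 * outerHalf k n ∧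
      joinLabel k n g r e i (discPt k n i (e - height k g (i + 2 * outerHalf k n)) s)
        = (i + j) % (2 * outerHalf k n) ∧
      (s < 2 * outerHalf k n ∧ IsOpener (height k g) (i + j) (i + s) ∨
        2 * outerHalf k n ≤ s ∧ s < 2 * outerHalf k n + k ∧ j = outerHalf k n ∨
        2 * outerHalf k n + k ≤ s ∧ j = 0) := by
    intro s hs0 hs
    rcases c.label_discPt_of_drift_zero hd hi hs0 hs with ⟨hs1, j, hj0, hj1, hj2, hj3⟩ | ⟨hs1, h2⟩
    · have := Int.emod_nonneg (i + j) (by omega : 2 * outerHalf k n ≠ 0)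
      refine ⟨j, hj0, hj1, ?_, Or.inl ⟨hs1, hj2⟩⟩
      rw [joinLabel, hj3, if_neg (by omega), if_neg (by omega)]
    · by_cases h3 : 2 * outerHalf k n + k ≤ s
      · rw [if_pos h3] at h2
        refine ⟨0, le_rfl, by omega, ?_, Or.inr (Or.inr ⟨h3, rfl⟩)⟩
        rw [joinLabel, h2, if_pos rfl, add_zero]
      · rw [if_neg h3] at h2
        refine ⟨outerHalf k n, hN.le, by omega, ?_, Or.inr (Or.inl ⟨hs1, by omega, rfl⟩)⟩
        rw [joinLabel, h2, if_neg (by omega), if_pos rfl]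
  have hmin : ∀ j, height k g i ≤ height k g j := by
    intro j
    rcases le_total i j with h | h
    · exact hi.1 hd.ge j h
    · exact hi.2 hd.le j h
  have hminN : height k g (i + outerHalf k n) = height k g i := by rw [c.per, hd, add_zero]
  intro x y z w hx hxy hyz hzw hw h1 h2
  obtain ⟨jx, hx0, hx1, hxl, hxc⟩ := key x hx (by omega)
  obtain ⟨jy, hy0, hy1, hyl, hyc⟩ := key y (by omega) (by omega)
  obtain ⟨jz, hz0, hz1, hzl, hzc⟩ := key z (by omega) (by omega)
  obtain ⟨jw, hw0, hw1, hwl, hwc⟩ := key w (by omega) hw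
  have hxz := emod_inj hx0 hx1 hz0 hz1 (hxl.symm.trans (h1.trans hzl))
  have hyw := emod_inj hy0 hy1 hw0 hw1 (hyl.symm.trans (h2.trans hwl))
  subst hxz hyw
  suffices h : jx = jy by subst h; exact hxl.trans hyl.symm
  rcases lt_or_ge w (2 * outerHalf k n) with hwo | hwo
  · replace hxc : IsOpener (height k g) (i + jx) (i + x) := by
      rcases hxc with h | h | h
      · exact h.2
      · omega
      · omega
    replace hyc : IsOpener (height k g) (i + jy) (i + y) := by
      rcases hyc with h | h | h
      · exact h.2
      · omega
      · omega
    replace hzc : IsOpener (height k g) (i + jx) (i + z) := by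
      rcases hzc with h | h | h
      · exact h.2
      · omega
      · omega
    replace hwc : IsOpener (height k g) (i + jy) (i + w) := by
      rcases hwc with h | h | h
      · exact h.2
      · omega
      · omega
    have := hxc.eq_of_crossing hzc hyc hwc (by omega) (by omega) (by omega)
    omega
  · rcases lt_or_ge z (2 * outerHalf k n) with hzo | hzo
    · replace hxc : IsOpener (height k g) (i + jx) (i + x) := by
        rcases hxc with h | h | h
        · exact h.2
        · omega
        · omega
      replace hyc : IsOpener (height k g) (i + jy) (i + y) := by
        rcases hyc with h | h | h
        · exact h.2
        · omega
        · omega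
      replace hzc : IsOpener (height k g) (i + jx) (i + z) := by
        rcases hzc with h | h | h
        · exact h.2
        · omega
        · omega
      -- Here w is inner, so jy is 0 or N and i + jy is a minimum of the walk. An arc cannot pass
      -- over a minimum, but the one from i + jx to i + z would have to.
      have hjy : height k g (i + jy) = height k g i := by
        rcases hwc with h | h | h
        · omega
        · rw [h.2.2, hminN]
        · rw [h.2, add_zero]
      have hxx := hxc.1
      obtain ⟨l, hl, hl'⟩ := hzc.nested (y := i + y) (by omega) (by omega)
      have := hl'.unique hyc
      by_contra hne
      have hyy := hyc.1
      have h3 := hzc.2.2 (i + jy) (by omega) (by omega)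
      have h4 := hzc.2.1
      have h5 := hmin (i + jx)
      omega
    -- With z and w inner, a crossing would need z in the first inner half and w in the second. Then
    -- x belongs to the block of i + N and y to that of i, against x < y.
    · have hN1 : ∀ x, IsOpener (height k g) (i + outerHalf k n) (i + x) → outerHalf k n ≤ x := by
        intro x h
        have := h.1
        omega
      have hN2 : ∀ x, IsOpener (height k g) (i + 0) (i + x) → x < outerHalf k n := by
        intro x h
        have := h.lt_add hN c.per
        omega
      rcases hzc with h | ⟨h3, h4, h5⟩ | ⟨h3, h4⟩
      · omega
      · rcases hwc with h | ⟨h6, h7, h8⟩ | ⟨h6, h7⟩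
        · omega
        · omega
        · exfalso
          subst h5 h7
          have hy' : y < outerHalf k n := by
            rcases hyc with h | h | h
            · exact hN2 y h.2
            · omega
            · omega
          have hx' : outerHalf k n ≤ x := by
            rcases hxc with h | h | h
            · exact hN1 x h.2
            · omega
            · omega
          omega
      · rcases hwc with h | ⟨h6, h7, h8⟩ | ⟨h6, h7⟩ <;> omega

/-- The joined partition is that of `joinLabel`, and sizes divisible by k stay so under union. -/
theorem isAnnularDivisible_join (c : IsCode k n g r e) (hd : height k g (outerHalf k n) = 0)
    {i u : ℤ} (hg : 1 ≤ g i) (hi : IsRecord (height k g) (height k g (outerHalf k n)) i)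
    (hu : u ∈ points k n) (hul : label k n g r e u = -2) :
    IsAnnularDivisible k n (join (kerPart k n (label k n g r e)).parts
      (fiber k n (label k n g r e) u)
      (fiber k n (label k n g r e) (outerPt (outerHalf k n) i))) := by
  have hN := c.pos
  set v := outerPt (outerHalf k n) i with hv
  have hvp : v ∈ points k n := outerPt_mem hN i
  have hvl : label k n g r e v = i % (2 * outerHalf k n) := c.label_opener hg
  have hv0 : 0 ≤ label k n g r e v := by
    rw [hvl]; exact Int.emod_nonneg _ (by omega)
  have hvn : label k n g r e (-v) = (i + outerHalf k n) % (2 * outerHalf k n) := by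
    rw [c.label_neg hvp, hvl, oppLabel_emod hN]
  have hvn0 : 0 ≤ label k n g r e (-v) := by
    rw [hvn]; exact Int.emod_nonneg _ (by omega)
  have hun : label k n g r e (-u) = -1 := by
    rw [c.label_neg hu, hul, oppLabel, if_neg (by omega), if_pos hd]; rfl
  have hne := c.label_neg_ne hvp (Or.inl hv0)
  have hunp := neg_mem_points hu
  have hvnp := neg_mem_points hvp
  have hjv : joinLabel k n g r e i v = label k n g r e v := by
    rw [joinLabel, if_neg (by omega), if_neg (by omega)]
  have hjvn : joinLabel k n g r e i (-v) = label k n g r e (-v) := by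
    rw [joinLabel, if_neg (by omega), if_neg (by omega)]
  have hF1 : fiber k n (joinLabel k n g r e i) v
      = fiber k n (label k n g r e) u ∪ fiber k n (label k n g r e) v := by
    ext y
    rw [Finset.mem_union, mem_fiber, mem_fiber, mem_fiber, ← and_or_left, and_congr_right_iff]
    intro hy
    rw [hjv, hul, hvl, joinLabel]
    rw [hvl] at hv0 hne
    rw [hvn] at hvn0 hne
    split_ifs <;> omega
  have hF2 : fiber k n (joinLabel k n g r e i) (-v)
      = fiber k n (label k n g r e) (-u) ∪ fiber k n (label k n g r e) (-v) := by
    ext y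
    rw [Finset.mem_union, mem_fiber, mem_fiber, mem_fiber, ← and_or_left, and_congr_right_iff]
    intro hy
    rw [hjvn, hun, hvn, joinLabel]
    rw [hvl] at hv0 hne
    rw [hvn] at hvn0 hne
    split_ifs <;> omega
  have hF3 : ∀ y ∈ points k n, label k n g r e y ≠ -1 → label k n g r e y ≠ -2 →
      label k n g r e y ≠ label k n g r e v → label k n g r e y ≠ label k n g r e (-v) →
      fiber k n (joinLabel k n g r e i) y = fiber k n (label k n g r e) y := by
    intro y hy h1 h2 h3 h4
    ext z
    rw [mem_fiber, mem_fiber, and_congr_right_iff]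
    intro hz
    rw [joinLabel, if_neg h2, if_neg h1, joinLabel]
    rw [hvl] at h3
    rw [hvn] at h4
    split_ifs <;> omega
  have hdisj : Disjoint (fiber k n (label k n g r e) u) (fiber k n (label k n g r e) v) := by
    rw [Finset.disjoint_left]
    intro y hy hy'
    rw [mem_fiber] at hy hy'
    have := hy.2.trans hy'.2.symm
    omega
  have hd1 : k ∣ (fiber k n (joinLabel k n g r e i) v).card := by
    rw [hF1, Finset.card_union_of_disjoint hdisj]
    exact (c.dvd_card_fiber u hu).add (c.dvd_card_fiber v hvp)
  have hneg : negBlock (fiber k n (label k n g r e) u ∪ fiber k n (label k n g r e) v)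
      = fiber k n (joinLabel k n g r e i) (-v) := by
    rw [negBlock_union, c.negBlock_fiber_label hu, c.negBlock_fiber_label hvp, hF2]
  refine isAnnularDivisible_of_label c.one_le hN (c.discCut_modEq i) (β := joinLabel k n g r e i)
    ?_ ?_ (c.placeNC_joinLabel hd hi)
  · intro W hW
    rw [join, hneg, ← hF1, c.negBlock_fiber_label hu, c.negBlock_fiber_label hvp] at hW
    simp only [Finset.mem_union, Finset.mem_sdiff, Finset.mem_insert, Finset.mem_singleton,
      not_or] at hW
    rcases hW with ⟨hW, h1, h2, h3, h4⟩ | rfl | rfl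
    · obtain ⟨y, hy, rfl⟩ := mem_kerPart.1 hW
      rw [fiber_eq_iff hu] at h1
      rw [fiber_eq_iff hvp] at h2
      rw [fiber_eq_iff hunp] at h3
      rw [fiber_eq_iff hvnp] at h4
      exact ⟨y, hy, hF3 y hy (hun ▸ h3) (hul ▸ h1) h2 h4⟩
    · exact ⟨v, hvp, rfl⟩
    · exact ⟨-v, hvnp, rfl⟩
  · intro y hy
    by_cases h1 : label k n g r e y = -2 ∨ label k n g r e y = label k n g r e v
    · have : joinLabel k n g r e i y = joinLabel k n g r e i v := by
        rw [hjv, joinLabel]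
        split_ifs <;> omega
      rwa [fiber_congr this]
    · by_cases h2 : label k n g r e y = -1 ∨ label k n g r e y = label k n g r e (-v)
      · have : joinLabel k n g r e i y = joinLabel k n g r e i (-v) := by
          rw [hjvn, joinLabel]
          split_ifs <;> omega
        rw [fiber_congr this, ← hneg, card_negBlock, ← hF1]
        exact hd1
      · push Not at h1 h2
        rw [hF3 y hy h2.1 h1.1 h1.2 h2.2]
        exact c.dvd_card_fiber y hy

/-- The partition of a code is a non-crossing partition of type `D`. -/
theorem isNCD (c : IsCode k n g r e) : IsNCD k n (kerPart k n (label k n g r e)) := by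
  have hN := c.pos
  refine ⟨?_, c.isAnnularDivisible, c.zero_block, ?_⟩
  · intro V hV
    obtain ⟨x, hx, rfl⟩ := mem_kerPart.1 hV
    rw [c.negBlock_fiber_label hx]
    exact fiber_mem_kerPart (neg_mem_points hx)
  · intro hsep U hU hUi V hV
    obtain ⟨u, hu, rfl⟩ := mem_kerPart.1 hU
    have huo := hUi u (mem_fiber.2 ⟨hu, rfl⟩)
    have hul : height k g (outerHalf k n) = 0 ∧
        (label k n g r e u = -1 ∨ label k n g r e u = -2) := by
      rcases c.label_cases hu with h | h | h
      · have h1 := c.label_opener h.2.2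
        rw [Int.emod_eq_of_lt h.1 h.2.1] at h1
        exact absurd (onOuter_outerPt hN _)
          (hUi _ (mem_fiber.2 ⟨outerPt_mem hN (label k n g r e u), h1.symm⟩))
      · have h1 := c.card_fiber_of_drift_neg h.1 h.2
        have h2 := Finset.card_le_card (s := fiber k n (label k n g r e) u)
          (t := (points k n).filter (fun x => ¬ OnOuter k n x)) (by
            intro y hy
            exact Finset.mem_filter.2 ⟨(mem_fiber.1 hy).1, hUi y hy⟩)
        rw [card_inner c.one_le hN] at h2
        omega
      · exact ⟨h.1, h.2.2⟩
    obtain ⟨hd, hul⟩ := hul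
    have hVmem := hV.1
    obtain ⟨v, hv, rfl⟩ := mem_kerPart.1 hVmem
    have hvo := hV.2.1 v (mem_fiber.2 ⟨hv, rfl⟩)
    have hvl : 0 ≤ label k n g r e v ∧ label k n g r e v < 2 * outerHalf k n ∧
        1 ≤ g (label k n g r e v) := by
      rcases c.label_cases hv with h | h | h
      · exact h
      · omega
      · exact absurd hvo h.2.1
    have h1 := c.label_opener hvl.2.2
    rw [Int.emod_eq_of_lt hvl.1 hvl.2.1] at h1
    have h2 : fiber k n (label k n g r e) v
        = fiber k n (label k n g r e) (outerPt (outerHalf k n) (label k n g r e v)) :=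
      fiber_congr h1.symm
    rw [h2] at hV ⊢
    have hrec := c.record_of_visible hd hvl.2.2 hV
    rcases hul with hul | hul
    -- An inner block with label -1 gets the label -2 when e is replaced by e + k, and the partition
    -- is the same.
    · have hl := c.label_add_half hd hu
      rw [hul, if_pos (by omega)] at hl
      have := c.add_half.isAnnularDivisible_join hd hvl.2.2 hrec hu hl
      have hfib : ∀ x ∈ points k n, fiber k n (label k n g r (e + k)) x
          = fiber k n (label k n g r e) x := by
        intro x hx
        rw [← kerPart_part hx, ← kerPart_part hx, c.kerPart_add_half hd]
      rwa [hfib u hu, hfib _ (outerPt_mem hN _), ← c.kerPart_add_half hd] at this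
    · exact c.isAnnularDivisible_join hd hvl.2.2 hrec hu hul

end IsCode

end TypeD

/-! ### Pairs of blocks of a given size; recovering the code from the partition -/

namespace TypeD

namespace IsCode

variable {k n : ℕ} {g : ℤ → ℕ} {r e : ℤ}

/-- The pair of the block of `x` and its opposite. -/
noncomputable def pairOf (k n : ℕ) (g : ℤ → ℕ) (r e x : ℤ) : Finset (Finset ℤ) :=
  {fiber k n (label k n g r e) x, fiber k n (label k n g r e) (-x)}

theorem pairOf_eq_iff (c : IsCode k n g r e) {x y : ℤ} (hx : x ∈ points k n)
    (hy : y ∈ points k n) : pairOf k n g r e x = pairOf k n g r e y ↔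
      label k n g r e x = label k n g r e y ∨ label k n g r e x = label k n g r e (-y) := by
  constructor
  · intro h
    have : fiber k n (label k n g r e) x ∈ pairOf k n g r e y := by
      rw [← h]; exact Finset.mem_insert_self _ _
    rw [pairOf, Finset.mem_insert, Finset.mem_singleton, fiber_eq_iff hy,
      fiber_eq_iff (neg_mem_points hy)] at this
    exact this
  · rintro (h | h)
    · rw [pairOf, pairOf, fiber_congr h, fiber_congr (c.label_neg_congr x hx y hy h)]
    · have h2 := c.label_neg_congr x hx _ (neg_mem_points hy) h
      rw [neg_neg] at h2
      rw [pairOf, pairOf, fiber_congr h, fiber_congr h2, Finset.pair_comm]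

/-- The size of a pair of opposite blocks, doubled. -/
theorem card_pair (c : IsCode k n g r e) {x : ℤ} (hx : x ∈ points k n) :
    ((fiber k n (label k n g r e) x ∪ negBlock (fiber k n (label k n g r e) x)).card : ℤ) =
      if 0 ≤ label k n g r e x then (2 * (k * g (label k n g r e x)) : ℤ)
      else 2 * k - 2 * height k g (outerHalf k n) := by
  have hdisj : label k n g r e (-x) ≠ label k n g r e x →
      Disjoint (fiber k n (label k n g r e) x) (negBlock (fiber k n (label k n g r e) x)) := by
    intro h
    rw [c.negBlock_fiber_label hx, Finset.disjoint_left]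
    intro y hy hy'
    rw [mem_fiber] at hy hy'
    exact h (hy'.2.trans hy.2.symm)
  rcases c.label_cases hx with h | h | h
  · rw [if_pos h.1, Finset.card_union_of_disjoint (hdisj (c.label_neg_ne hx (Or.inl h.1))),
      card_negBlock, c.card_fiber_of_nonneg hx h.1]
    push_cast
    ring
  · have : label k n g r e (-x) = label k n g r e x := by
      rw [c.label_neg hx, oppLabel, if_neg (by omega), if_neg (by omega)]
    rw [c.negBlock_fiber_label hx, fiber_congr this, Finset.union_self, if_neg (by omega),
      c.card_fiber_of_drift_neg h.1 h.2]
  · rw [Finset.card_union_of_disjoint (hdisj (c.label_neg_ne hx (Or.inr h.1))), card_negBlock,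
      c.card_fiber_of_drift_zero hx h.1 (by omega), if_neg (by omega), h.1]
    push_cast
    ring

theorem exists_label_neg (c : IsCode k n g r e) (hd : height k g (outerHalf k n) ≤ 0) :
    ∃ x ∈ points k n, label k n g r e x < 0 := by
  classical
  have h1 := c.card_label_neg
  have hkp := c.kpos
  have h2 : 0 < ((points k n).filter (fun x => label k n g r e x < 0)).card := by omega
  obtain ⟨x, hx⟩ := Finset.card_pos.1 h2
  exact ⟨x, Finset.mem_filter.1 hx⟩

/-- Opposite blocks have openers N apart, so a pair of blocks with openers has a representative
opener in [0, N). The second set collects the pair without opener, of size k - d. -/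
theorem pairsOfSize_eq (c : IsCode k n g r e) {t : ℕ} (ht : 1 ≤ t) :
    pairsOfSize (kerPart k n (label k n g r e)).parts (t * k) =
      ((Finset.Ico 0 (outerHalf k n)).filter (fun i => g i = t)).image
        (fun i => pairOf k n g r e (outerPt (outerHalf k n) i)) ∪
      ((points k n).filter (fun x => label k n g r e x < 0 ∧
        (k : ℤ) - height k g (outerHalf k n) = t * k)).image (pairOf k n g r e) := by
  have hN := c.pos
  have hkp := c.kpos
  ext Q
  simp only [pairsOfSize, Finset.mem_image, Finset.mem_union, Finset.mem_filter, mem_kerPart,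
    Finset.mem_Ico]
  constructor
  · rintro ⟨V, ⟨⟨x, hx, rfl⟩, hcard⟩, rfl⟩
    have h1 := c.card_pair hx
    rw [hcard] at h1
    have hpair : ({fiber k n (label k n g r e) x, negBlock (fiber k n (label k n g r e) x)} :
        Finset (Finset ℤ)) = pairOf k n g r e x := by
      rw [c.negBlock_fiber_label hx, pairOf]
    rw [hpair]
    push_cast at h1
    split_ifs at h1 with h0
    · left
      have hlt := c.label_lt hx
      have hg : g (label k n g r e x) = t := by
        have : (k : ℤ) * g (label k n g r e x) = k * t := by linarith
        exact_mod_cast mul_left_cancel₀ hkp.ne' this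
      rcases lt_or_ge (label k n g r e x) (outerHalf k n) with h | h
      · refine ⟨label k n g r e x, ⟨⟨h0, h⟩, hg⟩, ?_⟩
        rw [c.pairOf_eq_iff (outerPt_mem hN _) hx, c.label_opener (by omega),
          Int.emod_eq_of_lt h0 hlt]
        exact Or.inl rfl
      · have hg' : g (label k n g r e x - outerHalf k n) = t := by
          rw [← c.periodic, sub_add_cancel, hg]
        refine ⟨label k n g r e x - outerHalf k n, ⟨⟨by omega, by omega⟩, hg'⟩, ?_⟩
        rw [c.pairOf_eq_iff (outerPt_mem hN _) hx, c.label_opener (by omega), c.label_neg hx,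
          oppLabel, if_pos h0, add_emod_two_mul hN, Int.emod_eq_of_lt h0 hlt,
          Int.emod_eq_of_lt (by omega) (by omega), if_neg (by omega)]
        exact Or.inr rfl
    · right
      exact ⟨x, ⟨hx, by omega, by linarith⟩, rfl⟩
  · have key : ∀ x ∈ points k n, (if 0 ≤ label k n g r e x then (2 * (k * g (label k n g r e x)) : ℤ)
      else 2 * k - 2 * height k g (outerHalf k n)) = 2 * (t * k) →
      ∃ a, ((∃ x ∈ points k n, fiber k n (label k n g r e) x = a) ∧
        (a ∪ negBlock a).card = 2 * (t * k)) ∧ {a, negBlock a} = pairOf k n g r e x := by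
      intro x hx hcard
      refine ⟨_, ⟨⟨x, hx, rfl⟩, ?_⟩, ?_⟩
      · rw [← Nat.cast_inj (R := ℤ), c.card_pair hx, hcard]
        push_cast
        ring
      · rw [c.negBlock_fiber_label hx, pairOf]
    rintro (⟨i, ⟨hi, hg⟩, rfl⟩ | ⟨x, ⟨hx, h0, hd⟩, rfl⟩)
    · have hl := c.label_opener (i := i) (by omega)
      rw [Int.emod_eq_of_lt hi.1 (by omega)] at hl
      refine key _ (outerPt_mem hN i) ?_
      rw [hl, if_pos hi.1, hg]
      ring
    · refine key x hx ?_
      rw [if_neg (by omega)]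
      linarith

/-- The number of pairs of opposite blocks of a given size. -/
theorem card_pairsOfSize (c : IsCode k n g r e) {t : ℕ} (ht : 1 ≤ t) :
    (pairsOfSize (kerPart k n (label k n g r e)).parts (t * k)).card =
      ((Finset.Ico 0 (outerHalf k n)).filter (fun i => g i = t)).card +
        if (k : ℤ) - height k g (outerHalf k n) = t * k then 1 else 0 := by
  have hN := c.pos
  have hkp := c.kpos
  have hl : ∀ i, 0 ≤ i → i < outerHalf k n → g i = t →
      label k n g r e (outerPt (outerHalf k n) i) = i := by
    intro i h0 h1 hg
    rw [c.label_opener (by omega), Int.emod_eq_of_lt h0 (by omega)]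
  have hln : ∀ i, 0 ≤ i → i < outerHalf k n → g i = t →
      label k n g r e (-outerPt (outerHalf k n) i) = i + outerHalf k n := by
    intro i h0 h1 hg
    rw [c.label_neg (outerPt_mem hN i), hl i h0 h1 hg, oppLabel, if_pos h0,
      Int.emod_eq_of_lt (by omega) (by omega)]
  rw [c.pairsOfSize_eq ht, Finset.card_union_of_disjoint, Finset.card_image_of_injOn]
  · congr 1
    split_ifs with hd
    · have hd0 : height k g (outerHalf k n) ≤ 0 := by
        have : (1 : ℤ) * k ≤ t * k := by gcongr; exact_mod_cast ht
        linarith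
      obtain ⟨x, hx, hx0⟩ := c.exists_label_neg hd0
      rw [Finset.card_eq_one]
      refine ⟨pairOf k n g r e x, ?_⟩
      ext Q
      simp only [Finset.mem_image, Finset.mem_filter, Finset.mem_singleton]
      constructor
      -- All points without opener belong to the same pair: they share the label -1, or have the
      -- opposite labels -1 and -2.
      · rintro ⟨y, ⟨hy, hy0, -⟩, rfl⟩
        rw [c.pairOf_eq_iff hy hx, c.label_neg hx, oppLabel, if_neg (by omega)]
        have h1 := c.label_cases hx
        have h2 := c.label_cases hy
        split_ifs <;> omega
      · rintro rfl
        exact ⟨x, ⟨hx, hx0, hd⟩, rfl⟩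
    · simp [hd]
  · intro i hi j hj hij
    rw [Finset.mem_coe, Finset.mem_filter, Finset.mem_Ico] at hi hj
    simp only at hij
    rw [c.pairOf_eq_iff (outerPt_mem hN _) (outerPt_mem hN _), hl i hi.1.1 hi.1.2 hi.2,
      hl j hj.1.1 hj.1.2 hj.2, hln j hj.1.1 hj.1.2 hj.2] at hij
    omega
  · rw [Finset.disjoint_left]
    intro Q hQ hQ'
    rw [Finset.mem_image] at hQ hQ'
    obtain ⟨i, hi, rfl⟩ := hQ
    obtain ⟨x, hx, h⟩ := hQ'
    rw [Finset.mem_filter, Finset.mem_Ico] at hi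
    rw [Finset.mem_filter] at hx
    rw [c.pairOf_eq_iff hx.1 (outerPt_mem hN _), hl i hi.1.1 hi.1.2 hi.2,
      hln i hi.1.1 hi.1.2 hi.2] at h
    omega

/-- The openers are the points that have no point of their block in the preceding half circle. -/
theorem one_le_iff (c : IsCode k n g r e) (i : ℤ) : 1 ≤ g i ↔
    ∀ j, i - outerHalf k n ≤ j → j < i → label k n g r e (outerPt (outerHalf k n) j)
      ≠ label k n g r e (outerPt (outerHalf k n) i) := by
  have hN := c.pos
  constructor
  · intro hg j hj hji h
    rw [c.label_opener hg, c.label_outerPt] at h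
    by_cases hex : ∃ f, IsOpener (height k g) f j
    · obtain ⟨f, hf⟩ := hex
      rw [outerLabel_of_isOpener hf] at h
      have h1 := hf.lt_add hN c.per
      have h2 := hf.1
      have := emod_inj (a := f) (i := 0) (j := i - f) (m := 2 * outerHalf k n) le_rfl (by omega)
        (by omega) (by omega) (by simpa using h)
      omega
    · push Not at hex
      rw [outerLabel_of_not hex] at h
      have := Int.emod_nonneg i (by omega : 2 * outerHalf k n ≠ 0)
      omega
  · intro h
    by_contra hg
    by_cases hex : ∃ f, IsOpener (height k g) f i
    · obtain ⟨f, hf⟩ := hex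
      have hfi : f ≠ i := by
        rintro rfl
        exact hg ((le_height_succ_iff c.one_le f).1 hf.le_succ)
      have h1 := hf.lt_add hN c.per
      have h2 := hf.1
      refine h f (by omega) (by omega) ?_
      rw [c.label_outerPt, c.label_outerPt, outerLabel_of_isOpener hf,
        outerLabel_of_isOpener (isOpener_self hf.le_succ)]
    · push Not at hex
      have hl := c.label_outerPt i
      rw [outerLabel_of_not hex] at hl
      refine h (i - outerHalf k n) le_rfl (by omega) ?_
      rw [outerPt_sub_period hN, c.label_neg (outerPt_mem hN i), hl, oppLabel, if_neg (by omega)]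
      rcases c.label_cases (outerPt_mem hN i) with h3 | h3 | h3
      · omega
      · rw [if_neg (by omega)]
      · exact absurd (onOuter_outerPt hN i) h3.2.1

theorem label_eq_iff_of_kerPart_eq {g' : ℤ → ℕ} {r' e' : ℤ}
    (h : kerPart k n (label k n g r e) = kerPart k n (label k n g' r' e')) {x y : ℤ}
    (hx : x ∈ points k n) (hy : y ∈ points k n) :
    label k n g r e x = label k n g r e y ↔ label k n g' r' e' x = label k n g' r' e' y := by
  rw [← fiber_eq_iff (β := label k n g r e) hy, ← fiber_eq_iff (β := label k n g' r' e') hy,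
    ← kerPart_part hx, ← kerPart_part hy, h,
    kerPart_part hx, kerPart_part hy]

/-- The positions where `g` does not vanish are described in terms of blocks by `one_le_iff`, and
there `g` is the block size divided by k. -/
theorem eq_of_kerPart_eq (c : IsCode k n g r e) {g' : ℤ → ℕ} {r' e' : ℤ}
    (c' : IsCode k n g' r' e')
    (h : kerPart k n (label k n g r e) = kerPart k n (label k n g' r' e')) : g = g' := by
  have hN := c.pos
  ext i
  have hi := outerPt_mem hN i
  have h1 : 1 ≤ g i ↔ 1 ≤ g' i := by
    rw [c.one_le_iff, c'.one_le_iff]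
    simp only [Ne, label_eq_iff_of_kerPart_eq h (outerPt_mem hN _) hi]
  have hred : ∀ {g : ℤ → ℕ} {r e : ℤ}, IsCode k n g r e → g (i % (2 * outerHalf k n)) = g i := by
    intro g r e c
    obtain ⟨q, hq, -, -⟩ := exists_eq_emod_add_mul i (b := 2 * outerHalf k n) (by omega)
    conv_rhs => rw [hq]
    rw [show i % (2 * outerHalf k n) + 2 * outerHalf k n * q
      = i % (2 * outerHalf k n) + outerHalf k n * (2 * q) by ring, periodic_mul c.periodic]
  have hnn := Int.emod_nonneg i (by omega : 2 * outerHalf k n ≠ 0)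
  by_cases hg : 1 ≤ g i
  · have h2 : fiber k n (label k n g r e) (outerPt (outerHalf k n) i)
        = fiber k n (label k n g' r' e') (outerPt (outerHalf k n) i) := by
      rw [← kerPart_part hi, h, kerPart_part hi]
    have h3 := c.card_fiber_of_nonneg hi (by rw [c.label_opener hg]; exact hnn)
    have h4 := c'.card_fiber_of_nonneg hi (by rw [c'.label_opener (h1.1 hg)]; exact hnn)
    rw [c.label_opener hg, hred c] at h3
    rw [c'.label_opener (h1.1 hg), hred c'] at h4
    rw [h2, h4] at h3
    exact (Nat.eq_of_mul_eq_mul_left c.one_le h3).symm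
  · omega

/-- If blocks of both circles are joined, turning the inner circle by half a turn yields a
different partition. -/
theorem kerPart_add_half_ne (c : IsCode k n g r e) (hd : height k g (outerHalf k n) = k) :
    kerPart k n (label k n g r e) ≠ kerPart k n (label k n g r (e + k)) := by
  intro h
  have hN := c.pos
  have hkp := c.kpos
  set x := innerPt (outerHalf k n) k 0 with hx
  have hxp : x ∈ points k n := innerPt_mem c.one_le hN 0
  have hlx : 0 ≤ label k n g r e x ∧ label k n g r e x < 2 * outerHalf k n ∧
      1 ≤ g (label k n g r e x) := by
    rcases c.label_cases hxp with h | h | h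
    · exact h
    · omega
    · omega
  have h1 := c.label_opener hlx.2.2
  have h2 := c.add_half.label_opener hlx.2.2
  rw [Int.emod_eq_of_lt hlx.1 hlx.2.1] at h1 h2
  have h3 := (label_eq_iff_of_kerPart_eq h hxp (outerPt_mem hN _)).1 h1.symm
  rw [h2] at h3
  -- Half a turn gives each inner point the label of its opposite but leaves the outer labels. Equal
  -- partitions would then put x and -x into one block, although that block has an opener.
  have h4 : label k n g r (e + k) x = label k n g r e (-x) := by
    rw [hx, ← innerPt_add_period hkp, c.label_innerPt, c.add_half.label_innerPt,
      innerLabel_add hN hkp c.per c.drift rfl]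
    by_cases hex : ∃ j, IsLastBelow (height k g) j (e - 1 - 0)
    · obtain ⟨j, hj⟩ := hex
      have := hj.shift c.per 1
      rw [innerLabel_of_isLastBelow hj, oppLabel_emod hN,
        innerLabel_of_isLastBelow (j := j + outerHalf k n)]
      convert this using 1
      · ring
      · rw [hd]; ring
    · push Not at hex
      have h5 := c.label_innerPt 0
      rw [innerLabel_of_not hex, if_neg (by omega), ← hx] at h5
      omega
  exact c.label_neg_ne hxp (Or.inl hlx.1) (h4.symm.trans h3)

end IsCode

end TypeD

/-! ### Starting points of blocks on the outer circle, and good cuts -/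

namespace TypeD

section Circle

variable {γ : Type*} {k n : ℕ} {β : ℤ → γ} {a b : ℤ}

theorem discPt_of_lt {s : ℤ} (hs : s < 2 * outerHalf k n) :
    discPt k n a b s = outerPt (outerHalf k n) (a + s) := if_pos hs

theorem discPt_of_ge {s : ℤ} (hs : 2 * outerHalf k n ≤ s) :
    discPt k n a b s = innerPt (outerHalf k n) k (b + (s - 2 * outerHalf k n)) :=
  if_neg (not_lt.2 hs)

/-- On the outer circle, the absence of crossings does not depend on the cut. -/
theorem eq_of_circle_crossing (hk : 1 ≤ k) (hN : 0 < outerHalf k n)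
    (hnc : PlaceNC (fun s => β (discPt k n a b s)) (discLen k n)) {x y z w : ℤ}
    (hxy : x < y) (hyz : y < z) (hzw : z < w) (hwx : w < x + 2 * outerHalf k n)
    (hxz : β (outerPt (outerHalf k n) x) = β (outerPt (outerHalf k n) z))
    (hyw : β (outerPt (outerHalf k n) y) = β (outerPt (outerHalf k n) w)) :
    β (outerPt (outerHalf k n) x) = β (outerPt (outerHalf k n) y) := by
  obtain ⟨q, hq, h0, h1⟩ := exists_eq_emod_add_mul (x - a) (b := 2 * outerHalf k n) (by omega)
  set s := (x - a) % (2 * outerHalf k n)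
  have hlen : 2 * outerHalf k n < discLen k n := by rw [discLen]; omega
  have hlow : ∀ u, x ≤ u → u - x + s < 2 * outerHalf k n →
      outerPt (outerHalf k n) u = discPt k n a b (u - x + s) := by
    intro u _ hu
    rw [discPt_of_lt hu, ← outerPt_add_mul _ (a + (u - x + s)) q]
    congr 1; linarith
  have hhigh : ∀ u, u - x + s - 2 * outerHalf k n < 2 * outerHalf k n →
      outerPt (outerHalf k n) u = discPt k n a b (u - x + s - 2 * outerHalf k n) := by
    intro u hu
    rw [discPt_of_lt hu, ← outerPt_add_mul _ (a + (u - x + s - 2 * outerHalf k n)) (q + 1)]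
    congr 1; linarith
  rw [hlow x le_rfl (by omega)] at hxz ⊢
  -- The cut may separate the four points at any place; in the disc they appear in a cyclic rotation
  -- of x, y, z, w, and rotations preserve crossings.
  rcases lt_or_ge (w - x + s) (2 * outerHalf k n) with hw | hw
  · rw [hlow z (by omega) (by omega)] at hxz
    rw [hlow y (by omega) (by omega), hlow w (by omega) (by omega)] at hyw
    rw [hlow y (by omega) (by omega)]
    exact hnc _ _ _ _ (by omega) (by omega) (by omega) (by omega) (by omega) hxz hyw
  · rw [hhigh w (by omega)] at hyw
    rcases lt_or_ge (z - x + s) (2 * outerHalf k n) with hz | hz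
    · rw [hlow z (by omega) (by omega)] at hxz
      rw [hlow y (by omega) (by omega)] at hyw ⊢
      have := hnc (w - x + s - 2 * outerHalf k n) (x - x + s) (y - x + s) (z - x + s)
        (by omega) (by omega) (by omega) (by omega) (by omega) hyw.symm hxz
      exact this.symm.trans hyw.symm
    · rw [hhigh z (by omega)] at hxz
      rcases lt_or_ge (y - x + s) (2 * outerHalf k n) with hy | hy
      · rw [hlow y (by omega) (by omega)] at hyw ⊢
        have := hnc (z - x + s - 2 * outerHalf k n) (w - x + s - 2 * outerHalf k n) (x - x + s)
          (y - x + s) (by omega) (by omega) (by omega) (by omega) (by omega) hxz.symm hyw.symm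
        exact hxz.trans (this.trans hyw.symm)
      · rw [hhigh y (by omega)] at hyw ⊢
        have := hnc (y - x + s - 2 * outerHalf k n) (z - x + s - 2 * outerHalf k n)
          (w - x + s - 2 * outerHalf k n) (x - x + s) (by omega) (by omega) (by omega) (by omega)
          (by omega) hyw hxz.symm
        exact hxz.trans this.symm

/-- No point of the block of the outer point at `i` lies in the half circle before it. -/
def IsArcFirst (k n : ℕ) (β : ℤ → γ) (i : ℤ) : Prop :=
  ∀ j, i - outerHalf k n ≤ j → j < i →
    β (outerPt (outerHalf k n) j) ≠ β (outerPt (outerHalf k n) i)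

theorem isArcFirst_add_mul (i q : ℤ) (h : IsArcFirst k n β i) :
    IsArcFirst k n β (i + 2 * outerHalf k n * q) := by
  intro j hj1 hj2
  have := h (j + 2 * outerHalf k n * (-q)) (by linarith) (by linarith)
  rwa [outerPt_add_mul] at this ⊢

/-- The first point i of the block in the half circle that ends at p is a starting point: an earlier
one within half a circle of i would make the block cross its opposite. -/
theorem exists_isArcFirst (hk : 1 ≤ k) (hN : 0 < outerHalf k n)
    (hsymm : ∀ x ∈ points k n, ∀ y ∈ points k n, β x = β y → β (-x) = β (-y))
    (hnc : PlaceNC (fun s => β (discPt k n a b s)) (discLen k n)) {p : ℤ}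
    (hp : β (-outerPt (outerHalf k n) p) ≠ β (outerPt (outerHalf k n) p)) (u : ℤ) :
    ∃ i, u ≤ i ∧ i < u + 2 * outerHalf k n ∧
      β (outerPt (outerHalf k n) i) = β (outerPt (outerHalf k n) p) ∧ IsArcFirst k n β i := by
  obtain ⟨i, ⟨h1, h2, h3⟩, h4⟩ := Int.exists_least_of_bdd
    (P := fun i => p - outerHalf k n < i ∧ i ≤ p ∧
      β (outerPt (outerHalf k n) i) = β (outerPt (outerHalf k n) p))
    ⟨p - outerHalf k n, fun z hz => hz.1.le⟩ ⟨p, by omega, le_rfl, rfl⟩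
  have hi : IsArcFirst k n β i := by
    intro j hj1 hj2 hj
    have hneg : β (outerPt (outerHalf k n) (i - outerHalf k n))
        = β (outerPt (outerHalf k n) (p - outerHalf k n)) := by
      rw [outerPt_sub_period hN, outerPt_sub_period hN]
      exact hsymm _ (outerPt_mem hN _) _ (outerPt_mem hN _) h3
    have hpn := hp
    rw [← outerPt_sub_period hN] at hpn
    have hj3 : j < p - outerHalf k n := by
      by_contra hcon
      rcases (not_lt.1 hcon).eq_or_lt with h | h
      · rw [← h, h3] at hj
        exact hpn hj
      · have := h4 j ⟨h, by omega, hj.trans h3⟩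
        omega
    have hj4 : j ≠ i - outerHalf k n := by
      rintro rfl
      rw [hneg, h3] at hj
      exact hpn hj
    -- The points i - N and p - N belong to the opposite block, j and i to the block itself.
    have := eq_of_circle_crossing hk hN hnc (x := i - outerHalf k n) (y := j)
      (z := p - outerHalf k n) (w := i) (by omega) (by omega) (by omega) (by omega) hneg hj
    rw [hneg, hj, h3] at this
    exact hpn this
  obtain ⟨q, hq, h5, h6⟩ := exists_eq_emod_add_mul (i - u) (b := 2 * outerHalf k n) (by omega)
  have h7 : i + 2 * outerHalf k n * (-q) = u + (i - u) % (2 * outerHalf k n) := by linarith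
  refine ⟨i + 2 * outerHalf k n * (-q), by omega, by omega, ?_, isArcFirst_add_mul _ _ hi⟩
  rw [outerPt_add_mul, h3]

/-- If some block meets both circles, a block that is not its own opposite starts in the disc at
its first point on the arc. -/
theorem isFirst_of_isArcFirst (hk : 1 ≤ k) (hN : 0 < outerHalf k n)
    (hsymm : ∀ x ∈ points k n, ∀ y ∈ points k n, β x = β y → β (-x) = β (-y))
    (hnc : PlaceNC (fun s => β (discPt k n a b s)) (discLen k n)) {x y : ℤ} (hx : x ∈ points k n)
    (hy : y ∈ points k n) (hxo : OnOuter k n x) (hyi : ¬ OnOuter k n y) (hxy : β x = β y) {s : ℤ}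
    (hs : s < 2 * outerHalf k n)
    (hne : β (-outerPt (outerHalf k n) (a + s)) ≠ β (outerPt (outerHalf k n) (a + s)))
    (harc : IsArcFirst k n β (a + s)) : IsFirst (fun s => β (discPt k n a b s)) s := by
  intro j hj0 hjs hj
  have hjs' : j < s - outerHalf k n := by
    by_contra hcon
    refine harc (a + j) (by omega) (by omega) ?_
    simpa only [discPt_of_lt hs, discPt_of_lt (by omega : j < 2 * outerHalf k n)] using hj
  have hplace : ∀ z ∈ points k n, ¬ OnOuter k n z → ∃ u, 2 * outerHalf k n ≤ u ∧
      u < discLen k n ∧ discPt k n a b u = z := by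
    intro z hz hzi
    have := cutPos_nonneg_lt hk hN a b z
    exact ⟨_, not_lt.1 fun h => hzi (this.2.2.2 h), this.2.1, discPt_cutPos hk hN a b hz⟩
  obtain ⟨q, hq, h1, h2⟩ := exists_eq_emod_add_mul (outerPos k n x - (a + j + 1))
    (b := outerHalf k n) hN
  set c := (outerPos k n x - (a + j + 1)) % outerHalf k n
  -- The outer point x of the block meeting both circles, or its opposite, has a representative in
  -- each window of N positions, in particular among the N places after j. It is connected to an
  -- inner place, which comes after s.
  have htr : ∃ z ∈ points k n, ¬ OnOuter k n z ∧
      β (outerPt (outerHalf k n) (a + (j + 1 + c))) = β z := by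
    have h3 : a + (j + 1 + c) = outerPos k n x - outerHalf k n * q := by linarith
    rw [h3]
    obtain ⟨m, hm⟩ := Int.even_or_odd' q
    rcases hm with rfl | rfl
    · rw [show outerPos k n x - outerHalf k n * (2 * m)
        = outerPos k n x + 2 * outerHalf k n * (-m) by ring, outerPt_add_mul, outerPt_outerPos hx hxo]
      exact ⟨y, hy, hyi, hxy⟩
    · rw [show outerPos k n x - outerHalf k n * (2 * m + 1)
        = outerPos k n x - outerHalf k n + 2 * outerHalf k n * (-m) by ring, outerPt_add_mul,
        outerPt_sub_period hN, outerPt_outerPos hx hxo]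
      exact ⟨-y, neg_mem_points hy, fun h => hyi (onOuter_neg.1 h), hsymm x hx y hy hxy⟩
  obtain ⟨z, hz, hzi, hzβ⟩ := htr
  obtain ⟨u, hu1, hu2, rfl⟩ := hplace z hz hzi
  have hlen : 2 * outerHalf k n < discLen k n := by rw [discLen]; omega
  rw [← discPt_of_lt (b := b) (by omega)] at hzβ
  -- So the block of j and s is itself connected to the inner circle; otherwise it would be crossed.
  have h3 := hnc j (j + 1 + c) s u hj0 (by omega) (by omega) (by omega) hu2 hj hzβ
  obtain ⟨v, hv1, hv2, hv3⟩ := hplace _ (neg_mem_points hz) (fun h => hzi (onOuter_neg.1 h))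
  simp only at hj h3
  have hs' : β (outerPt (outerHalf k n) (a + s)) = β (discPt k n a b u) := by
    rw [← discPt_of_lt (b := b) hs, ← hj, h3, hzβ]
  have h4 := hsymm _ (outerPt_mem hN _) _ hz hs'
  rw [← outerPt_sub_period hN, ← hv3, add_sub_assoc, ← discPt_of_lt (b := b) (by omega)] at h4
  -- The opposite block contains the place s - N between j and s and also reaches the inner circle,
  -- so it would cross the block.
  have h5 := hnc j (s - outerHalf k n) s v hj0 (by omega) (by omega) (by omega) hv2 hj h4
  simp only at h5
  rw [hj, discPt_of_lt hs, discPt_of_lt (by omega), ← add_sub_assoc, outerPt_sub_period hN] at h5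
  exact hne h5.symm

/-- The disc starts every block that is not its own opposite at its first point on the arc. -/
def IsGoodCut (k n : ℕ) (β : ℤ → γ) (a b : ℤ) : Prop :=
  ∀ s, 0 ≤ s → s < 2 * outerHalf k n →
    β (-outerPt (outerHalf k n) (a + s)) ≠ β (outerPt (outerHalf k n) (a + s)) →
    (IsFirst (fun s => β (discPt k n a b s)) s ↔ IsArcFirst k n β (a + s))

theorem isGoodCut (hk : 1 ≤ k) (hN : 0 < outerHalf k n)
    (hsymm : ∀ x ∈ points k n, ∀ y ∈ points k n, β x = β y → β (-x) = β (-y))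
    (hnc : PlaceNC (fun s => β (discPt k n a b s)) (discLen k n)) {x y : ℤ} (hx : x ∈ points k n)
    (hy : y ∈ points k n) (hxo : OnOuter k n x) (hyi : ¬ OnOuter k n y) (hxy : β x = β y) :
    IsGoodCut k n β a b := by
  intro s hs0 hs hne
  refine ⟨fun hfirst => ?_, isFirst_of_isArcFirst hk hN hsymm hnc hx hy hxo hyi hxy hs hne⟩
  obtain ⟨i, hi1, hi2, hi3, hi4⟩ := exists_isArcFirst hk hN hsymm hnc hne a
  have hne' : β (-outerPt (outerHalf k n) i) ≠ β (outerPt (outerHalf k n) i) := by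
    rw [hi3, hsymm _ (outerPt_mem hN _) _ (outerPt_mem hN _) hi3]
    exact hne
  have h1 := isFirst_of_isArcFirst hk hN hsymm hnc hx hy hxo hyi hxy (s := i - a) (by omega)
    (by rwa [add_sub_cancel]) (by rwa [add_sub_cancel])
  have h2 : β (discPt k n a b (i - a)) = β (discPt k n a b s) := by
    rw [discPt_of_lt hs, discPt_of_lt (by omega), add_sub_cancel, hi3]
  rcases lt_trichotomy (i - a) s with h | h | h
  · exact absurd h2 (hfirst _ (by omega) h)
  · rw [← h, add_sub_cancel]; exact hi4
  · exact absurd h2.symm (h1 _ hs0 h)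

end Circle

end TypeD

/-! ### The code of a partition and its walk -/

namespace TypeD

section Partition

variable {k n : ℕ} {π : Finpartition (points k n)} {a b : ℤ}

theorem fiber_part {x : ℤ} (hx : x ∈ points k n) : fiber k n π.part x = π.part x := by
  ext y
  rw [mem_fiber]
  constructor
  · rintro ⟨hy, h⟩
    rw [h]; exact π.mem_part hy
  · intro hy
    have hyp := π.part_subset x hy
    exact ⟨hyp, ((π.mem_part_iff_part_eq_part hyp hx).1 hy).symm⟩

theorem part_eq_of_mem_part {x y : ℤ} (hx : x ∈ points k n) (h : y ∈ π.part x) :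
    π.part y = π.part x :=
  (π.mem_part_iff_part_eq_part (π.part_subset x h) hx).1 h

theorem part_neg (hneg : ∀ V ∈ π.parts, negBlock V ∈ π.parts) {x : ℤ} (hx : x ∈ points k n) :
    π.part (-x) = negBlock (π.part x) :=
  π.part_eq_of_mem (hneg _ (π.part_mem.2 hx)) (by rw [mem_negBlock, neg_neg]; exact π.mem_part hx)

theorem part_neg_congr (hneg : ∀ V ∈ π.parts, negBlock V ∈ π.parts) (x : ℤ)
    (hx : x ∈ points k n) (y : ℤ) (hy : y ∈ points k n) (h : π.part x = π.part y) :
    π.part (-x) = π.part (-y) := by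
  rw [part_neg hneg hx, part_neg hneg hy, h]

theorem dvd_card_part (hk : 1 ≤ k) (hN : 0 < outerHalf k n)
    (hann : IsAnnularDivisible k n π.parts) {x : ℤ} (hx : x ∈ points k n) :
    k ∣ (π.part x).card := by
  obtain ⟨a, b, -, hcong⟩ := hann
  refine dvd_card_of_congruence (p := cutPos k n a b) ?_ (hcong _ (π.part_mem.2 hx))
  intro y hy z hz h
  exact cutPos_injOn hk hN a b (π.part_subset x hy) (π.part_subset x hz) h

theorem part_placeNC (hk : 1 ≤ k) (hN : 0 < outerHalf k n)
    (h : NonCrossing π.parts (cutPos k n a b)) :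
    PlaceNC (fun s => π.part (discPt k n a b s)) (discLen k n) :=
  placeNC_of_nonCrossing hk hN (fun x hx => by rw [fiber_part hx]; exact π.part_mem.2 hx) h

open Classical in
/-- The code of a partition: the size divided by `k` of the block that starts at a position. -/
noncomputable def blockSeq (π : Finpartition (points k n)) (i : ℤ) : ℕ :=
  if IsArcFirst k n π.part i then (π.part (outerPt (outerHalf k n) i)).card / k else 0

theorem blockSeq_add (hN : 0 < outerHalf k n) (hneg : ∀ V ∈ π.parts, negBlock V ∈ π.parts)
    (i : ℤ) : blockSeq π (i + outerHalf k n) = blockSeq π i := by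
  have h1 : IsArcFirst k n π.part (i + outerHalf k n) ↔ IsArcFirst k n π.part i := by
    constructor
    · intro h j hj1 hj2 hj
      refine h (j + outerHalf k n) (by omega) (by omega) ?_
      rw [outerPt_add_period hN, outerPt_add_period hN]
      exact part_neg_congr hneg _ (outerPt_mem hN _) _ (outerPt_mem hN _) hj
    · intro h j hj1 hj2 hj
      refine h (j - outerHalf k n) (by omega) (by omega) ?_
      have := part_neg_congr hneg _ (outerPt_mem hN _) _ (outerPt_mem hN _) hj
      rwa [outerPt_add_period hN, neg_neg, ← outerPt_sub_period hN] at this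
  rw [blockSeq, blockSeq, h1, outerPt_add_period hN, part_neg hneg (outerPt_mem hN _),
    card_negBlock]

/-- The walk of the block sizes in the order of the disc. -/
noncomputable def discWalk (π : Finpartition (points k n)) (a b : ℤ) : ℤ → ℤ :=
  walk (fun s => (firstSize (fun s => π.part (discPt k n a b s)) (discLen k n) s : ℤ) - 1)

theorem discWalk_sub {u v : ℤ} (huv : u ≤ v) : discWalk π a b v - discWalk π a b u =
    ∑ x ∈ Finset.Ico u v,
      (firstSize (fun s => π.part (discPt k n a b s)) (discLen k n) x : ℤ) - (v - u) := by
  rw [discWalk, walk_sub_walk _ huv, Finset.sum_sub_distrib]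
  simp only [Finset.sum_const, Int.card_Ico, nsmul_eq_mul, mul_one]
  rw [Int.toNat_of_nonneg (by omega)]

theorem discWalk_zero : discWalk π a b 0 = 0 := walk_zero _

theorem discWalk_nonneg {v : ℤ} (hv : 0 ≤ v) (hvm : v ≤ discLen k n) :
    0 ≤ discWalk π a b v := by
  have h1 := discWalk_sub (π := π) (a := a) (b := b) hv
  have h2 := le_sum_firstSize (β := fun s => π.part (discPt k n a b s)) hv hvm
  rw [discWalk_zero] at h1
  omega

theorem isOpener_discWalk (hk : 1 ≤ k) (hN : 0 < outerHalf k n)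
    (h : NonCrossing π.parts (cutPos k n a b)) {j s : ℤ} (hj : 0 ≤ j) (hjs : j ≤ s)
    (hs : s < discLen k n) (hβ : π.part (discPt k n a b j) = π.part (discPt k n a b s))
    (hfirst : IsFirst (fun s => π.part (discPt k n a b s)) j) :
    IsOpener (discWalk π a b) j s :=
  isOpener_of_isFirst (β := fun s => π.part (discPt k n a b s)) (part_placeNC hk hN h)
    (fun _ _ _ huv _ => discWalk_sub huv) hj hjs hs hβ hfirst

theorem firstSize_of_isFirst (hk : 1 ≤ k) (hN : 0 < outerHalf k n) {s : ℤ}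
    (hfirst : IsFirst (fun s => π.part (discPt k n a b s)) s) :
    firstSize (fun s => π.part (discPt k n a b s)) (discLen k n) s
      = (π.part (discPt k n a b s)).card := by
  classical
  have h : (π.part (discPt k n a b s)).card
      = ((points k n).filter (fun y => π.part (discPt k n a b s) = π.part y)).card := by
    rw [← fiber_eq_filter, fiber_part (discPt_mem hk hN a b s)]
  rw [firstSize, if_pos hfirst, h, card_filter_points hk hN a b]
  congr 1
  ext y
  simp only [Finset.mem_filter, eq_comm]

/-- A point whose block is not its own opposite. -/
def IsGeneric (π : Finpartition (points k n)) (x : ℤ) : Prop := π.part (-x) ≠ π.part x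

/-- In a good cut the blocks start where the code says. This makes the disc walk and the height take
the same steps at places of blocks that are not their own opposite. -/
theorem firstSize_eq_blockSeq (hk : 1 ≤ k) (hN : 0 < outerHalf k n)
    (hann : IsAnnularDivisible k n π.parts) (hgood : IsGoodCut k n π.part a b) {s : ℤ}
    (hs0 : 0 ≤ s) (hs : s < 2 * outerHalf k n)
    (hgen : IsGeneric π (outerPt (outerHalf k n) (a + s))) :
    firstSize (fun s => π.part (discPt k n a b s)) (discLen k n) s = k * blockSeq π (a + s) := by
  have h1 := hgood s hs0 hs hgen
  by_cases hf : IsFirst (fun s => π.part (discPt k n a b s)) s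
  · rw [firstSize_of_isFirst hk hN hf, blockSeq, if_pos (h1.1 hf), discPt_of_lt hs,
      Nat.mul_div_cancel' (dvd_card_part hk hN hann (outerPt_mem hN _))]
  · rw [firstSize, if_neg hf, blockSeq, if_neg (fun h => hf (h1.2 h)), mul_zero]

theorem discWalk_sub_eq_height (hk : 1 ≤ k) (hN : 0 < outerHalf k n)
    (hann : IsAnnularDivisible k n π.parts) (hgood : IsGoodCut k n π.part a b) {u v : ℤ}
    (hu : 0 ≤ u) (huv : u ≤ v) (hv : v ≤ 2 * outerHalf k n)
    (hgen : ∀ s, u ≤ s → s < v → IsGeneric π (outerPt (outerHalf k n) (a + s))) :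
    discWalk π a b v - discWalk π a b u =
      height k (blockSeq π) (a + v) - height k (blockSeq π) (a + u) := by
  induction v, huv using Int.leInduction with
  | base => simp
  | succ v huv ih =>
    have h1 := ih (by omega) (fun s h1 h2 => hgen s h1 (by omega))
    have h2 := firstSize_eq_blockSeq hk hN hann hgood (by omega) (by omega) (hgen v huv (by omega))
    rw [discWalk, walk_succ, h2, ← add_assoc, height_succ]
    rw [discWalk] at h1
    push_cast
    linarith

/-- The opener property of the first element transfers from the disc walk, since between j and s the
two walks differ by a constant. -/
theorem isOpener_height (hk : 1 ≤ k) (hN : 0 < outerHalf k n)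
    (hann : IsAnnularDivisible k n π.parts) (hnc : NonCrossing π.parts (cutPos k n a b))
    (hgood : IsGoodCut k n π.part a b) {j s : ℤ} (hj : 0 ≤ j) (hjs : j ≤ s)
    (hs : s < 2 * outerHalf k n)
    (hgen : ∀ u, j ≤ u → u ≤ s → IsGeneric π (outerPt (outerHalf k n) (a + u)))
    (hβ : π.part (discPt k n a b j) = π.part (discPt k n a b s))
    (hfirst : IsFirst (fun s => π.part (discPt k n a b s)) j) :
    IsOpener (height k (blockSeq π)) (a + j) (a + s) := by
  have hlen : 2 * outerHalf k n < discLen k n := by rw [discLen]; omega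
  have h1 := isOpener_discWalk hk hN hnc hj hjs (by omega) hβ hfirst
  have h2 : ∀ v, j ≤ v → v ≤ s + 1 → discWalk π a b v - discWalk π a b j =
      height k (blockSeq π) (a + v) - height k (blockSeq π) (a + j) :=
    fun v hv hv' => discWalk_sub_eq_height hk hN hann hgood hj hv (by omega)
      (fun u hu hu' => hgen u hu (by omega))
  have h3 := h2 (s + 1) (by omega) le_rfl
  have h4 := h1.2.1
  rw [← add_assoc] at h3
  refine ⟨by omega, by omega, fun i hi hi' => ?_⟩
  have h5 := h1.2.2 (i - a) (by omega) (by omega)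
  have h6 := h2 (i - a) (by omega) (by omega)
  rw [add_sub_cancel] at h6
  omega

theorem height_period (hN : 0 < outerHalf k n) (hneg : ∀ V ∈ π.parts, negBlock V ∈ π.parts)
    (p : ℤ) : height k (blockSeq π) (p + outerHalf k n)
      = height k (blockSeq π) p + height k (blockSeq π) (outerHalf k n) :=
  height_add_period (blockSeq_add hN hneg) p

theorem height_two (hN : 0 < outerHalf k n) (hneg : ∀ V ∈ π.parts, negBlock V ∈ π.parts)
    (p : ℤ) : height k (blockSeq π) (p + 2 * outerHalf k n)
      = height k (blockSeq π) p + 2 * height k (blockSeq π) (outerHalf k n) := by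
  rw [two_mul, ← add_assoc, height_period hN hneg, height_period hN hneg]
  ring

end Partition

/-! ### Partitions with a zero-block -/

section ZeroBlock

variable {k n : ℕ} {π : Finpartition (points k n)}

/-- A partition with a zero block is determined by its code. -/
theorem eq_kerPart_of_zero_block (hk : 1 ≤ k) (hN : 0 < outerHalf k n) (h : IsNCD k n π)
    {z : ℤ} (hz : z ∈ points k n) (hzero : ¬ IsGeneric π z) :
    height k (blockSeq π) (outerHalf k n) < 0 ∧
    ∀ r, IsRecord (height k (blockSeq π)) (height k (blockSeq π) (outerHalf k n)) r →
      π = kerPart k n (label k n (blockSeq π) r 0) := by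
  classical
  rw [IsGeneric, not_not] at hzero
  have hZneg : negBlock (π.part z) = π.part z := by rw [← part_neg h.neg_mem hz, hzero]
  obtain ⟨hZin, hZout⟩ := h.zero_block _ (π.part_mem.2 hz) hZneg
  obtain ⟨w, hw⟩ : ((π.part z).filter (OnOuter k n)).Nonempty := by
    rw [← Finset.card_pos]; omega
  rw [Finset.mem_filter] at hw
  have hwp := π.part_subset z hw.1
  have hZ : ∀ x ∈ points k n, ¬ IsGeneric π x ↔ π.part x = π.part z := by
    intro x hx
    constructor
    · intro hxz
      rw [IsGeneric, not_not] at hxz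
      have h1 := (h.zero_block _ (π.part_mem.2 hx) (by rw [← part_neg h.neg_mem hx, hxz])).1
      have hi := innerPt_mem hk hN 0
      rw [← part_eq_of_mem_part hx (h1 _ hi (not_onOuter_innerPt hk hN 0)),
        ← part_eq_of_mem_part hz (hZin _ hi (not_onOuter_innerPt hk hN 0))]
    · intro hxz
      rw [IsGeneric, not_not, part_neg h.neg_mem hx, hxz, hZneg]
  have hinner : ∀ x ∈ points k n, ¬ OnOuter k n x → π.part x = π.part z := fun x hx hxi =>
    part_eq_of_mem_part hz (hZin x hx hxi)
  obtain ⟨a, b, hnc, hcong⟩ := h.annular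
  have hpnc := part_placeNC hk hN hnc
  have hI := innerPt_mem hk hN 0
  have hIo := not_onOuter_innerPt hk hN 0
  have hgood : IsGoodCut k n π.part a b :=
    isGoodCut hk hN (part_neg_congr h.neg_mem) hpnc hwp hI hw.2 hIo
      ((part_eq_of_mem_part hz hw.1).trans (hinner _ hI hIo).symm)
  have hlen : 2 * outerHalf k n < discLen k n := by rw [discLen]; omega
  have hlastβ : π.part (discPt k n a b (2 * outerHalf k n)) = π.part z := by
    rw [discPt_of_ge le_rfl]
    exact hinner _ (innerPt_mem hk hN _) (not_onOuter_innerPt hk hN _)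
  -- points of the blocks that are not zero
  have hop : ∀ s, 0 ≤ s → s < 2 * outerHalf k n →
      IsGeneric π (outerPt (outerHalf k n) (a + s)) → ∃ j, 0 ≤ j ∧ j ≤ s ∧
      π.part (discPt k n a b j) = π.part (discPt k n a b s) ∧
      IsFirst (fun s => π.part (discPt k n a b s)) j ∧
      IsOpener (height k (blockSeq π)) (a + j) (a + s) := by
    intro s hs0 hs hgen
    obtain ⟨j, hj0, hjs, hjβ, hjf⟩ := exists_isFirst (fun s => π.part (discPt k n a b s)) hs0
    refine ⟨j, hj0, hjs, hjβ, hjf, isOpener_height hk hN h.annular hnc hgood hj0 hjs hs ?_ hjβ hjf⟩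
    intro u hju hus
    by_contra hu
    rw [hZ _ (outerPt_mem hN _)] at hu
    have hne : π.part (outerPt (outerHalf k n) (a + s)) ≠ π.part z := fun hc =>
      (hZ _ (outerPt_mem hN _)).2 hc hgen
    rw [← discPt_of_lt (b := b) (by omega)] at hu hne
    have hju' : j ≠ u := by rintro rfl; exact hne (hjβ.symm.trans hu)
    have hus' : u ≠ s := by rintro rfl; exact hne hu
    have := hpnc j u s _ hj0 (by omega) (by omega) hs hlen hjβ (hu.trans hlastβ.symm)
    exact hne (hjβ.symm.trans (this.trans hu))
  -- the drift is negative
  have hd : height k (blockSeq π) (outerHalf k n) < 0 := by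
    obtain ⟨s, hs0, hs1, rfl⟩ := exists_discPt hk hN a b hwp
    have hso : s < 2 * outerHalf k n := by
      have := hw.2
      rwa [(cutPos_nonneg_lt hk hN a b _).2.2, cutPos_discPt hk hN a b hs0 hs1] at this
    obtain ⟨f, hf0, hfs, hfβ, hff⟩ := exists_isFirst (fun s => π.part (discPt k n a b s)) hs0
    have hfz : π.part (discPt k n a b f) = π.part z :=
      hfβ.trans (part_eq_of_mem_part hz hw.1)
    -- All blocks together have 2N + 2k points, so the disc walk is at most 2k at 2N. It exceeds the
    -- increase of the height by at least the size of the zero-block, which the code omits; this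
    -- size is at least 2k + 2, so 2d ≤ -2.
    have h1 := discWalk_sub (π := π) (a := a) (b := b) (u := 0) (v := 2 * outerHalf k n) (by omega)
    have h2 := sum_firstSize (β := fun s => π.part (discPt k n a b s)) (m := discLen k n) (u := 0)
      (v := 2 * outerHalf k n) le_rfl
    have h3 := Finset.card_le_card (Finset.filter_subset (fun y => ∃ x, 0 ≤ x ∧
      x < 2 * outerHalf k n ∧ IsFirst (fun s => π.part (discPt k n a b s)) x ∧
      π.part (discPt k n a b y) = π.part (discPt k n a b x)) (Finset.Ico 0 (discLen k n)))
    rw [← h2, Int.card_Ico] at h3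
    have h4 := discWalk_sub_eq_height hk hN h.annular hgood (u := 0) (v := f) le_rfl hf0 (by omega)
      (by
        intro u hu hu'
        by_contra hc
        rw [hZ _ (outerPt_mem hN _), ← discPt_of_lt (b := b) (by omega)] at hc
        exact hff u hu hu' (hc.trans hfz.symm))
    -- A point of the zero-block has its opposite in the same block half a circle before, so it is
    -- never a starting point and contributes only -1 to the height; the disc walk never rises by
    -- less.
    have h5 : ∀ v, f + 1 ≤ v → v ≤ 2 * outerHalf k n →
        discWalk π a b v - discWalk π a b (f + 1)
        ≥ height k (blockSeq π) (a + v) - height k (blockSeq π) (a + (f + 1)) := by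
      intro v hv
      induction v, hv using Int.leInduction with
      | base => simp
      | succ v hv ih =>
        intro hv2
        have h1 := ih (by omega)
        have h2 : k * blockSeq π (a + v)
            ≤ firstSize (fun s => π.part (discPt k n a b s)) (discLen k n) v := by
          by_cases hgen : IsGeneric π (outerPt (outerHalf k n) (a + v))
          · exact (firstSize_eq_blockSeq hk hN h.annular hgood (by omega) (by omega) hgen).ge
          · rw [IsGeneric, not_not, ← outerPt_sub_period hN] at hgen
            have : ¬ IsArcFirst k n π.part (a + v) := fun harc =>
              harc _ le_rfl (by omega) hgen
            rw [blockSeq, if_neg this, mul_zero]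
            exact Nat.zero_le _
        have h3 : (k : ℤ) * blockSeq π (a + v)
            ≤ firstSize (fun s => π.part (discPt k n a b s)) (discLen k n) v := by
          exact_mod_cast h2
        rw [discWalk, walk_succ, ← add_assoc, height_succ]
        rw [discWalk] at h1
        linarith
    have h6 := h5 (2 * outerHalf k n) (by omega) le_rfl
    have h7 : discWalk π a b (f + 1) = discWalk π a b f + ((π.part z).card - 1) := by
      rw [discWalk, walk_succ, firstSize_of_isFirst hk hN hff, hfz]
    have h8 : height k (blockSeq π) (a + (f + 1)) = height k (blockSeq π) (a + f) - 1 := by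
      rw [← add_assoc, height_succ]
      have : ¬ IsArcFirst k n π.part (a + f) := fun harc => by
        refine harc _ le_rfl (by omega) ?_
        have := (hZ _ (outerPt_mem hN (a + f))).2 (by rw [← hfz, discPt_of_lt (by omega)])
        rw [IsGeneric, not_not, ← outerPt_sub_period hN] at this
        exact this
      rw [blockSeq, if_neg this]
      simp [sub_eq_add_neg]
    have h9 : 2 * k + 2 ≤ (π.part z).card := by
      rw [← Finset.card_filter_add_card_filter_not (s := π.part z) (OnOuter k n)]
      have : (points k n).filter (fun x => ¬ OnOuter k n x)
          ⊆ (π.part z).filter (fun x => ¬ OnOuter k n x) := by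
        intro x hx
        rw [Finset.mem_filter] at *
        exact ⟨hZin x hx.1 hx.2, hx.2⟩
      have := Finset.card_le_card this
      rw [card_inner hk hN] at this
      omega
    have h10 := height_two hN h.neg_mem a
    rw [discWalk_zero, add_zero] at h4
    rw [discWalk_zero] at h1
    have h11 : ((∑ x ∈ Finset.Ico 0 (2 * outerHalf k n),
        firstSize (fun s => π.part (discPt k n a b s)) (discLen k n) x : ℕ) : ℤ)
        ≤ discLen k n := by omega
    push_cast at h11
    have hlen' : discLen k n = 2 * outerHalf k n + 2 * k := rfl
    have h12 : ((2 * k + 2 : ℕ) : ℤ) ≤ (π.part z).card := by exact_mod_cast h9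
    push_cast at h12
    linarith
  refine ⟨hd, fun r hr => ?_⟩
  have c : IsCode k n (blockSeq π) r 0 :=
    ⟨hk, hN, blockSeq_add hN h.neg_mem, Or.inl hd.le, hr, dvd_zero _⟩
  -- the labels of the points outside the zero block
  have hlab : ∀ x ∈ points k n, IsGeneric π x → ∃ j, 0 ≤ j ∧ j < 2 * outerHalf k n ∧
      π.part (discPt k n a b j) = π.part x ∧ IsFirst (fun s => π.part (discPt k n a b s)) j ∧
      label k n (blockSeq π) r 0 x = (a + j) % (2 * outerHalf k n) := by
    intro x hx hgen
    obtain ⟨s, hs0, hs1, rfl⟩ := exists_discPt hk hN a b hx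
    have hso : s < 2 * outerHalf k n := by
      by_contra hcon
      refine (hZ _ hx).2 (hinner _ hx ?_) hgen
      rw [discPt_of_ge (not_lt.1 hcon)]
      exact not_onOuter_innerPt hk hN _
    rw [discPt_of_lt hso] at hgen
    obtain ⟨j, hj0, hjs, hjβ, hjf, hjop⟩ := hop s hs0 hso hgen
    refine ⟨j, hj0, by omega, hjβ, hjf, ?_⟩
    rw [discPt_of_lt hso, c.label_outerPt, outerLabel_of_isOpener hjop]
  -- the labels of the zero block
  have hlab0 : ∀ x ∈ points k n, ¬ IsGeneric π x → label k n (blockSeq π) r 0 x = -1 := by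
    intro x hx hgen
    rcases c.label_cases hx with h1 | h1 | h1
    · exfalso
      -- If a point of the zero-block had an opener v, it would lie among the k * `blockSeq π v`
      -- points labelled v; but the block of v already supplies that many.
      set v := label k n (blockSeq π) r 0 x with hv
      have hvp := outerPt_mem hN v
      have harc : IsArcFirst k n π.part v := by
        by_contra hc
        have := h1.2.2
        rw [blockSeq, if_neg hc] at this
        omega
      have hcardv : (π.part (outerPt (outerHalf k n) v)).card = k * blockSeq π v := by
        rw [blockSeq, if_pos harc, Nat.mul_div_cancel' (dvd_card_part hk hN h.annular hvp)]
      have hvgen : IsGeneric π (outerPt (outerHalf k n) v) := by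
        intro hc
        rw [← outerPt_sub_period hN] at hc
        exact harc _ le_rfl (by omega) hc
      have hlv := c.label_opener h1.2.2
      rw [Int.emod_eq_of_lt h1.1 h1.2.1] at hlv
      obtain ⟨j, hj0, hj1, hjβ, hjf, hjl⟩ := hlab _ hvp hvgen
      have hsub : π.part (outerPt (outerHalf k n) v)
          ⊆ (points k n).filter (fun y => label k n (blockSeq π) r 0 y = v) := by
        intro y hy
        have hyp := π.part_subset _ hy
        have hyβ := part_eq_of_mem_part hvp hy
        have hygen : IsGeneric π y := by
          rw [IsGeneric, part_neg_congr h.neg_mem _ hyp _ hvp hyβ, hyβ]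
          exact hvgen
        obtain ⟨i, hi0, hi1, hiβ, hif, hil⟩ := hlab _ hyp hygen
        have hij : i = j := by
          have heq : π.part (discPt k n a b i) = π.part (discPt k n a b j) := by
            rw [hiβ, hjβ, hyβ]
          rcases lt_trichotomy i j with h | h | h
          · exact absurd heq (hjf i hi0 h)
          · exact h
          · exact absurd heq.symm (hif j hj0 h)
        rw [Finset.mem_filter]
        refine ⟨hyp, ?_⟩
        rw [hil, hij, ← hjl, hlv]
      have heq := Finset.eq_of_subset_of_card_le hsub (by rw [c.card_label h1.1 h1.2.1, hcardv])
      have hxv : x ∈ π.part (outerPt (outerHalf k n) v) := by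
        rw [heq, Finset.mem_filter]
        exact ⟨hx, rfl⟩
      have hxβ := part_eq_of_mem_part hvp hxv
      refine hgen ?_
      rw [IsGeneric, part_neg_congr h.neg_mem _ hx _ hvp hxβ, hxβ]
      exact hvgen
    · exact h1.2
    · omega
  refine eq_kerPart fun x hx y hy => ?_
  have hnn : ∀ j, 0 ≤ j % (2 * outerHalf k n) := fun j => Int.emod_nonneg _ (by omega)
  by_cases hgx : IsGeneric π x
  · obtain ⟨i, hi0, hi1, hiβ, hif, hil⟩ := hlab x hx hgx
    by_cases hgy : IsGeneric π y
    · obtain ⟨j, hj0, hj1, hjβ, hjf, hjl⟩ := hlab y hy hgy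
      rw [hil, hjl]
      constructor
      · intro heq
        have heq : π.part (discPt k n a b i) = π.part (discPt k n a b j) := by
          rw [hiβ, hjβ, heq]
        rcases lt_trichotomy i j with h | h | h
        · exact absurd heq (hjf i hi0 h)
        · rw [h]
        · exact absurd heq.symm (hif j hj0 h)
      · intro heq
        rw [← hiβ, ← hjβ, IsCode.emod_inj hi0 hi1 hj0 hj1 heq]
    · rw [hil, hlab0 y hy hgy]
      have := hnn (a + i)
      refine iff_of_false (fun heq => ?_) (by omega)
      exact (hZ x hx).2 (heq.trans ((hZ y hy).1 hgy)) hgx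
  · rw [hlab0 x hx hgx]
    by_cases hgy : IsGeneric π y
    · obtain ⟨j, hj0, hj1, hjβ, hjf, hjl⟩ := hlab y hy hgy
      rw [hjl]
      have := hnn (a + j)
      refine iff_of_false (fun heq => ?_) (by omega)
      exact (hZ y hy).2 (heq.symm.trans ((hZ x hx).1 hgx)) hgy
    · rw [hlab0 y hy hgy]
      exact iff_of_true (((hZ x hx).1 hgx).trans ((hZ y hy).1 hgy).symm) rfl

end ZeroBlock

end TypeD

/-! ### Partitions without zero-block in which a block meets both circles -/

namespace TypeD

section NoZeroBlock

variable {k n : ℕ} {π : Finpartition (points k n)} {a b : ℤ}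

theorem discWalk_eq_height (hk : 1 ≤ k) (hN : 0 < outerHalf k n)
    (hann : IsAnnularDivisible k n π.parts) (hgood : IsGoodCut k n π.part a b)
    (hgen : ∀ x ∈ points k n, IsGeneric π x) {v : ℤ} (hv0 : 0 ≤ v) (hv : v ≤ 2 * outerHalf k n) :
    discWalk π a b v = height k (blockSeq π) (a + v) - height k (blockSeq π) a := by
  have := discWalk_sub_eq_height hk hN hann hgood le_rfl hv0 hv
    (fun s _ _ => hgen _ (outerPt_mem hN _))
  rwa [discWalk_zero, sub_zero, add_zero] at this

/-- If the drift is not negative, a good cut starts at a record. -/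
theorem isRecord_of_isGoodCut (hk : 1 ≤ k) (hN : 0 < outerHalf k n)
    (hneg : ∀ V ∈ π.parts, negBlock V ∈ π.parts) (hann : IsAnnularDivisible k n π.parts)
    (hgood : IsGoodCut k n π.part a b) (hgen : ∀ x ∈ points k n, IsGeneric π x)
    (hd : 0 ≤ height k (blockSeq π) (outerHalf k n)) :
    IsRecord (height k (blockSeq π)) (height k (blockSeq π) (outerHalf k n)) a := by
  have hlen : 2 * outerHalf k n ≤ discLen k n := by rw [discLen]; omega
  -- The disc walk is not negative, so over one turn from a the height stays at or above H a; other
  -- places differ by whole turns, each adding twice the drift.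
  have key : ∀ j, ∃ q, height k (blockSeq π) a
      + height k (blockSeq π) (outerHalf k n) * (2 * q) ≤ height k (blockSeq π) j ∧
      (a ≤ j → 0 ≤ q) := by
    intro j
    obtain ⟨q, hq, h0, h1⟩ := exists_eq_emod_add_mul (j - a) (b := 2 * outerHalf k n) (by omega)
    have h2 := discWalk_nonneg (π := π) (a := a) (b := b) h0 (by omega)
    rw [discWalk_eq_height hk hN hann hgood hgen h0 h1.le] at h2
    have h3 := walk_add_mul (height_period hN hneg) (a + (j - a) % (2 * outerHalf k n)) (2 * q)
    rw [show a + (j - a) % (2 * outerHalf k n) + outerHalf k n * (2 * q) = j by linarith] at h3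
    refine ⟨q, by linarith, fun haj => ?_⟩
    by_contra hcon
    have : 2 * outerHalf k n * q ≤ 2 * outerHalf k n * (-1) :=
      mul_le_mul_of_nonneg_left (by omega) (by omega)
    linarith
  refine ⟨fun _ j hj => ?_, fun hd' j _ => ?_⟩
  · obtain ⟨q, h1, h2⟩ := key j
    have := mul_nonneg hd (by have := h2 hj; omega : 0 ≤ 2 * q)
    linarith
  · obtain ⟨q, h1, -⟩ := key j
    rw [le_antisymm hd' hd, zero_mul, add_zero] at h1
    exact h1

/-- A cut with a ≡ b has b + H (a + 2N) divisible by k, and since inner positions count modulo 2k,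
only the parity of the quotient matters. -/
theorem exists_cut (hab : a ≡ b [ZMOD k]) (g : ℤ → ℕ) : ∃ e : ℤ, (e = 0 ∨ e = k) ∧
    ∀ s, discPt k n a b s = discPt k n a (e - height k g (a + 2 * outerHalf k n)) s := by
  have h1 := height_modEq (k := k) (g := g) (a + 2 * outerHalf k n)
  rw [Int.modEq_iff_dvd] at hab h1
  have h2 : (k : ℤ) ∣ 2 * outerHalf k n := dvd_outerHalf.mul_left 2
  have h3 : (k : ℤ) ∣ b + height k g (a + 2 * outerHalf k n) :=
    dvd_of_dvd_of_eq ((hab.sub h1).sub h2) (by ring)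
  obtain ⟨w, hw⟩ := h3
  refine ⟨k * (w % 2), ?_, fun s => ?_⟩
  · rcases Int.emod_two_eq_zero_or_one w with h | h <;> simp [h]
  · rw [discPt, discPt]
    split_ifs
    · rfl
    · rw [← innerPt_add_mul _ _ (_ + _) (-(w / 2))]
      congr 1
      have h4 : (k : ℤ) * w = k * (w % 2) + 2 * k * (w / 2) := by
        conv_lhs => rw [← Int.emod_add_mul_ediv w 2]
        ring
      linarith

/-- A block on the inner circle and its opposite cover the inner circle. -/
theorem mem_inner_block (hk : 1 ≤ k) (hN : 0 < outerHalf k n) (h : IsNCD k n π) {u : ℤ}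
    (hu : u ∈ points k n) (hgen : IsGeneric π u) (hin : IsInnerBlock k n (π.part u)) {z : ℤ}
    (hz : z ∈ points k n) (hzi : ¬ OnOuter k n z) : π.part z = π.part u ∨ π.part z = π.part (-u) := by
  classical
  have hdisj : Disjoint (π.part u) (π.part (-u)) := by
    rw [Finset.disjoint_left]
    intro y hy hy'
    exact hgen ((part_eq_of_mem_part (neg_mem_points hu) hy').symm.trans
      (part_eq_of_mem_part hu hy))
  -- Both blocks are disjoint, non-empty and of size divisible by k, and there are only 2k inner
  -- points.
  have hcard : k ≤ (π.part u).card := Nat.le_of_dvd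
    (Finset.card_pos.2 ⟨u, π.mem_part hu⟩) (dvd_card_part hk hN h.annular hu)
  have hsub : π.part u ∪ π.part (-u) ⊆ (points k n).filter (fun x => ¬ OnOuter k n x) := by
    intro y hy
    rw [Finset.mem_filter]
    rcases Finset.mem_union.1 hy with hy | hy
    · exact ⟨π.part_subset _ hy, hin y hy⟩
    · refine ⟨π.part_subset _ hy, fun hyo => ?_⟩
      rw [part_neg h.neg_mem hu, mem_negBlock] at hy
      exact hin _ hy (onOuter_neg.2 hyo)
  have heq := Finset.eq_of_subset_of_card_le hsub (by
    rw [card_inner hk hN, Finset.card_union_of_disjoint hdisj, part_neg h.neg_mem hu,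
      card_negBlock]
    omega)
  have : z ∈ π.part u ∪ π.part (-u) := by
    rw [heq, Finset.mem_filter]; exact ⟨hz, hzi⟩
  rcases Finset.mem_union.1 this with h1 | h1
  · exact Or.inl (part_eq_of_mem_part hu h1)
  · exact Or.inr (part_eq_of_mem_part (neg_mem_points hu) h1)

theorem eq_of_isFirst {γ : Type*} {β : ℤ → γ} {i j : ℤ} (hi0 : 0 ≤ i) (hj0 : 0 ≤ j)
    (hi : IsFirst β i) (hj : IsFirst β j) (h : β i = β j) : i = j := by
  rcases lt_trichotomy i j with h' | h' | h'
  · exact absurd h (hj i hi0 h')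
  · exact h'
  · exact absurd h.symm (hi j hj0 h')

/-- A partition without zero block but with a block that meets both circles is determined by its
code up to half a turn of the inner circle. -/
theorem eq_kerPart_of_traversing (hk : 1 ≤ k) (hN : 0 < outerHalf k n) (h : IsNCD k n π)
    (hgen : ∀ x ∈ points k n, IsGeneric π x) {x y : ℤ} (hx : x ∈ points k n) (hy : y ∈ points k n)
    (hxo : OnOuter k n x) (hyi : ¬ OnOuter k n y) (hxy : π.part x = π.part y) :
    height k (blockSeq π) (outerHalf k n) = k ∧
    ∀ r, IsRecord (height k (blockSeq π)) (height k (blockSeq π) (outerHalf k n)) r →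
      π = kerPart k n (label k n (blockSeq π) r 0) ∨
      π = kerPart k n (label k n (blockSeq π) r k) := by
  classical
  obtain ⟨a, b, hnc, hcong⟩ := h.annular
  have hpnc := part_placeNC hk hN hnc
  have hgood : IsGoodCut k n π.part a b :=
    isGoodCut hk hN (part_neg_congr h.neg_mem) hpnc hx hy hxo hyi hxy
  have hab : a ≡ b [ZMOD k] := by
    refine modEq_of_traversing hk hN hpnc (fun z hz => ?_) hx hy hxo hyi hxy ?_
    · rw [fiber_part hz]; exact dvd_card_part hk hN h.annular hz
    · rw [fiber_part hx]; exact hcong _ (π.part_mem.2 hx)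
  have hlen : discLen k n = 2 * outerHalf k n + 2 * k := rfl
  -- every block meets the outer circle
  have hfo : ∀ s, 0 ≤ s → s < discLen k n → ∃ j, 0 ≤ j ∧ j ≤ s ∧ j < 2 * outerHalf k n ∧
      π.part (discPt k n a b j) = π.part (discPt k n a b s) ∧
      IsFirst (fun s => π.part (discPt k n a b s)) j := by
    intro s hs0 hs
    obtain ⟨j, hj0, hjs, hjβ, hjf⟩ := exists_isFirst (fun s => π.part (discPt k n a b s)) hs0
    refine ⟨j, hj0, hjs, ?_, hjβ, hjf⟩
    by_contra hcon
    have hjp := discPt_mem hk hN a b j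
    have hin : IsInnerBlock k n (π.part (discPt k n a b j)) := by
      intro w hw hwo
      have hwp := π.part_subset _ hw
      have h1 := cutPos_nonneg_lt hk hN a b w
      have h2 := h1.2.2.1 hwo
      refine hjf _ h1.1 (by omega) ?_
      simp only
      rw [discPt_cutPos hk hN a b hwp]
      exact part_eq_of_mem_part hjp hw
    -- A block inside the inner circle would, with its opposite, cover it, leaving no inner point
    -- for the block of x and y.
    rcases mem_inner_block hk hN h hjp (hgen _ hjp) hin hy hyi with h1 | h1
    · refine hin x ?_ hxo
      rw [← h1, ← hxy]
      exact π.mem_part hx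
    · refine hin (-x) ?_ (onOuter_neg.2 hxo)
      rw [← neg_neg (discPt k n a b j)]
      rw [← part_neg_congr h.neg_mem _ hx _ (neg_mem_points hjp) (hxy.trans h1)]
      exact π.mem_part (neg_mem_points hx)
  -- the walk in the disc
  have htail : ∀ v, 2 * outerHalf k n ≤ v → v ≤ discLen k n →
      discWalk π a b v = discWalk π a b (2 * outerHalf k n) - (v - 2 * outerHalf k n) := by
    intro v hv
    induction v, hv using Int.leInduction with
    | base => simp
    | succ v hv ih =>
      intro hv2
      have hnf : ¬ IsFirst (fun s => π.part (discPt k n a b s)) v := by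
        intro hf
        obtain ⟨j, hj0, hjs, hj1, hjβ, hjf⟩ := hfo v (by omega) (by omega)
        exact hf j hj0 (by omega) hjβ
      have h1 := ih (by omega)
      rw [discWalk] at h1 ⊢
      rw [walk_succ, h1, firstSize, if_neg hnf]
      push_cast
      ring
  have hend : discWalk π a b (discLen k n) = 0 := by
    have h1 := discWalk_sub (π := π) (a := a) (b := b) (u := 0) (v := discLen k n) (by omega)
    have h2 := sum_firstSize (β := fun s => π.part (discPt k n a b s)) (m := discLen k n) (u := 0)
      (v := discLen k n) le_rfl
    rw [Finset.filter_true_of_mem, Int.card_Ico] at h2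
    · rw [discWalk_zero] at h1
      have h3 : ((∑ x ∈ Finset.Ico 0 (discLen k n),
        firstSize (fun s => π.part (discPt k n a b s)) (discLen k n) x : ℕ) : ℤ)
        = discLen k n := by omega
      push_cast at h3
      linarith
    · intro s hs
      rw [Finset.mem_Ico] at hs
      obtain ⟨j, hj0, hjs, hj1, hjβ, hjf⟩ := hfo s hs.1 hs.2
      exact ⟨j, hj0, by omega, hjf, hjβ.symm⟩
  have h2N := discWalk_eq_height hk hN h.annular hgood hgen (v := 2 * outerHalf k n) (by omega)
    le_rfl
  -- The disc walk goes down at each of the 2k inner places and ends at 0, so it is 2k after the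
  -- outer circle; this is twice the drift.
  have hd : height k (blockSeq π) (outerHalf k n) = k := by
    have h1 := htail (discLen k n) (by omega) le_rfl
    have h3 := height_two hN h.neg_mem a
    omega
  refine ⟨hd, fun r hr => ?_⟩
  have ha := isRecord_of_isGoodCut hk hN h.neg_mem h.annular hgood hgen (by omega)
  obtain ⟨e, he, hcut⟩ := exists_cut (n := n) hab (blockSeq π)
  have hdvd : (k : ℤ) ∣ e := by
    rcases he with rfl | rfl
    · exact dvd_zero _
    · exact dvd_refl _
  have c : IsCode k n (blockSeq π) r e :=
    ⟨hk, hN, blockSeq_add hN h.neg_mem, Or.inr hd, hr, hdvd⟩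
  have hK : ∀ v, 0 ≤ v → v ≤ discLen k n →
      IsCode.discHeight (outerHalf k n) (height k (blockSeq π)) a v
        = discWalk π a b v + height k (blockSeq π) a := by
    intro v hv0 hv
    rcases le_total v (2 * outerHalf k n) with h1 | h1
    · rw [IsCode.discHeight_of_le h1, discWalk_eq_height hk hN h.annular hgood hgen hv0 h1]
      ring
    · rw [IsCode.discHeight_of_ge h1, htail v h1 hv, h2N]
      ring
  have hlab : ∀ s, 0 ≤ s → s < discLen k n → ∃ j, 0 ≤ j ∧ j < 2 * outerHalf k n ∧
      π.part (discPt k n a b j) = π.part (discPt k n a b s) ∧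
      IsFirst (fun s => π.part (discPt k n a b s)) j ∧
      label k n (blockSeq π) r e (discPt k n a b s) = (a + j) % (2 * outerHalf k n) := by
    intro s hs0 hs
    obtain ⟨j, hj0, hjs, hj1, hjβ, hjf⟩ := hfo s hs0 hs
    refine ⟨j, hj0, hj1, hjβ, hjf, ?_⟩
    have hop := isOpener_discWalk hk hN hnc hj0 hjs hs hjβ hjf
    have hop' : IsOpener (IsCode.discHeight (outerHalf k n) (height k (blockSeq π)) a) j s := by
      refine ⟨hjs, ?_, fun i hi his => ?_⟩
      · rw [hK j hj0 (by omega), hK (s + 1) (by omega) (by omega)]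
        have := hop.2.1
        omega
      · rw [hK i (by omega) (by omega), hK (s + 1) (by omega) (by omega)]
        have := hop.2.2 i hi his
        omega
    rw [hcut]
    rcases c.label_discPt ha hs0 hs with ⟨l, hl0, hl1, hl2, hl3⟩ | ⟨hl2, -⟩
    · rw [hl3, hl2.unique hop']
    · exact absurd hop' (hl2 j hj0)
  have hmain : π = kerPart k n (label k n (blockSeq π) r e) := by
    refine eq_kerPart fun x hx y hy => ?_
    obtain ⟨s, hs0, hs, rfl⟩ := exists_discPt hk hN a b hx
    obtain ⟨t, ht0, ht, rfl⟩ := exists_discPt hk hN a b hy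
    obtain ⟨i, hi0, hi1, hiβ, hif, hil⟩ := hlab s hs0 hs
    obtain ⟨j, hj0, hj1, hjβ, hjf, hjl⟩ := hlab t ht0 ht
    rw [hil, hjl, ← hiβ, ← hjβ]
    constructor
    · intro heq
      rw [eq_of_isFirst hi0 hj0 hif hjf heq]
    · intro heq
      rw [IsCode.emod_inj hi0 hi1 hj0 hj1 heq]
  rcases he with rfl | rfl
  · exact Or.inl hmain
  · exact Or.inr hmain

end NoZeroBlock

end TypeD

/-! ### Existence of a visible block; merging blocks -/

namespace TypeD

section Separated

variable {k n : ℕ} {π : Finpartition (points k n)} {a b : ℤ}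

/-- A block with two points at maximal distance is visible. -/
theorem exists_isVisible (hk : 1 ≤ k) (hN : 0 < outerHalf k n)
    (hneg : ∀ V ∈ π.parts, negBlock V ∈ π.parts) (hann : IsAnnularDivisible k n π.parts)
    (hgen : ∀ x ∈ points k n, IsGeneric π x)
    (hsep : ∀ V ∈ π.parts, IsOuterBlock k n V ∨ IsInnerBlock k n V) :
    ∃ v ∈ points k n, OnOuter k n v ∧ IsVisible k n π.parts (π.part v) := by
  obtain ⟨a, b, hnc, -⟩ := hann
  have hpnc := part_placeNC hk hN hnc
  obtain ⟨δ, ⟨hδ0, hδN, e, heq⟩, hmax⟩ := Int.exists_greatest_of_bdd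
    (P := fun δ => 0 ≤ δ ∧ δ < outerHalf k n ∧
      ∃ e, π.part (outerPt (outerHalf k n) e) = π.part (outerPt (outerHalf k n) (e + δ)))
    ⟨outerHalf k n, fun z hz => hz.2.1.le⟩ ⟨0, le_rfl, hN, 0, by rw [add_zero]⟩
  have hep := outerPt_mem hN e
  refine ⟨_, hep, onOuter_outerPt hN e, π.part_mem.2 hep, ?_, ?_⟩
  · rcases hsep _ (π.part_mem.2 hep) with h | h
    · exact h
    · exact absurd (onOuter_outerPt hN e) (h _ (π.mem_part hep))
  rintro ⟨W, hW, hWo, hWV, hWV', w, hw, w', hw', v, hv, hcyc⟩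
  have hwp := π.le hW hw
  have hwp' := π.le hW hw'
  have hvp := π.part_subset _ hv
  have hvV := part_eq_of_mem_part hep hv
  have hvo : OnOuter k n v := by
    rcases hsep _ (π.part_mem.2 hep) with h | h
    · exact h _ hv
    · exact absurd (onOuter_outerPt hN e) (h _ (π.mem_part hep))
  have hwW : π.part w = W := π.part_eq_of_mem hW hw
  have hwW' : π.part w' = W := π.part_eq_of_mem hW hw'
  rw [← part_neg hneg hep] at hWV'
  -- a short arc between points of the separating block around a point of the pair of blocks
  suffices ∃ α β γ ε : ℤ, α < γ ∧ γ < β ∧ β - α < outerHalf k n ∧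
      π.part (outerPt (outerHalf k n) α) = W ∧ π.part (outerPt (outerHalf k n) β) = W ∧
      π.part (outerPt (outerHalf k n) γ) ≠ W ∧
      π.part (outerPt (outerHalf k n) ε) = π.part (outerPt (outerHalf k n) γ) ∧
      π.part (outerPt (outerHalf k n) (ε + δ)) = π.part (outerPt (outerHalf k n) γ) by
    obtain ⟨α, β, γ, ε, h1, h2, h3, hα, hβ, hγ, hε, hε'⟩ := this
    -- The block of γ is trapped under the arc from α to β of W. It contains two points at distance
    -- δ, so β - α > δ, against the maximality of δ.
    have key : ∀ i, α ≤ i → i < α + 2 * outerHalf k n →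
        π.part (outerPt (outerHalf k n) i) = π.part (outerPt (outerHalf k n) γ) →
        α < i ∧ i < β := by
      intro i hi1 hi2 hi
      constructor
      · rcases hi1.eq_or_lt with rfl | h
        · exact absurd (hi.symm.trans hα) hγ
        · exact h
      · by_contra hcon
        rcases (not_lt.1 hcon).eq_or_lt with rfl | h
        · exact hγ (hi.symm.trans hβ)
        · have := eq_of_circle_crossing hk hN hpnc h1 h2 h hi2 (hα.trans hβ.symm) hi.symm
          exact hγ (this.symm.trans hα)
    obtain ⟨q, hq, h4, h5⟩ := exists_eq_emod_add_mul (ε - α) (b := 2 * outerHalf k n) (by omega)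
    have h6 := key (α + (ε - α) % (2 * outerHalf k n)) (by omega) (by omega) (by
      rw [← outerPt_add_mul _ _ q, add_assoc, ← hq, add_sub_cancel]
      exact hε)
    have h7 := key (α + (ε - α) % (2 * outerHalf k n) + δ) (by omega) (by omega) (by
      rw [← outerPt_add_mul _ _ q,
        show α + (ε - α) % (2 * outerHalf k n) + δ + 2 * outerHalf k n * q = ε + δ by linarith]
      exact hε')
    have h8 := hmax (β - α) ⟨by omega, h3, α, by rw [hα, add_sub_cancel, hβ]⟩
    omega
  have hnegV : ∀ x, π.part (outerPt (outerHalf k n) x) = π.part (outerPt (outerHalf k n) e) →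
      π.part (outerPt (outerHalf k n) (x + outerHalf k n))
        = π.part (-outerPt (outerHalf k n) e) := by
    intro x hx
    rw [outerPt_add_period hN]
    exact part_neg_congr hneg _ (outerPt_mem hN _) _ hep hx
  rw [← outerPt_outerPos hwp (hWo w hw), ← outerPt_outerPos hwp' (hWo w' hw'),
    ← outerPt_outerPos hvp hvo, ← outerPt_add_period hN, outerCyclic_outerPt_iff hN] at hcyc
  obtain ⟨q1, hq1, h10, h11⟩ := exists_eq_emod_add_mul (outerPos k n v - outerPos k n w)
    (b := 2 * outerHalf k n) (by omega)
  obtain ⟨q2, hq2, h20, h21⟩ := exists_eq_emod_add_mul (outerPos k n w' - outerPos k n w)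
    (b := 2 * outerHalf k n) (by omega)
  rw [show outerPos k n v + outerHalf k n - outerPos k n w
    = (outerPos k n v - outerPos k n w) + outerHalf k n by ring, add_emod_two_mul hN] at hcyc
  set γ := (outerPos k n v - outerPos k n w) % (2 * outerHalf k n)
  set β := (outerPos k n w' - outerPos k n w) % (2 * outerHalf k n)
  have hcyc' : 0 < γ ∧ γ < β ∧ β < γ + outerHalf k n ∧ γ < outerHalf k n := by
    split_ifs at hcyc <;> omega
  set α := outerPos k n w
  have hα : π.part (outerPt (outerHalf k n) α) = W := by
    rw [outerPt_outerPos hwp (hWo w hw), hwW]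
  have hβ : π.part (outerPt (outerHalf k n) (α + β)) = W := by
    rw [← outerPt_add_mul _ _ q2, add_assoc, ← hq2, add_sub_cancel,
      outerPt_outerPos hwp' (hWo w' hw'), hwW']
  have hγ : π.part (outerPt (outerHalf k n) (α + γ)) = π.part (outerPt (outerHalf k n) e) := by
    rw [← outerPt_add_mul _ _ q1, add_assoc, ← hq1, add_sub_cancel, outerPt_outerPos hvp hvo, hvV]
  -- If the arc from w to w' is shorter than N, it encloses v. If it is longer, the complementary
  -- arc is shorter and encloses -v. It cannot be exactly N, since no block is its own opposite.
  rcases lt_trichotomy β (outerHalf k n) with h | h | h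
  · refine ⟨α, α + β, α + γ, e, by omega, by omega, by omega, hα, hβ, ?_, hγ.symm, ?_⟩
    · rw [hγ]; exact hWV.symm
    · rw [hγ, heq]
  · exfalso
    rw [h, outerPt_add_period hN] at hβ
    exact hgen _ (outerPt_mem hN _) (hβ.trans hα.symm)
  · refine ⟨α + β, α + 2 * outerHalf k n * 1, α + γ + outerHalf k n, e + outerHalf k n, by omega,
      by omega, by omega, hβ, ?_, ?_, ?_, ?_⟩
    · rw [outerPt_add_mul, hα]
    · rw [hnegV _ hγ]; exact hWV'.symm
    · rw [hnegV _ hγ, hnegV _ rfl]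
    · rw [hnegV _ hγ, add_right_comm, hnegV _ heq.symm]

/-- Labels for the partition in which the blocks of `u` and `v` are joined, as well as the blocks
of `-u` and `-v`. -/
noncomputable def mergeLabel (π : Finpartition (points k n)) (u v x : ℤ) : Finset ℤ :=
  if π.part x = π.part u then π.part v
  else if π.part x = π.part (-u) then π.part (-v) else π.part x

theorem part_neg_inj (hneg : ∀ V ∈ π.parts, negBlock V ∈ π.parts) {x y : ℤ}
    (hx : x ∈ points k n) (hy : y ∈ points k n) :
    π.part (-x) = π.part (-y) ↔ π.part x = π.part y := by
  refine ⟨fun h => ?_, part_neg_congr hneg x hx y hy⟩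
  have := part_neg_congr hneg _ (neg_mem_points hx) _ (neg_mem_points hy) h
  rwa [neg_neg, neg_neg] at this

theorem mergeLabel_neg (hneg : ∀ V ∈ π.parts, negBlock V ∈ π.parts) {u v x : ℤ}
    (hu : u ∈ points k n) (hv : v ∈ points k n) (hx : x ∈ points k n) (hgen : IsGeneric π u) :
    mergeLabel π u v (-x) = negBlock (mergeLabel π u v x) := by
  have h1 := part_neg_inj hneg hx hu
  have h2 := part_neg_inj hneg hx (neg_mem_points hu)
  rw [neg_neg] at h2
  have h3 := part_neg hneg (neg_mem_points hv)
  rw [neg_neg] at h3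
  unfold mergeLabel
  simp only [h1, h2]
  by_cases ha : π.part x = π.part u
  · rw [if_neg (fun hb => hgen (hb.symm.trans ha)), if_pos ha, if_pos ha, part_neg hneg hv]
  · rw [if_neg ha, if_neg ha]
    split_ifs
    · exact h3
    · exact part_neg hneg hx

/-- The blocks of u, -u, v, -v are four different blocks, so merging u with v and -u with -v does
not merge anything else. -/
theorem fiber_mergeLabel_mem_join (hneg : ∀ V ∈ π.parts, negBlock V ∈ π.parts) {u v x : ℤ}
    (hu : u ∈ points k n) (hv : v ∈ points k n) (hx : x ∈ points k n) (hgu : IsGeneric π u)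
    (hgv : IsGeneric π v) (huv : π.part u ≠ π.part v) (huv' : π.part u ≠ π.part (-v)) :
    fiber k n (mergeLabel π u v) x ∈ join π.parts (π.part u) (π.part v) := by
  have hF : ∀ y z, y ∈ points k n → (z ∈ π.part y ↔ z ∈ points k n ∧ π.part z = π.part y) := by
    intro y z hy
    constructor
    · intro h
      exact ⟨π.part_subset _ h, part_eq_of_mem_part hy h⟩
    · rintro ⟨h1, h2⟩
      rw [← h2]; exact π.mem_part h1
  have hun := neg_mem_points hu
  have hvn := neg_mem_points hv
  have huv'' : π.part (-u) ≠ π.part v := by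
    intro h
    have := part_neg_congr hneg _ hun _ hv h
    rw [neg_neg] at this
    exact huv' this
  have huv3 : π.part (-u) ≠ π.part (-v) := fun h => huv ((part_neg_inj hneg hu hv).1 h)
  rw [join, negBlock_union, ← part_neg hneg hu, ← part_neg hneg hv]
  simp only [Finset.mem_union, Finset.mem_sdiff, Finset.mem_insert, Finset.mem_singleton, not_or]
  by_cases h1 : π.part x = π.part u ∨ π.part x = π.part v
  · right; left
    ext z
    rw [mem_fiber, Finset.mem_union, hF u z hu, hF v z hv, ← and_or_left, and_congr_right_iff]
    intro hz
    have : mergeLabel π u v x = π.part v := by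
      rcases h1 with h | h
      · rw [mergeLabel, if_pos h]
      · rw [mergeLabel, h, if_neg huv.symm, if_neg huv''.symm]
    rw [this, mergeLabel]
    split_ifs with h2 h3
    · exact iff_of_true rfl (Or.inl h2)
    · rw [h3]
      exact iff_of_false hgv.symm (fun h => h.elim hgu huv'')
    · simp only [h2, false_or, eq_comm]
  · by_cases h2 : π.part x = π.part (-u) ∨ π.part x = π.part (-v)
    · right; right
      ext z
      rw [mem_fiber, Finset.mem_union, hF _ z hun, hF _ z hvn, ← and_or_left, and_congr_right_iff]
      intro hz
      have : mergeLabel π u v x = π.part (-v) := by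
        rcases h2 with h | h
        · rw [mergeLabel, h, if_neg hgu, if_pos rfl]
        · rw [mergeLabel, h, if_neg huv'.symm, if_neg huv3.symm]
      rw [this, mergeLabel]
      split_ifs with h2 h3
      · rw [h2]
        exact iff_of_false hgv (fun h => h.elim hgu.symm huv')
      · exact iff_of_true rfl (Or.inl h3)
      · simp only [h3, false_or, eq_comm]
    · push Not at h1 h2
      left
      have : fiber k n (mergeLabel π u v) x = π.part x := by
        ext z
        rw [mem_fiber, hF x z hx, and_congr_right_iff]
        intro hz
        rw [mergeLabel, if_neg h1.1, if_neg h2.1, mergeLabel]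
        split_ifs with h3 h4
        · rw [h3]
          exact iff_of_false h1.2 h1.1.symm
        · rw [h4]
          exact iff_of_false h2.2 h2.1.symm
        · exact eq_comm
      rw [this]
      exact ⟨π.part_mem.2 hx, h1.1, h1.2, h2.1, h2.2⟩

end Separated

end TypeD

/-! ### Partitions in which no block meets both circles, and the summary of all cases -/

namespace TypeD

section Separated

variable {k n : ℕ} {π : Finpartition (points k n)} {a b : ℤ}

/-- A partition without a block that meets both circles is determined by its code. -/
theorem eq_kerPart_of_separated (hk : 1 ≤ k) (hN : 0 < outerHalf k n) (h : IsNCD k n π)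
    (hgen : ∀ x ∈ points k n, IsGeneric π x)
    (hsep : ∀ V ∈ π.parts, IsOuterBlock k n V ∨ IsInnerBlock k n V) :
    height k (blockSeq π) (outerHalf k n) = 0 ∧
    ∀ r, IsRecord (height k (blockSeq π)) (height k (blockSeq π) (outerHalf k n)) r →
      π = kerPart k n (label k n (blockSeq π) r 0) := by
  classical
  obtain ⟨v, hv, hvo, hvis⟩ := exists_isVisible hk hN h.neg_mem h.annular hgen hsep
  set u := innerPt (outerHalf k n) k 0
  have hu : u ∈ points k n := innerPt_mem hk hN 0
  have hui : ¬ OnOuter k n u := not_onOuter_innerPt hk hN 0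
  have hout : ∀ x ∈ points k n, OnOuter k n x → IsOuterBlock k n (π.part x) := by
    intro x hx hxo
    rcases hsep _ (π.part_mem.2 hx) with h1 | h1
    · exact h1
    · exact absurd hxo (h1 _ (π.mem_part hx))
  have hin : ∀ x ∈ points k n, ¬ OnOuter k n x → IsInnerBlock k n (π.part x) := by
    intro x hx hxo
    rcases hsep _ (π.part_mem.2 hx) with h1 | h1
    · exact absurd (h1 _ (π.mem_part hx)) hxo
    · exact h1
  have hne : ∀ x ∈ points k n, ∀ y ∈ points k n, OnOuter k n x → ¬ OnOuter k n y →
      π.part x ≠ π.part y := by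
    intro x hx y hy hxo hyi hxy
    exact hin y hy hyi x (hxy ▸ π.mem_part hx) hxo
  have hun := neg_mem_points hu
  have hvn := neg_mem_points hv
  have huni : ¬ OnOuter k n (-u) := fun hc => hui (onOuter_neg.1 hc)
  have hvno : OnOuter k n (-v) := onOuter_neg.2 hvo
  set β := mergeLabel π u v with hβdef
  have hβo : ∀ x ∈ points k n, OnOuter k n x → β x = π.part x := by
    intro x hx hxo
    rw [hβdef, mergeLabel, if_neg (hne x hx u hu hxo hui), if_neg (hne x hx _ hun hxo huni)]
  have hβi : ∀ x ∈ points k n, ¬ OnOuter k n x →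
      π.part x = π.part u ∧ β x = π.part v ∨ π.part x = π.part (-u) ∧ β x = π.part (-v) := by
    intro x hx hxi
    rcases mem_inner_block hk hN h hu (hgen u hu) (hin u hu hui) hx hxi with h1 | h1
    · exact Or.inl ⟨h1, by rw [hβdef, mergeLabel, if_pos h1]⟩
    · refine Or.inr ⟨h1, ?_⟩
      rw [hβdef, mergeLabel, if_neg (fun h2 => hgen u hu (h1.symm.trans h2)), if_pos h1]
  have hgu := hgen u hu
  have hgv := hgen v hv
  have hsymm : ∀ x ∈ points k n, ∀ y ∈ points k n, β x = β y → β (-x) = β (-y) := by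
    intro x hx y hy hxy
    rw [hβdef, mergeLabel_neg h.neg_mem hu hv hx hgu, mergeLabel_neg h.neg_mem hu hv hy hgu]
    exact congrArg negBlock hxy
  have hfib : ∀ x ∈ points k n, fiber k n β x ∈ join π.parts (π.part u) (π.part v) := fun x hx =>
    fiber_mergeLabel_mem_join h.neg_mem hu hv hx hgu hgv (hne v hv u hu hvo hui).symm
      (hne _ hvn u hu hvno hui).symm
  -- The joined partition has a block meeting both circles, so its cut is good and satisfies a ≡ b.
  -- The cut is then used for the original partition, which has the same blocks on the outer circle.
  obtain ⟨a, b, hnc, hcong⟩ := h.inner_visible hsep _ (π.part_mem.2 hu) (hin u hu hui) _ hvis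
  have hpnc : PlaceNC (fun s => β (discPt k n a b s)) (discLen k n) :=
    placeNC_of_nonCrossing hk hN hfib hnc
  have hβvu : β v = β u := by
    rw [hβo v hv hvo, hβdef, mergeLabel, if_pos rfl]
  have hab : a ≡ b [ZMOD k] := by
    refine modEq_of_traversing hk hN hpnc (fun z hz => ?_) hv hu hvo hui hβvu (hcong _ (hfib v hv))
    refine dvd_card_of_congruence (p := cutPos k n a b) ?_ (hcong _ (hfib z hz))
    intro x hx y hy hxy
    exact cutPos_injOn hk hN a b (mem_fiber.1 hx).1 (mem_fiber.1 hy).1 hxy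
  have hgoodβ : IsGoodCut k n β a b := isGoodCut hk hN hsymm hpnc hv hu hvo hui hβvu
  have hlen : discLen k n = 2 * outerHalf k n + 2 * k := rfl
  have hO : ∀ p, β (outerPt (outerHalf k n) p) = π.part (outerPt (outerHalf k n) p) := fun p =>
    hβo _ (outerPt_mem hN p) (onOuter_outerPt hN p)
  have hD : ∀ s, s < 2 * outerHalf k n → β (discPt k n a b s) = π.part (discPt k n a b s) := by
    intro s hs
    rw [discPt_of_lt hs, hO]
  have hDo : ∀ s, s < 2 * outerHalf k n → OnOuter k n (discPt k n a b s) := by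
    intro s hs
    rw [discPt_of_lt hs]; exact onOuter_outerPt hN _
  have hDi : ∀ s, 2 * outerHalf k n ≤ s → ¬ OnOuter k n (discPt k n a b s) := by
    intro s hs
    rw [discPt_of_ge hs]; exact not_onOuter_innerPt hk hN _
  have hDp := discPt_mem hk hN a b
  have hDne : ∀ s t, s < 2 * outerHalf k n → 2 * outerHalf k n ≤ t →
      π.part (discPt k n a b s) ≠ π.part (discPt k n a b t) := fun s t hs ht =>
    hne _ (hDp s) _ (hDp t) (hDo s hs) (hDi t ht)
  have hgood : IsGoodCut k n π.part a b := by
    intro s hs0 hs hneq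
    have h1 := hgoodβ s hs0 hs (by
      rw [← outerPt_sub_period hN, hO, hO, outerPt_sub_period hN]; exact hneq)
    have h2 : IsFirst (fun s => β (discPt k n a b s)) s ↔
        IsFirst (fun s => π.part (discPt k n a b s)) s := by
      refine forall_congr' fun i => forall_congr' fun _ => forall_congr' fun hi => ?_
      simp only [hD s hs, hD i (hi.trans hs)]
    have h3 : IsArcFirst k n β (a + s) ↔ IsArcFirst k n π.part (a + s) := by
      unfold IsArcFirst
      simp only [hO]
    rw [← h2, h1, h3]
  -- the inner circle
  have hplace : ∀ x ∈ points k n, OnOuter k n x → ∃ p, 0 ≤ p ∧ p < 2 * outerHalf k n ∧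
      β (discPt k n a b p) = π.part x := by
    intro x hx hxo
    have h1 := cutPos_nonneg_lt hk hN a b x
    exact ⟨_, h1.1, h1.2.2.1 hxo, by rw [discPt_cutPos hk hN a b hx, hβo x hx hxo]⟩
  obtain ⟨p1, hp10, hp11, hp1⟩ := hplace v hv hvo
  obtain ⟨p2, hp20, hp21, hp2⟩ := hplace _ hvn hvno
  -- If the inner block changed twice, the places x and z would enclose y of the opposite block; but
  -- y is joined to an outer place before x, which would be a crossing.
  have hmono : ∀ x y z, 2 * outerHalf k n ≤ x → x < y → y < z → z < discLen k n →
      π.part (discPt k n a b x) ≠ π.part (discPt k n a b y) →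
      π.part (discPt k n a b y) = π.part (discPt k n a b z) := by
    intro x y z hx hxy hyz hz hxy'
    rcases hβi _ (hDp x) (hDi x hx) with ⟨hx1, hx2⟩ | ⟨hx1, hx2⟩ <;>
    rcases hβi _ (hDp y) (hDi y (by omega)) with ⟨hy1, hy2⟩ | ⟨hy1, hy2⟩ <;>
    rcases hβi _ (hDp z) (hDi z (by omega)) with ⟨hz1, hz2⟩ | ⟨hz1, hz2⟩
    · exact hy1.trans hz1.symm
    · exact absurd (hx1.trans hy1.symm) hxy'
    · have := hpnc p2 x y z hp20 (by omega) hxy hyz hz (hp2.trans hy2.symm) (hx2.trans hz2.symm)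
      exact absurd (hp2.symm.trans (this.trans hx2)) hgv
    · exact hy1.trans hz1.symm
    · exact hy1.trans hz1.symm
    · have := hpnc p1 x y z hp10 (by omega) hxy hyz hz (hp1.trans hy2.symm) (hx2.trans hz2.symm)
      exact absurd (hp1.symm.trans (this.trans hx2)).symm hgv
    · exact absurd (hx1.trans hy1.symm) hxy'
    · exact hy1.trans hz1.symm
  have hanti : ∀ s, 2 * outerHalf k n ≤ s →
      discPt k n a b (s + k) = -discPt k n a b s := by
    intro s hs
    rw [discPt_of_ge hs, discPt_of_ge (by omega), ← innerPt_add_period (by omega)]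
    congr 1
    ring
  have hstart := hDp (2 * outerHalf k n)
  -- The first inner place and the one k later are opposite, so the only change of block has
  -- happened by then; by symmetry it happens exactly there.
  have hlow : ∀ s, 2 * outerHalf k n + k ≤ s → s < discLen k n → π.part (discPt k n a b s)
      = π.part (-discPt k n a b (2 * outerHalf k n)) := by
    intro s hs hsm
    rw [← hanti _ le_rfl]
    rcases hs.eq_or_lt with h1 | h1
    · rw [h1]
    · refine (hmono _ _ _ le_rfl (by omega) h1 hsm ?_).symm
      rw [hanti _ le_rfl]
      exact (hgen _ hstart).symm
  have hhigh : ∀ s, 2 * outerHalf k n ≤ s → s < 2 * outerHalf k n + k →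
      π.part (discPt k n a b s) = π.part (discPt k n a b (2 * outerHalf k n)) := by
    intro s hs hsm
    have h1 := hlow (s + k) (by omega) (by omega)
    rw [hanti s hs] at h1
    exact (part_neg_inj h.neg_mem (hDp s) hstart).1 h1
  have hppnc : NonCrossing π.parts (cutPos k n a b) := by
    intro V hV W hW hVW x hx z hz y hy w hw hlt
    have hxp := π.le hV hx
    have hyp := π.le hW hy
    have hzp := π.le hV hz
    have hwp := π.le hW hw
    have hpx := π.part_eq_of_mem hV hx
    have hpy := π.part_eq_of_mem hW hy
    have hpz := π.part_eq_of_mem hV hz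
    have hpw := π.part_eq_of_mem hW hw
    have cx := cutPos_nonneg_lt hk hN a b x
    have cw := cutPos_nonneg_lt hk hN a b w
    rw [← discPt_cutPos hk hN a b hxp] at hpx
    rw [← discPt_cutPos hk hN a b hyp] at hpy
    rw [← discPt_cutPos hk hN a b hzp] at hpz
    rw [← discPt_cutPos hk hN a b hwp] at hpw
    generalize cutPos k n a b x = x' at *
    generalize cutPos k n a b y = y' at *
    generalize cutPos k n a b z = z' at *
    generalize cutPos k n a b w = w' at *
    have hxy : π.part (discPt k n a b x') ≠ π.part (discPt k n a b y') := by
      rw [hpx, hpy]; exact hVW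
    rcases lt_or_ge x' (2 * outerHalf k n) with hxo | hxo
    · have hzo : z' < 2 * outerHalf k n := by
        by_contra hc
        exact hDne x' z' hxo (not_lt.1 hc) (hpx.trans hpz.symm)
      have hwo : w' < 2 * outerHalf k n := by
        by_contra hc
        exact hDne y' w' (by omega) (not_lt.1 hc) (hpy.trans hpw.symm)
      have := hpnc x' y' z' w' cx.1 hlt.1 hlt.2.1 hlt.2.2 cw.2.1
        (by simp only [hD x' hxo, hD z' hzo, hpx, hpz])
        (by simp only [hD y' (by omega), hD w' hwo, hpy, hpw])
      simp only [hD x' hxo, hD y' (by omega)] at this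
      exact hxy this
    · have := hmono x' y' z' hxo hlt.1 hlt.2.1 (by omega) hxy
      exact hxy (hpx.trans (hpz.symm.trans this.symm))
  -- the walk on the outer circle
  have hfirst : ∀ s, 0 ≤ s → s < 2 * outerHalf k n → ∃ j, 0 ≤ j ∧ j < 2 * outerHalf k n ∧
      π.part (discPt k n a b j) = π.part (discPt k n a b s) ∧
      IsFirst (fun s => π.part (discPt k n a b s)) j ∧
      IsOpener (height k (blockSeq π)) (a + j) (a + s) := by
    intro s hs0 hs
    obtain ⟨j, hj0, hjs, hjβ, hjf⟩ := exists_isFirst (fun s => π.part (discPt k n a b s)) hs0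
    exact ⟨j, hj0, by omega, hjβ, hjf, isOpener_height hk hN h.annular hppnc hgood hj0 hjs hs
      (fun u _ _ => hgen _ (outerPt_mem hN _)) hjβ hjf⟩
  -- The blocks that start on the outer circle consist of exactly the 2N outer points, so the disc
  -- walk is back at 0 after them.
  have hd : height k (blockSeq π) (outerHalf k n) = 0 := by
    have h1 := discWalk_sub (π := π) (a := a) (b := b) (u := 0) (v := 2 * outerHalf k n) (by omega)
    have h2 := sum_firstSize (β := fun s => π.part (discPt k n a b s)) (m := discLen k n) (u := 0)
      (v := 2 * outerHalf k n) le_rfl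
    have h3 : (Finset.Ico 0 (discLen k n)).filter (fun y => ∃ x, 0 ≤ x ∧
        x < 2 * outerHalf k n ∧ IsFirst (fun s => π.part (discPt k n a b s)) x ∧
        π.part (discPt k n a b y) = π.part (discPt k n a b x))
        = Finset.Ico 0 (2 * outerHalf k n) := by
      ext y
      rw [Finset.mem_filter, Finset.mem_Ico, Finset.mem_Ico]
      constructor
      · rintro ⟨hy, x, hx0, hx1, -, hxy⟩
        refine ⟨hy.1, ?_⟩
        by_contra hc
        exact hDne x y hx1 (not_lt.1 hc) hxy.symm
      · rintro ⟨hy0, hy1⟩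
        obtain ⟨j, hj0, hj1, hj2, hj3, -⟩ := hfirst y hy0 hy1
        exact ⟨⟨hy0, by omega⟩, j, hj0, hj1, hj3, hj2.symm⟩
    rw [h3, Int.card_Ico] at h2
    rw [discWalk_zero, discWalk_eq_height hk hN h.annular hgood hgen (by omega) le_rfl,
      height_two hN h.neg_mem] at h1
    have h4 : ((∑ x ∈ Finset.Ico 0 (2 * outerHalf k n),
      firstSize (fun s => π.part (discPt k n a b s)) (discLen k n) x : ℕ) : ℤ)
        = 2 * outerHalf k n := by omega
    push_cast at h4
    linarith
  refine ⟨hd, fun r hr => ?_⟩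
  have ha := isRecord_of_isGoodCut hk hN h.neg_mem h.annular hgood hgen hd.ge
  obtain ⟨e, he, hcut⟩ := exists_cut (n := n) hab (blockSeq π)
  have hdvd : (k : ℤ) ∣ e := by
    rcases he with rfl | rfl
    · exact dvd_zero _
    · exact dvd_refl _
  have c : IsCode k n (blockSeq π) r e :=
    ⟨hk, hN, blockSeq_add hN h.neg_mem, Or.inl hd.le, hr, hdvd⟩
  have hlab : ∀ s, 0 ≤ s → s < 2 * outerHalf k n → ∃ j, 0 ≤ j ∧ j < 2 * outerHalf k n ∧
      π.part (discPt k n a b j) = π.part (discPt k n a b s) ∧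
      IsFirst (fun s => π.part (discPt k n a b s)) j ∧
      label k n (blockSeq π) r e (discPt k n a b s) = (a + j) % (2 * outerHalf k n) := by
    intro s hs0 hs
    obtain ⟨j, hj0, hj1, hjβ, hjf, hop⟩ := hfirst s hs0 hs
    refine ⟨j, hj0, hj1, hjβ, hjf, ?_⟩
    rw [discPt_of_lt hs, c.label_outerPt, outerLabel_of_isOpener hop]
  have hlabi : ∀ s, 2 * outerHalf k n ≤ s → s < discLen k n →
      label k n (blockSeq π) r e (discPt k n a b s)
        = if 2 * outerHalf k n + k ≤ s then -2 else -1 := by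
    intro s hs hsm
    rw [hcut]
    rcases c.label_discPt_of_drift_zero hd ha (by omega) hsm with ⟨h1, -⟩ | ⟨-, h1⟩
    · omega
    · exact h1
  have hmain : π = kerPart k n (label k n (blockSeq π) r e) := by
    refine eq_kerPart fun x hx y hy => ?_
    obtain ⟨s, hs0, hs, rfl⟩ := exists_discPt hk hN a b hx
    obtain ⟨t, ht0, ht, rfl⟩ := exists_discPt hk hN a b hy
    have hnn : ∀ j, 0 ≤ j % (2 * outerHalf k n) := fun j => Int.emod_nonneg _ (by omega)
    rcases lt_or_ge s (2 * outerHalf k n) with hso | hso <;>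
    rcases lt_or_ge t (2 * outerHalf k n) with hto | hto
    · obtain ⟨i, hi0, hi1, hiβ, hif, hil⟩ := hlab s hs0 hso
      obtain ⟨j, hj0, hj1, hjβ, hjf, hjl⟩ := hlab t ht0 hto
      rw [hil, hjl, ← hiβ, ← hjβ]
      constructor
      · intro heq
        rw [eq_of_isFirst hi0 hj0 hif hjf heq]
      · intro heq
        rw [IsCode.emod_inj hi0 hi1 hj0 hj1 heq]
    · obtain ⟨i, hi0, hi1, hiβ, hif, hil⟩ := hlab s hs0 hso
      refine iff_of_false (hDne s t hso hto) ?_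
      rw [hil, hlabi t hto ht]
      have := hnn (a + i)
      split_ifs <;> omega
    · obtain ⟨j, hj0, hj1, hjβ, hjf, hjl⟩ := hlab t ht0 hto
      refine iff_of_false (hDne t s hto hso).symm ?_
      rw [hjl, hlabi s hso hs]
      have := hnn (a + j)
      split_ifs <;> omega
    · rw [hlabi s hso hs, hlabi t hto ht]
      have hg := hgen _ hstart
      rcases lt_or_ge s (2 * outerHalf k n + k) with h1 | h1 <;>
      rcases lt_or_ge t (2 * outerHalf k n + k) with h2 | h2
      · rw [if_neg (by omega), if_neg (by omega), hhigh s hso h1, hhigh t hto h2]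
        simp
      · rw [if_neg (by omega), if_pos h2, hhigh s hso h1, hlow t h2 ht]
        exact iff_of_false hg.symm (by omega)
      · rw [if_pos h1, if_neg (by omega), hlow s h1 hs, hhigh t hto h2]
        exact iff_of_false hg (by omega)
      · rw [if_pos h1, if_pos h2, hlow s h1 hs, hlow t h2 ht]
        simp
  rcases he with rfl | rfl
  · exact hmain
  · have c0 : IsCode k n (blockSeq π) r 0 :=
      ⟨hk, hN, blockSeq_add hN h.neg_mem, Or.inl hd.le, hr, dvd_zero _⟩
    rw [c0.kerPart_add_half hd, zero_add]
    exact hmain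

/-- Every partition of type `D` comes from a code. -/
theorem eq_kerPart_of_isNCD (hk : 1 ≤ k) (hN : 0 < outerHalf k n) (h : IsNCD k n π) :
    (height k (blockSeq π) (outerHalf k n) ≤ 0 ∨ height k (blockSeq π) (outerHalf k n) = k) ∧
    ∀ r, IsRecord (height k (blockSeq π)) (height k (blockSeq π) (outerHalf k n)) r →
      π = kerPart k n (label k n (blockSeq π) r 0) ∨
      height k (blockSeq π) (outerHalf k n) = k ∧
        π = kerPart k n (label k n (blockSeq π) r k) := by
  by_cases hgen : ∀ x ∈ points k n, IsGeneric π x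
  · by_cases htr : ∃ x ∈ points k n, ∃ y ∈ points k n, OnOuter k n x ∧ ¬ OnOuter k n y ∧
      π.part x = π.part y
    · obtain ⟨x, hx, y, hy, hxo, hyi, hxy⟩ := htr
      obtain ⟨hd, hr⟩ := eq_kerPart_of_traversing hk hN h hgen hx hy hxo hyi hxy
      refine ⟨Or.inr hd, fun r hrec => ?_⟩
      rcases hr r hrec with h1 | h1
      · exact Or.inl h1
      · exact Or.inr ⟨hd, h1⟩
    · obtain ⟨hd, hr⟩ := eq_kerPart_of_separated hk hN h hgen (by
        intro V hV
        by_contra hcon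
        rw [not_or, IsOuterBlock, IsInnerBlock] at hcon
        push Not at hcon
        obtain ⟨⟨y, hy, hyi⟩, x, hx, hxo⟩ := hcon
        refine htr ⟨x, π.le hV hx, y, π.le hV hy, hxo, hyi, ?_⟩
        rw [π.part_eq_of_mem hV hx, π.part_eq_of_mem hV hy])
      exact ⟨Or.inl hd.le, fun r hrec => Or.inl (hr r hrec)⟩
  · push Not at hgen
    obtain ⟨z, hz, hzero⟩ := hgen
    obtain ⟨hd, hr⟩ := eq_kerPart_of_zero_block hk hN h hz hzero
    exact ⟨Or.inl hd.le, fun r hrec => Or.inl (hr r hrec)⟩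

end Separated

end TypeD

/-! ### Counting compositions -/

namespace TypeD

section Counting

open Finset

variable {ι : Type*} [DecidableEq ι]

theorem mem_piAntidiag_iff {s : Finset ι} {n : ℕ} {f : ι → ℕ} :
    f ∈ piAntidiag s n ↔ ∑ i ∈ s, f i = n ∧ ∀ i, f i ≠ 0 → i ∈ s := mem_piAntidiag

theorem card_piAntidiag_nat (s : Finset ι) (n : ℕ) :
    (piAntidiag s n).card = s.card.multichoose n := by
  rw [← card_finsuppAntidiag_nat_eq_multichoose, finsuppAntidiag, card_map, card_attach]

/-- Deleting the entry t at i leaves a composition of n - t on the other indices. -/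
theorem card_filter_piAntidiag {s : Finset ι} {i : ι} (hi : i ∈ s) (n t : ℕ) :
    ((piAntidiag s n).filter (fun f => f i = t)).card
      = if t ≤ n then (s.card - 1).multichoose (n - t) else 0 := by
  split_ifs with htn
  · rw [← card_erase_of_mem hi, ← card_piAntidiag_nat]
    refine card_bij' (fun f _ => Function.update f i 0) (fun f _ => Function.update f i t)
      ?_ ?_ ?_ ?_
    · intro f hf
      rw [mem_filter, mem_piAntidiag_iff] at hf
      rw [mem_piAntidiag_iff]
      have h1 := add_sum_erase s f hi
      refine ⟨?_, fun j hj => ?_⟩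
      · rw [sum_update_of_notMem (notMem_erase i s)]
        omega
      · rcases eq_or_ne j i with rfl | hji
        · simp at hj
        · rw [Function.update_of_ne hji] at hj
          exact mem_erase.2 ⟨hji, hf.1.2 j hj⟩
    · intro f hf
      rw [mem_piAntidiag_iff] at hf
      rw [mem_filter, mem_piAntidiag_iff]
      refine ⟨⟨?_, fun j hj => ?_⟩, by simp⟩
      · rw [← add_sum_erase s _ hi, sum_update_of_notMem (notMem_erase i s), hf.1]
        simp only [Function.update_self]
        omega
      · rcases eq_or_ne j i with rfl | hji
        · exact hi
        · rw [Function.update_of_ne hji] at hj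
          exact mem_of_mem_erase (hf.2 j hj)
    · intro f hf
      rw [mem_filter] at hf
      simp [← hf.2]
    · intro f hf
      rw [mem_piAntidiag_iff] at hf
      have : f i = 0 := by
        by_contra hc
        exact notMem_erase i s (hf.2 i hc)
      simp [← this]
  · rw [card_eq_zero, filter_eq_empty_iff]
    intro f hf hft
    rw [mem_piAntidiag_iff] at hf
    have := single_le_sum (f := f) (fun _ _ => Nat.zero_le _) hi
    omega

/-- The number of entries `t` in all compositions of `n`. -/
theorem sum_card_filter_piAntidiag (s : Finset ι) (n t : ℕ) :
    ∑ f ∈ piAntidiag s n, (s.filter (fun i => f i = t)).card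
      = s.card * if t ≤ n then (s.card - 1).multichoose (n - t) else 0 := by
  have h := sum_card_bipartiteAbove_eq_sum_card_bipartiteBelow (s := piAntidiag s n) (t := s)
    (fun f i => f i = t)
  unfold bipartiteAbove bipartiteBelow at h
  rw [h, sum_congr rfl fun i hi => card_filter_piAntidiag hi n t, sum_const, smul_eq_mul]

end Counting

/-- The symmetry of binomial coefficients gives this for r > 0. For r = 0 and t = n both arguments
are -1, and the convention yields the one empty composition of 0. -/
theorem binom_eq_multichoose (r n t : ℕ) :
    binom ((r : ℤ) + n - 1 - t) ((r : ℤ) - 1) = if t ≤ n then r.multichoose (n - t) else 0 := by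
  rw [binom]
  rcases lt_trichotomy t n with h | rfl | h
  · rw [if_neg (by omega), if_pos h.le]
    rcases r with _ | r
    · rw [if_neg (by omega), Nat.multichoose_eq, Nat.choose_eq_zero_of_lt (by omega)]
    · rw [if_pos (by omega), Nat.multichoose_eq,
        ← Nat.choose_symm_of_eq_add (show r + 1 + (n - t) - 1 = r + (n - t) by omega)]
      congr 1 <;> omega
  · rw [if_pos (by ring), if_pos le_rfl, Nat.sub_self, Nat.multichoose_zero_right]
  · rw [if_neg (by omega), if_neg (by omega), if_neg (by omega)]

/-! ### Codes as compositions, and the final count -/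

section Codes

variable {k n : ℕ}

/-- The periodic sequence with the given values. -/
def codeSeq (N : ℤ) (f : ℤ → ℕ) (p : ℤ) : ℕ := f (p % N)

theorem codeSeq_add (N : ℤ) (f : ℤ → ℕ) (p : ℤ) : codeSeq N f (p + N) = codeSeq N f p := by
  rw [codeSeq, codeSeq, Int.add_emod_right]

theorem codeSeq_of_mem {N p : ℤ} (f : ℤ → ℕ) (h : p ∈ Finset.Ico 0 N) :
    codeSeq N f p = f p := by
  rw [Finset.mem_Ico] at h
  rw [codeSeq, Int.emod_eq_of_lt h.1 h.2]

theorem height_outerHalf (hN : 0 < outerHalf k n) (g : ℤ → ℕ) :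
    height k g (outerHalf k n)
      = k * (∑ i ∈ Finset.Ico 0 (outerHalf k n), g i : ℕ) - k * ((n : ℤ) - 1) := by
  have h := walk_sub_walk (fun p => (k : ℤ) * g p - 1) hN.le
  rw [walk_zero, sub_zero] at h
  rw [height, h, Finset.sum_sub_distrib, ← Finset.mul_sum]
  simp only [Finset.sum_const, Int.card_Ico, sub_zero, nsmul_eq_mul, mul_one]
  rw [Int.toNat_of_nonneg hN.le]
  push_cast
  rfl

theorem sum_Ico_neg_one {N : ℤ} (hN : 0 < N) (f : ℤ → ℕ) :
    ∑ i ∈ Finset.Ico (-1) N, f i = f (-1) + ∑ i ∈ Finset.Ico 0 N, f i := by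
  have : Finset.Ico (-1) N = insert (-1) (Finset.Ico 0 N) := by
    ext x; simp only [Finset.mem_Ico, Finset.mem_insert]; omega
  rw [this, Finset.sum_insert (by simp)]

/-- The index -1 holds the missing part n - ∑ g. So f(-1) = 0, f(-1) = 1 and f(-1) ≥ 2 are the cases
of drift k, drift 0 and negative drift. -/
theorem height_codeSeq (hN : 0 < outerHalf k n) {f : ℤ → ℕ}
    (hf : f ∈ Finset.piAntidiag (Finset.Ico (-1) (outerHalf k n)) n) :
    height k (codeSeq (outerHalf k n) f) (outerHalf k n) = k * (1 - (f (-1) : ℤ)) := by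
  rw [height_outerHalf hN, Finset.sum_congr rfl fun i hi => codeSeq_of_mem f hi]
  rw [mem_piAntidiag_iff, sum_Ico_neg_one hN] at hf
  have : ((∑ i ∈ Finset.Ico 0 (outerHalf k n), f i : ℕ) : ℤ) = n - f (-1) := by omega
  rw [this]
  ring

/-- A position at which the height is minimal in the sense required of a code. -/
noncomputable def recordOf (k n : ℕ) (g : ℤ → ℕ) : ℤ :=
  Classical.epsilon (IsRecord (height k g) (height k g (outerHalf k n)))

/-- The partition that belongs to a code. -/
noncomputable def partOf (k n : ℕ) (e : ℤ) (f : ℤ → ℕ) : Finpartition (points k n) :=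
  kerPart k n (label k n (codeSeq (outerHalf k n) f)
    (recordOf k n (codeSeq (outerHalf k n) f)) e)

theorem isRecord_recordOf (hN : 0 < outerHalf k n) {g : ℤ → ℕ}
    (hg : ∀ p, g (p + outerHalf k n) = g p) :
    IsRecord (height k g) (height k g (outerHalf k n)) (recordOf k n g) :=
  Classical.epsilon_spec (exists_isRecord hN (height_add_period hg))

theorem isCode_codeSeq (hk : 1 ≤ k) (hN : 0 < outerHalf k n) {f : ℤ → ℕ}
    (hf : f ∈ Finset.piAntidiag (Finset.Ico (-1) (outerHalf k n)) n) {e : ℤ} (he : (k : ℤ) ∣ e) :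
    IsCode k n (codeSeq (outerHalf k n) f) (recordOf k n (codeSeq (outerHalf k n) f)) e := by
  refine ⟨hk, hN, codeSeq_add _ f, ?_, isRecord_recordOf hN (codeSeq_add _ f), he⟩
  rw [height_codeSeq hN hf]
  rcases Nat.eq_zero_or_pos (f (-1)) with h | h
  · right; simp [h]
  · left
    exact mul_nonpos_of_nonneg_of_nonpos (by omega) (by omega)

theorem piAntidiag_subset (n : ℕ) {N : ℤ} : Finset.piAntidiag (Finset.Ico 0 N) n
    ⊆ Finset.piAntidiag (Finset.Ico (-1) N) n := by
  intro f hf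
  rw [mem_piAntidiag_iff] at *
  refine ⟨?_, fun i hi => Finset.Ico_subset_Ico_left (by omega) (hf.2 i hi)⟩
  rw [← hf.1]
  refine (Finset.sum_subset (Finset.Ico_subset_Ico_left (by omega)) fun i _ hi => ?_).symm
  by_contra hc
  exact hi (hf.2 i hc)

theorem apply_neg_one_of_mem {N : ℤ} {f : ℤ → ℕ}
    (hf : f ∈ Finset.piAntidiag (Finset.Ico 0 N) n) : f (-1) = 0 := by
  rw [mem_piAntidiag_iff] at hf
  by_contra hc
  simpa using hf.2 _ hc

theorem eq_of_partOf_eq (hk : 1 ≤ k) (hN : 0 < outerHalf k n) {f f' : ℤ → ℕ}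
    (hf : f ∈ Finset.piAntidiag (Finset.Ico (-1) (outerHalf k n)) n)
    (hf' : f' ∈ Finset.piAntidiag (Finset.Ico (-1) (outerHalf k n)) n) {e e' : ℤ}
    (he : (k : ℤ) ∣ e) (he' : (k : ℤ) ∣ e') (h : partOf k n e f = partOf k n e' f') : f = f' := by
  have h1 := (isCode_codeSeq hk hN hf he).eq_of_kerPart_eq (isCode_codeSeq hk hN hf' he') h
  have h2 : ∀ i ∈ Finset.Ico 0 (outerHalf k n), f i = f' i := by
    intro i hi
    rw [← codeSeq_of_mem f hi, h1, codeSeq_of_mem f' hi]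
  rw [mem_piAntidiag_iff, sum_Ico_neg_one hN] at hf hf'
  have h3 : ∑ i ∈ Finset.Ico 0 (outerHalf k n), f i = ∑ i ∈ Finset.Ico 0 (outerHalf k n), f' i :=
    Finset.sum_congr rfl h2
  ext i
  by_cases hi : i ∈ Finset.Ico (-1) (outerHalf k n)
  · by_cases hi0 : i ∈ Finset.Ico 0 (outerHalf k n)
    · exact h2 i hi0
    · rw [Finset.mem_Ico] at hi hi0
      have : i = -1 := by omega
      subst this
      omega
  · have h4 : f i = 0 := by
      by_contra hc
      exact hi (hf.2 i hc)
    have h5 : f' i = 0 := by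
      by_contra hc
      exact hi (hf'.2 i hc)
    rw [h4, h5]

-- Compositions into N + 1 parts give the partitions with e = 0. The half turn e = k gives something
-- new only at drift k, that is for f(-1) = 0, which leaves compositions into N parts.
open Classical in
theorem NCD_eq (hk : 1 ≤ k) (hN : 0 < outerHalf k n) : NCD k n =
    (Finset.piAntidiag (Finset.Ico (-1) (outerHalf k n)) n).image (partOf k n 0) ∪
    (Finset.piAntidiag (Finset.Ico 0 (outerHalf k n)) n).image (partOf k n k) := by
  ext π
  rw [NCD, Finset.mem_filter, Finset.mem_union, Finset.mem_image, Finset.mem_image]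
  constructor
  · rintro ⟨-, h⟩
    obtain ⟨hd, hr⟩ := eq_kerPart_of_isNCD hk hN h
    have hper := blockSeq_add hN h.neg_mem
    -- The drift is at most k. Hence the truncated difference n - ∑ that defines f(-1) is a true
    -- one.
    have hsum : ∑ i ∈ Finset.Ico 0 (outerHalf k n), blockSeq π i ≤ n := by
      rw [height_outerHalf hN, ← mul_sub] at hd
      have hkp : (0 : ℤ) < k := by exact_mod_cast hk
      have : ((∑ i ∈ Finset.Ico 0 (outerHalf k n), blockSeq π i : ℕ) : ℤ) - (n - 1) ≤ 1 := by
        rcases hd with hd | hd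
        · by_contra hc
          have := mul_pos hkp (by omega :
            0 < ((∑ i ∈ Finset.Ico 0 (outerHalf k n), blockSeq π i : ℕ) : ℤ) - (n - 1))
          omega
        · exact (mul_left_cancel₀ hkp.ne' (hd.trans (mul_one _).symm)).le
      omega
    obtain ⟨f, hfi, hf1, hf0⟩ : ∃ f : ℤ → ℕ,
        (∀ i ∈ Finset.Ico 0 (outerHalf k n), f i = blockSeq π i) ∧
        f (-1) = n - ∑ i ∈ Finset.Ico 0 (outerHalf k n), blockSeq π i ∧
        ∀ i ∉ Finset.Ico (-1) (outerHalf k n), f i = 0 := by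
      refine ⟨fun i => if i ∈ Finset.Ico 0 (outerHalf k n) then blockSeq π i else
        if i = -1 then n - ∑ i ∈ Finset.Ico 0 (outerHalf k n), blockSeq π i else 0,
        fun i hi => if_pos hi, by simp, fun i hi => ?_⟩
      rw [Finset.mem_Ico] at hi
      simp only [Finset.mem_Ico]
      rw [if_neg (by omega), if_neg (by omega)]
    have hfA : f ∈ Finset.piAntidiag (Finset.Ico (-1) (outerHalf k n)) n := by
      have hfs : ∑ i ∈ Finset.Ico 0 (outerHalf k n), f i
          = ∑ i ∈ Finset.Ico 0 (outerHalf k n), blockSeq π i := Finset.sum_congr rfl hfi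
      rw [mem_piAntidiag_iff, sum_Ico_neg_one hN, hfs, hf1]
      refine ⟨by omega, fun i hi => ?_⟩
      by_contra hc
      exact hi (hf0 i hc)
    have hseq : codeSeq (outerHalf k n) f = blockSeq π := by
      ext p
      obtain ⟨q, hq, h0, h1⟩ := exists_eq_emod_add_mul p hN
      rw [codeSeq, hfi _ (Finset.mem_Ico.2 ⟨h0, h1⟩)]
      conv_rhs => rw [hq]
      rw [periodic_mul hper]
    rcases hr _ (isRecord_recordOf hN hper) with h1 | ⟨h1, h2⟩
    · exact Or.inl ⟨f, hfA, by rw [partOf, hseq, ← h1]⟩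
    · refine Or.inr ⟨f, ?_, by rw [partOf, hseq, ← h2]⟩
      rw [← hseq, height_codeSeq hN hfA] at h1
      have hkp : (0 : ℤ) < k := by exact_mod_cast hk
      have h3 := mul_left_cancel₀ hkp.ne' (h1.trans (mul_one _).symm)
      rw [mem_piAntidiag_iff] at hfA ⊢
      rw [sum_Ico_neg_one hN] at hfA
      refine ⟨by omega, fun i hi => ?_⟩
      have := hfA.2 i hi
      rw [Finset.mem_Ico] at this ⊢
      refine ⟨?_, this.2⟩
      by_contra hc
      have : i = -1 := by omega
      subst this
      omega
  · rintro (⟨f, hf, rfl⟩ | ⟨f, hf, rfl⟩)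
    · exact ⟨Finset.mem_univ _, (isCode_codeSeq hk hN hf (dvd_zero _)).isNCD⟩
    · exact ⟨Finset.mem_univ _, (isCode_codeSeq hk hN (piAntidiag_subset n hf) dvd_rfl).isNCD⟩

theorem card_pairsOfSize_partOf (hk : 1 ≤ k) (hN : 0 < outerHalf k n) {f : ℤ → ℕ}
    (hf : f ∈ Finset.piAntidiag (Finset.Ico (-1) (outerHalf k n)) n) {e : ℤ} (he : (k : ℤ) ∣ e)
    {t : ℕ} (ht : 1 ≤ t) : (pairsOfSize (partOf k n e f).parts (t * k)).card =
      ((Finset.Ico 0 (outerHalf k n)).filter (fun i => f i = t)).card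
        + if f (-1) = t then 1 else 0 := by
  rw [partOf, (isCode_codeSeq hk hN hf he).card_pairsOfSize ht, height_codeSeq hN hf]
  congr 1
  · congr 1
    refine Finset.filter_congr fun i hi => ?_
    rw [codeSeq_of_mem f hi]
  · have hkp : (k : ℤ) ≠ 0 := by omega
    -- The pair of points without opener has size k f(-1), so the additional entry is counted like
    -- all others.
    have : (k : ℤ) - k * (1 - (f (-1) : ℤ)) = t * k ↔ f (-1) = t := by
      rw [show (k : ℤ) - k * (1 - (f (-1) : ℤ)) = f (-1) * k by ring, mul_left_inj' hkp,
        Nat.cast_inj]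
    simp only [this]

theorem sum_card_pairsOfSize (hk : 1 ≤ k) (hN : 0 < outerHalf k n) {t : ℕ} (ht : 1 ≤ t) :
    ∑ π ∈ NCD k n, (pairsOfSize π.parts (t * k)).card =
      (outerHalf k n + 1).toNat *
        (if t ≤ n then ((outerHalf k n + 1).toNat - 1).multichoose (n - t) else 0) +
      (outerHalf k n).toNat *
        (if t ≤ n then ((outerHalf k n).toNat - 1).multichoose (n - t) else 0) := by
  classical
  -- A common partition would have the same code with e = 0 and e = k; at drift k these differ by
  -- half a turn that changes the partition.
  have hdisj : Disjoint
      ((Finset.piAntidiag (Finset.Ico (-1) (outerHalf k n)) n).image (partOf k n 0))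
      ((Finset.piAntidiag (Finset.Ico 0 (outerHalf k n)) n).image (partOf k n k)) := by
    rw [Finset.disjoint_left]
    intro π h1 h2
    obtain ⟨f, hf, rfl⟩ := Finset.mem_image.1 h1
    obtain ⟨f', hf', h⟩ := Finset.mem_image.1 h2
    have hfA := piAntidiag_subset n hf'
    have heq := eq_of_partOf_eq hk hN hfA hf dvd_rfl (dvd_zero _) h
    subst heq
    have c := isCode_codeSeq hk hN hf (dvd_zero (k : ℤ))
    refine c.kerPart_add_half_ne ?_ ?_
    · rw [height_codeSeq hN hf, apply_neg_one_of_mem hf']; simp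
    · rw [zero_add]; exact h.symm
  rw [NCD_eq hk hN, Finset.sum_union hdisj, Finset.sum_image, Finset.sum_image]
  · congr 1
    · rw [show (outerHalf k n + 1).toNat = (Finset.Ico (-1) (outerHalf k n)).card by
        rw [Int.card_Ico, sub_neg_eq_add], ← sum_card_filter_piAntidiag]
      refine Finset.sum_congr rfl fun f hf => ?_
      rw [card_pairsOfSize_partOf hk hN hf (dvd_zero _) ht, Finset.card_filter,
        Finset.card_filter, sum_Ico_neg_one hN (fun i => if f i = t then 1 else 0), add_comm]
    · rw [show (outerHalf k n).toNat = (Finset.Ico 0 (outerHalf k n)).card by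
        rw [Int.card_Ico, sub_zero], ← sum_card_filter_piAntidiag]
      refine Finset.sum_congr rfl fun f hf => ?_
      rw [card_pairsOfSize_partOf hk hN (piAntidiag_subset n hf) dvd_rfl ht,
        apply_neg_one_of_mem hf, if_neg (by omega), add_zero]
  · intro f hf f' hf' h
    exact eq_of_partOf_eq hk hN (piAntidiag_subset n hf) (piAntidiag_subset n hf') dvd_rfl
      dvd_rfl h
  · intro f hf f' hf' h
    exact eq_of_partOf_eq hk hN hf hf' (dvd_zero _) (dvd_zero _) h

end Codes

end TypeD

theorem theorem3 (k n t : ℕ) (hk : 1 ≤ k) (hn : 2 ≤ n) (ht : 1 ≤ t) :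
    ∑ π ∈ TypeD.NCD k n, (TypeD.pairsOfSize π.parts (t * k)).card =
      (k * (n - 1) + 1) *
          TypeD.binom (((k : ℤ) + 1) * ((n : ℤ) - 1) - t) ((k : ℤ) * ((n : ℤ) - 1) - 1) +
        k * (n - 1) *
          TypeD.binom (((k : ℤ) + 1) * ((n : ℤ) - 1) - t - 1) ((k : ℤ) * ((n : ℤ) - 1) - 2) := by
  have hN := TypeD.outerHalf_pos hk hn
  have hm : TypeD.outerHalf k n = (k * (n - 1) : ℕ) := by
    rw [TypeD.outerHalf]
    push_cast [Nat.cast_sub (by omega : 1 ≤ n)]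
    ring
  have hm' : (k : ℤ) * ((n : ℤ) - 1) = (k * (n - 1) : ℕ) := hm
  rw [TypeD.sum_card_pairsOfSize hk hN ht, add_mul (k : ℤ) 1, one_mul, hm', hm]
  rw [hm] at hN
  generalize k * (n - 1) = m at *
  -- With m = k(n-1), the upper argument (k+1)(n-1) - t is m + n - 1 - t; the counts for m + 1 and m
  -- parts leave m and m - 1 parts after one entry t is removed.
  have h1 := TypeD.binom_eq_multichoose m n t
  have h2 := TypeD.binom_eq_multichoose (m - 1) n t
  rw [show ((m : ℤ) + 1).toNat = m + 1 by omega, Int.toNat_natCast, Nat.add_sub_cancel, ← h1, ← h2,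
    Nat.cast_sub (by omega)]
  push_cast
  congr 3 <;> ring_nf
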